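/- Setting. Let $\Gamma$ be a group generated by a finite set $S$, with unit $e$ and word length $|\cdot|$ with respect to $S$, let $r\ge 1$, and let $p=\sum_g p_g\,g\in M_r(\mathbb C)[\Gamma]$ (a finite sum) satisfy $p=p^*$, where $p^*=\sum_g p_g^*\,g^{-1}$. Put $P=\lambda(p)=\sum_g p_g\otimes\lambda(g)$ on $\mathbb C^r\otimes\ell^2(\Gamma)$, with $\lambda(g)\delta_v=\delta_{gv}$, and $R^z=(P-z)^{-1}$, $\Im R^z=(R^z-(R^z)^*)/(2i)$; operators on $\mathbb C^r\otimes\ell^2(\Gamma)$ (resp. $\mathbb C^r\otimes\mathbb C^N$) have blocks $Q(g,h)\in M_r(\mathbb C)$, $g,h\in\Gamma$ (resp. $Q(x,y)$, $x,y\in[N]$). Along a sequence of integers $N\to\infty$ let $\rho_N:\Gamma\to S_N$ be homomorphisms, write $g.x=\rho_N(g)(x)$, and let $\rho_N(g)$ also denote the permutation matrix $(\mathbf 1(x=g.y))_{x,y}$; put $P_N=\rho_N(p)=\sum_g p_g\otimes\rho_N(g)$. Assume that $\rho_N$ converges in distribution to $\lambda$: $\frac1N\mathrm{Tr}\,\rho_N(g)\to0$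 for all $g\ne e$. Let $I_0$ be a compact interval such that for some $C_0\ge1$ $$C_0^{-1}\le\mathrm{Tr}\{(\Im R^{E+i\eta})(e,e)\}\le C_0\qquad\text{for all }E\in I_0,\ 0<\eta\le1,$$ let $I=[a,b]$, $a<b$, be contained in the interior of $I_0$, and let $(\varphi_\alpha)_{1\le\alpha\le rN}$ be any orthonormal eigenbasis of $P_N$, with eigenvalues $\lambda_\alpha$; for $J\subset\mathbb R$ let $\Lambda_J=\{\alpha:\lambda_\alpha\in J\}$. Let $T\subset\Gamma$ be finite and let $K_N\in M_r(\mathbb C)\otimes M_N(\mathbb C)$ be $T$-local, i.e. $K_N(x,y)=0$ unless $x=g.y$ for some $g\in T$, with $\max_{x,y}\|K_N(x,y)\|_2\le1$ (Frobenius norm). Put $\langle K_N\rangle=\sum_{g\in T}k_{N,g}\otimes\rho_N(g)$, where $k_{N,g}=\frac1N\sum_xK_N(g.x,x)$. Theorem. Under any one of the conditions (i), (ii), (iii) below, quantum ergodicity holds in $I$, $$\lim_{N\to\infty}\frac1{|\Lambda_I|}\sum_{\alpha\in\Lambda_I}|\langle\varphi_\alpha,K_N\varphi_\alpha\rangle-\langle\varphi_\alpha,\langle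 K_N\rangle\varphi_\alpha\rangle|^2=0,$$ and quantum mixing holds in $I$: for all $E_1,E_2$ in the interior of $I$, with $J_E^\eta=[E-\eta,E+\eta]$, $$\lim_{\eta\to0}\limsup_{N\to\infty}\frac1{|\Lambda_{J^\eta_{E_1}}|}\sum_{\alpha\in\Lambda_{J^\eta_{E_1}}}\sum_{\beta\in\Lambda_{J^\eta_{E_2}}}|\langle\varphi_\beta,K_N\varphi_\alpha\rangle-\langle\varphi_\beta,\langle K_N\rangle\varphi_\alpha\rangle|^2=0$$ (normalised sums over empty sets are $0$). (i) $(K_N)$ is asymptotically uncorrelated: for every $t\in T$, with $a_N(x)=K_N(t.x,x)\in M_r(\mathbb C)$ and $\langle a_N\rangle=\frac1N\sum_xa_N(x)$, $$\lim_{|g|\to\infty}\sigma(g)=0,\qquad\sigma(g)=\limsup_{N\to\infty}\Big\|\frac1N\sum_x\overline{(a_N(x)-\langle a_N\rangle)}\otimes(a_N(g.x)-\langle a_N\rangle)\Big\|_{\rm op}.$$ (ii) $\Gamma$ has rapid decay with constant $C_1$, the fourth-moment condition holds with some $C_1'>2C_1+1$, and $(K_N(t.x,x))_{x\in[N]}\in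 H_N^\perp$ for all $t\in T$. Here $H_N\subset M_r(\mathbb C)\otimes\mathbb C^N$ are certain subspaces with $\dim H_N=o(N)$, whose existence is part of the claim and which depend only on $T$, $p$ and $(\rho_N)$. (iii) $\Gamma$ has rapid decay with constant $C_1$, the fourth-moment condition holds with some $C_1'>2C_1+1$, $\rho_N$ converges strongly to $\lambda$, and $(K_N(t.x,x))_{x\in[N]}\in M_r(\mathbb C)\otimes1^\perp$ for all $t\in T$, where $1\in\mathbb C^N$ is the constant vector. Rapid decay with constant $C_1>0$ means: for some finite generating set $S'$ and some $C>0$, $\|\lambda(q)\|_{\rm op}\le C\,(\mathrm{diam}_{S'}(q))^{C_1}\,(\sum_g|q_g|^2)^{1/2}$ for all $q\in\mathbb C[\Gamma]$, where $\mathrm{diam}_{S'}(q)$ is the maximum of $1$ and the diameter of the support of $q$ in the left Cayley graph of $(\Gamma,S')$ (edges $g\to sg$). The fourth-moment condition is $$\lim_{\eta\to0}\ \sup_{E\in I}\ \sum_{g\in\Gamma}\eta^2\,\|(\Im R^{E+i\eta})(e,g)\|_2^4\,|g|^{C_1'}=0.$$ Strong convergence means convergence in distribution together with $\|\rho_N(q)|_{1^\perp}\|_{\rm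 op}\to\|\lambda(q)\|_{\rm op}$ for every $q\in\mathbb C[\Gamma]$. -/

import Mathlib

open Filter Topology
open scoped ENNReal Kronecker

namespace QMix

noncomputable section

/-! ### Operators on `ℓ²(Γ, E)` -/

section Operators

/-- The Hilbert space `ℓ²(Γ, E)`; for `E = ℂ^r` this is `ℂ^r ⊗ ℓ²(Γ)`. -/
abbrev L2 (Γ : Type*) (E : Type*) [NormedAddCommGroup E] : Type _ := lp (fun _ : Γ => E) 2

theorem L2.summable_sq {Γ E : Type*} [NormedAddCommGroup E] (f : L2 Γ E) : Summable fun h => ‖f h‖ ^ 2 := by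
  have := (memℓp_gen_iff (p := 2) (by norm_num)).1 (lp.memℓp f)
  simpa using this

theorem L2.norm_sq {Γ E : Type*} [NormedAddCommGroup E] (f : L2 Γ E) : ‖f‖ ^ 2 = ∑' h, ‖f h‖ ^ 2 := by
  have := lp.norm_rpow_eq_tsum (p := 2) (by norm_num) f
  simpa using this

variable {Γ : Type*} [Group Γ] {E : Type*} [NormedAddCommGroup E] [InnerProductSpace ℂ E]

/-- Left translation by `g`, `(λ(g) f)(h) = f(g⁻¹ h)`, so that `λ(g) δ_v = δ_{gv}`. -/
def translate (g : Γ) : L2 Γ E →L[ℂ] L2 Γ E :=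
  LinearMap.mkContinuous
    { toFun := fun f => ⟨fun h => f (g⁻¹ * h), by
        refine memℓp_gen ?_
        simpa [Function.comp_def] using
          (Equiv.mulLeft g⁻¹).summable_iff.2 (L2.summable_sq f)⟩
      map_add' := fun _ _ => rfl
      map_smul' := fun _ _ => rfl } 1 (by
    intro f
    rw [one_mul]
    refine le_of_sq_le_sq ?_ (norm_nonneg _)
    rw [L2.norm_sq, L2.norm_sq]
    exact ((Equiv.mulLeft g⁻¹).tsum_eq fun h => ‖f h‖ ^ 2).le)

/-- The operator `A ⊗ 1` applying `A` in each fibre, `(f_h)_h ↦ (A f_h)_h`. -/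
def fibreMap (A : E →L[ℂ] E) : L2 Γ E →L[ℂ] L2 Γ E :=
  LinearMap.mkContinuous
    { toFun := fun f => ⟨fun h => A (f h), by
        refine memℓp_gen ?_
        have h2 : Summable fun h => ‖A‖ ^ 2 * ‖f h‖ ^ 2 := (L2.summable_sq f).mul_left _
        have : Summable fun h => ‖A (f h)‖ ^ 2 :=
          Summable.of_nonneg_of_le (fun _ => by positivity) (fun h => by
            rw [← mul_pow]; gcongr; exact A.le_opNorm _) h2
        simpa using this⟩
      map_add' := fun f g => by ext h; exact A.map_add _ _
      map_smul' := fun c f => by ext h; exact A.map_smul _ _ } ‖A‖ (by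
    intro f
    refine le_of_sq_le_sq ?_ (by positivity)
    rw [mul_pow, L2.norm_sq, L2.norm_sq, ← tsum_mul_left]
    have h2 : Summable fun h => ‖A‖ ^ 2 * ‖f h‖ ^ 2 := (L2.summable_sq f).mul_left _
    have hle : ∀ h, ‖A (f h)‖ ^ 2 ≤ ‖A‖ ^ 2 * ‖f h‖ ^ 2 := fun h => by
      rw [← mul_pow]; gcongr; exact A.le_opNorm _
    exact (Summable.of_nonneg_of_le (fun _ => by positivity) hle h2).tsum_le_tsum hle h2)

end Operators

/-! ### Group algebras, regular representation, permutation representations -/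

section Algebra

variable {Γ : Type*} [Group Γ] {r : ℕ}

/-- `λ(p) = ∑_g p_g λ(g)` on `ℓ²(Γ)`, for `p ∈ ℂ[Γ]`. -/
def regRep (p : MonoidAlgebra ℂ Γ) : L2 Γ ℂ →L[ℂ] L2 Γ ℂ :=
  ∑ g ∈ p.coeff.support, p.coeff g • translate g

/-- `M_r(ℂ)[Γ]`. -/
abbrev MatAlg (r : ℕ) (Γ : Type*) : Type _ := MonoidAlgebra (Matrix (Fin r) (Fin r) ℂ) Γ

/-- `p = p^*`, where `p^* = ∑_g p_g^* g⁻¹`. -/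
def IsSelfAdj (p : MatAlg r Γ) : Prop :=
  ∀ g : Γ, p.coeff g⁻¹ = (p.coeff g).conjTranspose

/-- `λ(p) = ∑_g p_g ⊗ λ(g)` on `ℂ^r ⊗ ℓ²(Γ)`, for `p ∈ M_r(ℂ)[Γ]`. -/
def matRegRep (p : MatAlg r Γ) :
    L2 Γ (EuclideanSpace ℂ (Fin r)) →L[ℂ] L2 Γ (EuclideanSpace ℂ (Fin r)) :=
  ∑ g ∈ p.coeff.support,
    (fibreMap (Matrix.toEuclideanCLM (n := Fin r) (𝕜 := ℂ) (p.coeff g))).comp (translate g)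

/-- The permutation matrix with entries `1(x = σ y)`. -/
def permMat {N : ℕ} (σ : Equiv.Perm (Fin N)) : Matrix (Fin N) (Fin N) ℂ :=
  Matrix.of fun x y => if x = σ y then 1 else 0

/-- `ρ(p) = ∑_g p_g ρ(g)`, for `p ∈ ℂ[Γ]`. -/
def permRep {N : ℕ} (ρ : Γ →* Equiv.Perm (Fin N)) (p : MonoidAlgebra ℂ Γ) :
    Matrix (Fin N) (Fin N) ℂ :=
  ∑ g ∈ p.coeff.support, p.coeff g • permMat (ρ g)

/-- `M_r(ℂ) ⊗ M_N(ℂ)`. -/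
abbrev BMat (r N : ℕ) : Type := Matrix (Fin r × Fin N) (Fin r × Fin N) ℂ

/-- `ρ(p) = ∑_g p_g ⊗ ρ(g)`, for `p ∈ M_r(ℂ)[Γ]`. -/
def matPermRep {N : ℕ} (ρ : Γ →* Equiv.Perm (Fin N)) (p : MatAlg r Γ) : BMat r N :=
  ∑ g ∈ p.coeff.support, p.coeff g ⊗ₖ permMat (ρ g)

/-- The block `K(x, y) ∈ M_r(ℂ)`. -/
def block {N : ℕ} (K : BMat r N) (x y : Fin N) : Matrix (Fin r) (Fin r) ℂ :=
  Matrix.of fun i j => K (i, x) (j, y)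

/-- The Frobenius norm. -/
def frob (A : Matrix (Fin r) (Fin r) ℂ) : ℝ := √(∑ i, ∑ j, ‖A i j‖ ^ 2)

end Algebra

/-! ### Word length and rapid decay -/

section Word

variable {Γ : Type*} [Group Γ]

/-- The word length of `g` with respect to `S ∪ S⁻¹`. -/
def wordLength (S : Finset Γ) (g : Γ) : ℕ :=
  sInf {n | ∃ l : List Γ, (∀ s ∈ l, s ∈ S ∨ s⁻¹ ∈ S) ∧ l.prod = g ∧ l.length = n}

/-- The maximum of one and the diameter of the support of `p` in the left Cayley graph, whose
edges join `g` to `s g`; there the distance between `g` and `h` is the length of `g h⁻¹`. -/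
def suppDiam (S : Finset Γ) (p : MonoidAlgebra ℂ Γ) : ℕ :=
  max 1 ((p.coeff.support ×ˢ p.coeff.support).sup fun gh => wordLength S (gh.1 * gh.2⁻¹))

/-- `Γ` has the rapid decay property with exponent `C₁`. -/
def HasRD (Γ : Type*) [Group Γ] (C₁ : ℝ) : Prop :=
  0 < C₁ ∧ ∃ S : Finset Γ, Subgroup.closure (S : Set Γ) = ⊤ ∧ ∃ C : ℝ, 0 < C ∧
    ∀ p : MonoidAlgebra ℂ Γ,
      ‖regRep p‖ ≤ C * (suppDiam S p : ℝ) ^ C₁ * √(∑ g ∈ p.coeff.support, ‖p.coeff g‖ ^ 2)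

end Word

/-! ### The resolvent of `λ(p)` and the spectral assumptions -/

section Resolvent

variable {Γ : Type*} [Group Γ] {r : ℕ}

/-- `R^z = (λ(p) - z)⁻¹`. -/
def resolv (p : MatAlg r Γ) (z : ℂ) :
    L2 Γ (EuclideanSpace ℂ (Fin r)) →L[ℂ] L2 Γ (EuclideanSpace ℂ (Fin r)) :=
  Ring.inverse (matRegRep p - z • (1 : _ →L[ℂ] _))

/-- `Im R^z = (R^z - (R^z)^*) / (2i)`. -/
def imResolv (p : MatAlg r Γ) (z : ℂ) :
    L2 Γ (EuclideanSpace ℂ (Fin r)) →L[ℂ] L2 Γ (EuclideanSpace ℂ (Fin r)) :=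
  (1 / (2 * Complex.I)) • (resolv p z - ContinuousLinearMap.adjoint (resolv p z))

open scoped Classical in
/-- The block `Q(g, h) ∈ M_r(ℂ)` of an operator on `ℂ^r ⊗ ℓ²(Γ)`. -/
def opBlock (Q : L2 Γ (EuclideanSpace ℂ (Fin r)) →L[ℂ] L2 Γ (EuclideanSpace ℂ (Fin r)))
    (g h : Γ) : Matrix (Fin r) (Fin r) ℂ :=
  Matrix.of fun i j =>
    (Q (lp.single (E := fun _ : Γ => EuclideanSpace ℂ (Fin r)) 2 h
      (EuclideanSpace.single j (1 : ℂ)))) g i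

/-- `C₀⁻¹ ≤ Tr (Im R^{E + iη})(e,e) ≤ C₀` for all `E ∈ [a₀, b₀]` and `0 < η ≤ 1`. -/
def ACOn (p : MatAlg r Γ) (a₀ b₀ : ℝ) : Prop :=
  ∃ C₀ : ℝ, 1 ≤ C₀ ∧ ∀ E ∈ Set.Icc a₀ b₀, ∀ η ∈ Set.Ioc (0 : ℝ) 1,
    C₀⁻¹ ≤ (opBlock (imResolv p (E + η * Complex.I)) 1 1).trace.re ∧
      (opBlock (imResolv p (E + η * Complex.I)) 1 1).trace.re ≤ C₀

/-- The fourth moment condition on `[a, b]` with exponent `C₁'`: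
`sup_{E ∈ [a, b]} ∑_g η² ‖(Im R^{E + iη})(e,g)‖₂⁴ |g|^{C₁'} → 0` as `η → 0`. -/
def FourthMoment (S : Finset Γ) (p : MatAlg r Γ) (a b C₁' : ℝ) : Prop :=
  Tendsto (fun η : ℝ => ⨆ E ∈ Set.Icc a b, ∑' g : Γ, ENNReal.ofReal
      (η ^ 2 * frob (opBlock (imResolv p (E + η * Complex.I)) 1 g) ^ 4
        * (wordLength S g : ℝ) ^ C₁'))
    (𝓝[>] 0) (𝓝 0)

end Resolvent

/-! ### Sequences of permutation representations -/

section Sequences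

variable {Γ : Type*} [Group Γ] {r : ℕ} {d : ℕ → ℕ}

/-- Convergence in distribution to the regular representation. -/
def ConvDistrib (ρ : ∀ k, Γ →* Equiv.Perm (Fin (d k))) : Prop :=
  ∀ g : Γ, g ≠ 1 →
    Tendsto (fun k => (1 / (d k : ℂ)) * (permMat (ρ k g)).trace) atTop (𝓝 0)

/-- The vector `1 ∈ ℂ^N`. -/
def onesVec (N : ℕ) : EuclideanSpace ℂ (Fin N) := WithLp.toLp 2 fun _ => 1

/-- Strong convergence in distribution to the regular representation: the operator norm of
`ρ_N(p)` restricted to `1^⊥` converges to that of `λ(p)` for every `p ∈ ℂ[Γ]`. -/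
def ConvStrong (ρ : ∀ k, Γ →* Equiv.Perm (Fin (d k))) : Prop :=
  ConvDistrib ρ ∧ ∀ p : MonoidAlgebra ℂ Γ,
    Tendsto (fun k => ‖(Matrix.toEuclideanCLM (n := Fin (d k)) (𝕜 := ℂ) (permRep (ρ k) p)).comp
        (Submodule.span ℂ {onesVec (d k)})ᗮ.subtypeL‖)
      atTop (𝓝 ‖regRep p‖)

/-- `φ` is an orthonormal basis of eigenvectors of `P`, with eigenvalues `ev`. -/
def IsEigenbasis {N : ℕ} (P : BMat r N)
    (φ : OrthonormalBasis (Fin (r * N)) ℂ (EuclideanSpace ℂ (Fin r × Fin N)))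
    (ev : Fin (r * N) → ℝ) : Prop :=
  ∀ α, Matrix.toEuclideanLin P (φ α) = (ev α : ℂ) • φ α

/-! ### Observables -/

/-- `K` is `T`-local: `K(x, y) = 0` unless `x = g.y` for some `g ∈ T`. -/
def IsLocal {N : ℕ} (ρ : Γ →* Equiv.Perm (Fin N)) (T : Finset Γ) (K : BMat r N) : Prop :=
  ∀ x y : Fin N, (¬ ∃ g ∈ T, x = ρ g y) → block K x y = 0

/-- `‖K‖_{1,∞} = max_{x,y} ‖K(x, y)‖₂ ≤ 1`. -/
def IsBddOne {N : ℕ} (K : BMat r N) : Prop := ∀ x y : Fin N, frob (block K x y) ≤ 1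

/-- The matrix-valued function `x ↦ K(t.x, x)`. -/
def diagAt {N : ℕ} (ρ : Γ →* Equiv.Perm (Fin N)) (K : BMat r N) (t : Γ) (x : Fin N) :
    Matrix (Fin r) (Fin r) ℂ :=
  block K (ρ t x) x

/-- The average `(1/N) ∑_x a(x)`. -/
def avg {N : ℕ} (a : Fin N → Matrix (Fin r) (Fin r) ℂ) : Matrix (Fin r) (Fin r) ℂ :=
  (1 / (N : ℂ)) • ∑ x, a x

/-- `⟨K⟩ = ∑_{g ∈ T} k_g ⊗ ρ(g)` with `k_g = (1/N) ∑_x K(g.x, x)`. -/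
def centre {N : ℕ} (ρ : Γ →* Equiv.Perm (Fin N)) (T : Finset Γ) (K : BMat r N) : BMat r N :=
  ∑ g ∈ T, avg (diagAt ρ K g) ⊗ₖ permMat (ρ g)

/-- The vector `(K(t.x, x))_x` of `M_r(ℂ) ⊗ ℂ^N`, with its Hilbert space structure. -/
def diagVec {N : ℕ} (ρ : Γ →* Equiv.Perm (Fin N)) (K : BMat r N) (t : Γ) :
    EuclideanSpace ℂ (Fin N × Fin r × Fin r) :=
  WithLp.toLp 2 fun v => diagAt ρ K t v.1 v.2.1 v.2.2

/-- The empirical covariance `(1/N) ∑_x conj(a(x) - ⟨a⟩) ⊗ (a(g.x) - ⟨a⟩)`. -/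
def empCov {N : ℕ} (ρ : Γ →* Equiv.Perm (Fin N)) (a : Fin N → Matrix (Fin r) (Fin r) ℂ) (g : Γ) :
    Matrix (Fin r × Fin r) (Fin r × Fin r) ℂ :=
  (1 / (N : ℂ)) • ∑ x, ((a x - avg a).map (starRingEnd ℂ)) ⊗ₖ (a (ρ g x) - avg a)

/-- The asymptotic covariance `σ(g)`: the upper limit of the operator norms of the empirical
covariances. -/
def asympCov (ρ : ∀ k, Γ →* Equiv.Perm (Fin (d k)))
    (a : ∀ k, Fin (d k) → Matrix (Fin r) (Fin r) ℂ) (g : Γ) : ℝ≥0∞ :=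
  limsup (fun k => ENNReal.ofReal
    ‖Matrix.toEuclideanCLM (n := Fin r × Fin r) (𝕜 := ℂ) (empCov (ρ k) (a k) g)‖) atTop

/-- `(K_N)` is asymptotically uncorrelated: for `t ∈ T`, the asymptotic covariance of
`x ↦ K_N(t.x, x)` tends to zero as `|g| → ∞`. -/
def AsympUncorr (S : Finset Γ) (ρ : ∀ k, Γ →* Equiv.Perm (Fin (d k))) (T : Finset Γ)
    (K : ∀ k, BMat r (d k)) : Prop :=
  ∀ t ∈ T, Tendsto (asympCov ρ fun k => diagAt (ρ k) (K k) t)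
    (comap (wordLength S) atTop) (𝓝 0)

/-! ### Quantum ergodicity and quantum mixing -/

open scoped Classical in
/-- `Λ_J`, the set of indices `α` with eigenvalue in `J`. -/
def eigSet {n : ℕ} (ev : Fin n → ℝ) (J : Set ℝ) : Finset (Fin n) :=
  Finset.univ.filter fun α => ev α ∈ J

/-- The matrix coefficient `⟨φ_β, A φ_α⟩`. -/
def coef {N : ℕ} (φ : OrthonormalBasis (Fin (r * N)) ℂ (EuclideanSpace ℂ (Fin r × Fin N)))
    (A : BMat r N) (β α : Fin (r * N)) : ℂ :=
  inner ℂ (φ β) (Matrix.toEuclideanLin A (φ α))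

/-- Quantum ergodicity in `I`. -/
def QErgodic (ρ : ∀ k, Γ →* Equiv.Perm (Fin (d k))) (T : Finset Γ)
    (φ : ∀ k, OrthonormalBasis (Fin (r * d k)) ℂ (EuclideanSpace ℂ (Fin r × Fin (d k))))
    (ev : ∀ k, Fin (r * d k) → ℝ) (K : ∀ k, BMat r (d k)) (I : Set ℝ) : Prop :=
  Tendsto (fun k => (1 / ((eigSet (ev k) I).card : ℝ)) * ∑ α ∈ eigSet (ev k) I,
      ‖coef (φ k) (K k) α α - coef (φ k) (centre (ρ k) T (K k)) α α‖ ^ 2)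
    atTop (𝓝 0)

/-- Quantum mixing (small-scale quantum weak mixing) in `I`; with `J_E^η = [E - η, E + η]`. -/
def QMixing (ρ : ∀ k, Γ →* Equiv.Perm (Fin (d k))) (T : Finset Γ)
    (φ : ∀ k, OrthonormalBasis (Fin (r * d k)) ℂ (EuclideanSpace ℂ (Fin r × Fin (d k))))
    (ev : ∀ k, Fin (r * d k) → ℝ) (K : ∀ k, BMat r (d k)) (I : Set ℝ) : Prop :=
  ∀ E₁ ∈ interior I, ∀ E₂ ∈ interior I,
    Tendsto (fun η : ℝ => limsup (fun k => ENNReal.ofReal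
        ((1 / ((eigSet (ev k) (Set.Icc (E₁ - η) (E₁ + η))).card : ℝ)) *
          ∑ α ∈ eigSet (ev k) (Set.Icc (E₁ - η) (E₁ + η)),
            ∑ β ∈ eigSet (ev k) (Set.Icc (E₂ - η) (E₂ + η)),
              ‖coef (φ k) (K k) β α - coef (φ k) (centre (ρ k) T (K k)) β α‖ ^ 2)) atTop)
      (𝓝[>] 0) (𝓝 0)

end Sequences

end

end QMix

open QMix

set_option linter.unusedSectionVars false

/-! Replace sharp spectral windows by Poisson kernels, the functions `x ↦ Im (x - z)⁻¹` with `z = E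
+ iη`. The smoothed variance `qvar` is then the trace of `K* (Im R_N^{z₂}) K (Im R_N^{z₁})`, where
`R_N^z = (P_N - z)⁻¹`. The double sum over two windows of half-width `η` is at most `4η² qvar`
(`sum_window_le`), while a window centred in `I` contains at least a constant times `ηN` eigenvalues
(`eventually_card_eigSet_ge`). Mixing therefore follows once `η · qvar / N` is small, with `N → ∞`
before `η → 0`; ergodicity follows by covering `I` with such windows.

To compute `qvar / N`, approximate the kernels by polynomials on an interval containing every
spectrum. For `K = E_{li} ⊗ ρ(t) diag(u)` the trace is a sum over pairs `(g, h)` of contributions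
from the fixed points of `t⁻¹htg`. Convergence in distribution leaves only `h = tg⁻¹t⁻¹`, hence `∑_g
c_g corr_u(g)`, where `c_g` is a product of two resolvent entries (`qvar_piece_le`). Up to an error
of squared Hilbert–Schmidt norm `o(N)`, `K - ⟨K⟩` is a finite sum of such pieces with `u` a centred
entry (`sub_centre_eq`).

It remains to make `η ∑_g c_g corr_u(g)` small. In case (i), `|c_g|` is bounded and `η ∑_g |c_g|` is
bounded by a Ward inequality (`resolvCoef_bounds`): finitely many `g` cost `O(η)`, the others have
small correlation. In cases (ii) and (iii) the sum is `(1/N)⟨u, ρ_N(w) u⟩` for an element `w` of the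
group algebra that does not depend on `N`. On the orthogonal complement of a small subspace `ρ_N(w)`
is bounded by nearly `‖λ(w)‖`. Rapid decay bounds this by `|w_1|` plus a weighted `ℓ²` norm
(`HasRD.exists_weighted_bound`), which the fourth-moment condition makes small. Under strong
convergence the subspace is `ℂ1`; in general it is spanned by `1` and the singular vectors of
`ρ_N(q)` with singular value above 1, for a growing finite family of `q` with `‖λ(q)‖ < 1`. High
moments show that there are only `o(N)` of these (`exists_permBound`). -/

namespace QMix

noncomputable section

/-! ### Representations of the group algebras and their polynomial calculus -/

section Reps

variable {Γ : Type*} [Group Γ] {E : Type*} [NormedAddCommGroup E] [InnerProductSpace ℂ E]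

@[simp] theorem translate_apply (g : Γ) (f : L2 Γ E) (h : Γ) : translate g f h = f (g⁻¹ * h) := rfl

@[simp] theorem fibreMap_apply (A : E →L[ℂ] E) (f : L2 Γ E) (h : Γ) : fibreMap A f h = A (f h) := rfl

variable (Γ E) in
/-- Left translation as a representation. -/
def translateHom : Γ →* (L2 Γ E →L[ℂ] L2 Γ E) where
  toFun := translate
  map_one' := by ext f h; simp
  map_mul' g g' := by ext f h; simp [mul_assoc]

variable (Γ E) in
/-- The ampliation `A ↦ A ⊗ 1` as an algebra homomorphism. -/
def fibreMapHom : (E →L[ℂ] E) →ₐ[ℝ] (L2 Γ E →L[ℂ] L2 Γ E) where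
  toFun := fibreMap
  map_one' := by ext f h; simp
  map_mul' A B := by ext f h; simp
  map_zero' := by ext f h; simp
  map_add' A B := by ext f h; simp
  commutes' c := by
    ext f h
    simp [Algebra.algebraMap_eq_smul_one]

theorem adjoint_translate [CompleteSpace E] (g : Γ) :
    ContinuousLinearMap.adjoint (translate g : L2 Γ E →L[ℂ] L2 Γ E) = translate g⁻¹ := by
  symm
  rw [ContinuousLinearMap.eq_adjoint_iff]
  intro x y
  rw [lp.inner_eq_tsum, lp.inner_eq_tsum, ← (Equiv.mulLeft g⁻¹).tsum_eq]
  simp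

theorem adjoint_fibreMap [CompleteSpace E] (A : E →L[ℂ] E) :
    ContinuousLinearMap.adjoint (fibreMap A : L2 Γ E →L[ℂ] L2 Γ E)
      = fibreMap (ContinuousLinearMap.adjoint A) := by
  symm
  rw [ContinuousLinearMap.eq_adjoint_iff]
  intro x y
  rw [lp.inner_eq_tsum, lp.inner_eq_tsum]
  simp [ContinuousLinearMap.adjoint_inner_left]

variable {r : ℕ}

/-- `λ` on `M_r(ℂ)[Γ]` as an algebra homomorphism. -/
def matRegHom : MatAlg r Γ →ₐ[ℝ]
    (L2 Γ (EuclideanSpace ℂ (Fin r)) →L[ℂ] L2 Γ (EuclideanSpace ℂ (Fin r))) :=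
  MonoidAlgebra.liftNCAlgHom
    ((fibreMapHom Γ (EuclideanSpace ℂ (Fin r))).comp
      ((Matrix.toEuclideanCLM (n := Fin r) (𝕜 := ℂ)).toAlgEquiv.toAlgHom.restrictScalars ℝ))
    (translateHom Γ (EuclideanSpace ℂ (Fin r)))
    (fun A g => by ext f h; simp [fibreMapHom, translateHom])

theorem matRegHom_apply (q : MatAlg r Γ) : matRegHom q = matRegRep q := rfl

/-- The ampliation `A ↦ A ⊗ 1`. -/
def kronOneHom (r N : ℕ) : Matrix (Fin r) (Fin r) ℂ →ₐ[ℝ] BMat r N where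
  toFun A := A ⊗ₖ (1 : Matrix (Fin N) (Fin N) ℂ)
  map_one' := by simp
  map_mul' A B := by rw [← Matrix.mul_kronecker_mul, one_mul]
  map_zero' := by simp
  map_add' A B := Matrix.add_kronecker ..
  commutes' c := by simp [Algebra.algebraMap_eq_smul_one, Matrix.smul_kronecker]

/-- Permutation matrices as a representation. -/
def permMatHom {N : ℕ} : Equiv.Perm (Fin N) →* Matrix (Fin N) (Fin N) ℂ where
  toFun := permMat
  map_one' := by ext x y; simp [permMat, Matrix.one_apply]; congr
  map_mul' σ τ := by
    ext x y
    simp [permMat, Matrix.mul_apply]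
    congr

/-- `ρ` on `M_r(ℂ)[Γ]` as an algebra homomorphism. -/
def matPermHom {N : ℕ} (ρ : Γ →* Equiv.Perm (Fin N)) : MatAlg r Γ →ₐ[ℝ] BMat r N :=
  MonoidAlgebra.liftNCAlgHom (kronOneHom r N)
    { toFun := fun g => (1 : Matrix (Fin r) (Fin r) ℂ) ⊗ₖ permMat (ρ g)
      map_one' := by
        have := (permMatHom (N := N)).map_one
        simp only [permMatHom, MonoidHom.coe_mk, OneHom.coe_mk] at this
        simp [this]
      map_mul' := fun g h => by
        have := (permMatHom (N := N)).map_mul (ρ g) (ρ h)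
        simp only [permMatHom, MonoidHom.coe_mk, OneHom.coe_mk] at this
        rw [map_mul, this, ← Matrix.mul_kronecker_mul, one_mul] }
    (fun A g => by
      simp only [Commute, SemiconjBy, kronOneHom, MonoidHom.coe_mk, OneHom.coe_mk, AlgHom.coe_mk,
        RingHom.coe_mk]
      rw [← Matrix.mul_kronecker_mul, ← Matrix.mul_kronecker_mul]
      simp)

theorem matPermHom_apply {N : ℕ} (ρ : Γ →* Equiv.Perm (Fin N)) (q : MatAlg r Γ) :
    matPermHom ρ q = matPermRep ρ q := by
  refine Finset.sum_congr rfl fun g _ => ?_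
  change (q.coeff g ⊗ₖ (1 : Matrix (Fin N) (Fin N) ℂ))
    * ((1 : Matrix (Fin r) (Fin r) ℂ) ⊗ₖ permMat (ρ g)) = _
  rw [← Matrix.mul_kronecker_mul]
  simp

theorem matRegRep_aeval (p : MatAlg r Γ) (Q : Polynomial ℝ) :
    matRegRep (Polynomial.aeval p Q) = Polynomial.aeval (matRegRep p) Q := by
  rw [← matRegHom_apply, ← matRegHom_apply, Polynomial.aeval_algHom_apply]

theorem matPermRep_aeval {N : ℕ} (ρ : Γ →* Equiv.Perm (Fin N)) (p : MatAlg r Γ)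
    (Q : Polynomial ℝ) :
    matPermRep ρ (Polynomial.aeval p Q) = Polynomial.aeval (matPermRep ρ p) Q := by
  rw [← matPermHom_apply, ← matPermHom_apply, Polynomial.aeval_algHom_apply]

-- Passes between operators and the group algebra: blocks of a polynomial in `λ(p)` are
-- coefficients, and they depend only on `g * h⁻¹`.
open scoped Classical in
theorem opBlock_matRegRep (q : MatAlg r Γ) (g h : Γ) :
    opBlock (matRegRep q) g h = q.coeff (g * h⁻¹) := by
  ext i j
  rw [opBlock, Matrix.of_apply, matRegRep, sum_apply, lp.coeFn_sum,
    Finset.sum_apply, WithLp.ofLp_sum, Finset.sum_apply,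
    Finset.sum_eq_single (g * h⁻¹)]
  · rw [ContinuousLinearMap.comp_apply, fibreMap_apply, translate_apply]
    simp [mul_assoc, Matrix.ofLp_toEuclideanCLM]
  · intro k _ hk
    rw [ContinuousLinearMap.comp_apply, fibreMap_apply, translate_apply, lp.single_apply_ne]
    · simp
    · intro hh
      apply hk
      rw [← hh]
      group
  · intro hk
    rw [Finsupp.notMem_support_iff] at hk
    simp [hk, fibreMap]

theorem isSelfAdjoint_matRegRep {p : MatAlg r Γ} (hp : IsSelfAdj p) :
    IsSelfAdjoint (matRegRep p) := by
  rw [ContinuousLinearMap.isSelfAdjoint_iff']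
  rw [matRegRep, map_sum]
  refine Finset.sum_bij' (fun g _ => g⁻¹) (fun g _ => g⁻¹) ?_ ?_ ?_ ?_ ?_
  · intro g hg
    simpa [hp g] using hg
  · intro g hg
    simpa [hp g] using hg
  · simp
  · simp
  · intro g hg
    rw [ContinuousLinearMap.adjoint_comp, adjoint_translate, adjoint_fibreMap, hp g]
    have : (Matrix.toEuclideanCLM (n := Fin r) (𝕜 := ℂ)) (p.coeff g).conjTranspose
        = ContinuousLinearMap.adjoint (Matrix.toEuclideanCLM (n := Fin r) (𝕜 := ℂ) (p.coeff g)) :=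
      map_star (Matrix.toEuclideanCLM (n := Fin r) (𝕜 := ℂ)) (p.coeff g)
    rw [this]
    ext f h
    simp

end Reps

/-- The function `x ↦ Im (x - (E + iη))⁻¹`. -/
def poisson (E η x : ℝ) : ℝ := η / ((x - E) ^ 2 + η ^ 2)

theorem poisson_pos {E η : ℝ} (hη : 0 < η) (x : ℝ) : 0 < poisson E η x := by
  unfold poisson; positivity

theorem poisson_le {E η : ℝ} (hη : 0 < η) (x : ℝ) : poisson E η x ≤ η⁻¹ := by
  unfold poisson
  rw [div_le_iff₀ (by positivity), inv_mul_eq_div, le_div_iff₀ hη]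
  nlinarith [sq_nonneg (x - E)]

theorem continuous_poisson {E η : ℝ} (hη : 0 < η) : Continuous (poisson E η) := by
  unfold poisson
  refine continuous_const.div (by fun_prop) fun x => ?_
  positivity

/-! ### The imaginary part of the resolvent: functional calculus and entry bounds -/

section Resolvent

variable {Γ : Type*} [Group Γ] {r : ℕ}

section General

variable {H : Type*} [NormedAddCommGroup H] [InnerProductSpace ℂ H] [CompleteSpace H]

/-- The imaginary part of the resolvent of an operator. -/
def imInv (A : H →L[ℂ] H) (z : ℂ) : H →L[ℂ] H :=
  (1 / (2 * Complex.I)) • (Ring.inverse (A - z • (1 : H →L[ℂ] H))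
      - ContinuousLinearMap.adjoint (Ring.inverse (A - z • (1 : H →L[ℂ] H))))

/-- Since `(A - z̄)(A - z) = (A - E)² + η²`, the operator `W = cfc (poisson E η) A` satisfies `W (A
- z̄)(A - z) = η`. Hence `(A - z)⁻¹ = η⁻¹ (A - z̄) W`, and subtracting the adjoint leaves `η⁻¹ (z -
z̄) W = 2i W`. -/
theorem imInv_eq_cfc {A : H →L[ℂ] H} (hA : IsSelfAdjoint A) {E η : ℝ} (hη : 0 < η) :
    imInv A (E + η * Complex.I) = cfc (poisson E η) A := by
  unfold imInv
  set z : ℂ := E + η * Complex.I with hz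
  set W := cfc (poisson E η) A with hW
  have hWsa : IsSelfAdjoint W := cfc_predicate _ _
  have hcont : Continuous (poisson E η) := continuous_poisson hη
  have hAW : A * W = W * A := by
    have := cfc_commute_cfc (R := ℝ) id (poisson E η) A
    rwa [cfc_id ℝ A, ← hW] at this
  have hD : W * ((A - (E : ℂ) • 1) * (A - (E : ℂ) • 1) + ((η ^ 2 : ℝ) : ℂ) • 1) = (η : ℂ) • 1 := by
    have h1 : cfc (fun x : ℝ => (x - E) * (x - E) + η ^ 2) A
        = (A - (E : ℂ) • 1) * (A - (E : ℂ) • 1) + ((η ^ 2 : ℝ) : ℂ) • 1 := by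
      rw [cfc_add_const (η ^ 2) (fun x : ℝ => (x - E) * (x - E)) A,
        cfc_mul (fun x : ℝ => x - E) (fun x : ℝ => x - E) A,
        cfc_sub (fun x : ℝ => x) (fun _ => E) A, cfc_id' ℝ A, cfc_const E A]
      simp [Algebra.algebraMap_eq_smul_one, ← Complex.coe_smul]
    rw [← h1, hW, ← cfc_mul (poisson E η) (fun x : ℝ => (x - E) * (x - E) + η ^ 2) A
      hcont.continuousOn]
    have h2 : cfc (fun x => poisson E η x * ((x - E) * (x - E) + η ^ 2)) A
        = cfc (fun _ : ℝ => η) A := by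
      refine cfc_congr fun x _ => ?_
      simp only [poisson]
      have : (x - E) ^ 2 + η ^ 2 ≠ 0 := by positivity
      field_simp
    rw [h2, cfc_const η A]
    simp [Algebra.algebraMap_eq_smul_one, ← Complex.coe_smul]
  have hη' : (η : ℂ) ≠ 0 := by exact_mod_cast hη.ne'
  set R := A - z • (1 : H →L[ℂ] H) with hR
  set R' := A - (starRingEnd ℂ z) • (1 : H →L[ℂ] H) with hR'
  have hRR : R' * R = (A - (E : ℂ) • 1) * (A - (E : ℂ) • 1) + ((η ^ 2 : ℝ) : ℂ) • 1 := by
    simp only [hR, hR', hz, mul_sub, sub_mul, mul_smul_comm, smul_mul_assoc, one_mul, mul_one,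
      smul_smul, smul_sub]
    have hI := Complex.I_sq
    match_scalars <;> simp <;> first | ring1 | linear_combination (-η ^ 2 : ℂ) * hI
  have hcR : R * W = W * R := by simp [hR, mul_sub, sub_mul, hAW]
  have hcR' : R' * W = W * R' := by simp [hR', mul_sub, sub_mul, hAW]
  have hcRR : R * R' = R' * R := by
    simp only [hR, hR', mul_sub, sub_mul, mul_smul_comm, smul_mul_assoc, one_mul, mul_one,
      smul_smul, smul_sub]
    match_scalars <;> ring
  have hinv : Ring.inverse R = (η : ℂ)⁻¹ • (R' * W) := by
    have e1 : R * ((η : ℂ)⁻¹ • (R' * W)) = 1 := by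
      rw [mul_smul_comm, ← mul_assoc, hcRR, mul_assoc, hcR, ← mul_assoc, hcR', mul_assoc, hRR, hD,
        smul_smul, inv_mul_cancel₀ hη', one_smul]
    have e2 : ((η : ℂ)⁻¹ • (R' * W)) * R = 1 := by
      rw [smul_mul_assoc, hcR', mul_assoc, hRR, hD, smul_smul, inv_mul_cancel₀ hη', one_smul]
    exact Ring.inverse_unit (⟨R, _, e1, e2⟩ : (H →L[ℂ] H)ˣ)
  have hadj : ContinuousLinearMap.adjoint ((η : ℂ)⁻¹ • (R' * W)) = (η : ℂ)⁻¹ • (W * R) := by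
    rw [← ContinuousLinearMap.star_eq_adjoint, star_smul, star_mul, hWsa.star_eq]
    congr 1
    · simp
    · rw [hR', star_sub, star_smul, hA.star_eq, star_one, hR]
      simp
  rw [hinv, hadj, hcR', ← smul_sub, ← mul_sub]
  have : R' - R = (2 * Complex.I * η) • 1 := by
    simp only [hR, hR', hz]
    match_scalars <;> simp
    ring
  rw [this, mul_smul_comm, mul_one, smul_smul, smul_smul]
  have : 1 / (2 * Complex.I) * (η : ℂ)⁻¹ * (2 * Complex.I * η) = 1 := by
    have := Complex.I_ne_zero
    field_simp
  rw [this, one_smul]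

theorem isSelfAdjoint_imInv {A : H →L[ℂ] H} (hA : IsSelfAdjoint A) {E η : ℝ} (hη : 0 < η) :
    IsSelfAdjoint (imInv A (E + η * Complex.I)) := by
  rw [imInv_eq_cfc hA hη]
  exact cfc_predicate _ _

theorem norm_aeval_sub_imInv_le {A : H →L[ℂ] H} (hA : IsSelfAdjoint A) {E η : ℝ} (hη : 0 < η)
    {M ε : ℝ} (hM : ‖A‖ ≤ M) (hε : 0 ≤ ε) {Q : Polynomial ℝ}
    (hQ : ∀ x ∈ Set.Icc (-M) M, |Q.eval x - poisson E η x| ≤ ε) :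
    ‖Polynomial.aeval A Q - imInv A (E + η * Complex.I)‖ ≤ ε := by
  have hf := continuous_poisson (E := E) hη
  rw [imInv_eq_cfc hA hη, ← cfc_polynomial Q A hA,
    ← cfc_sub (fun x => Q.eval x) (poisson E η) A (by fun_prop) hf.continuousOn]
  refine norm_cfc_le hε fun x hx => ?_
  -- On the zero space the spectrum is empty; otherwise it lies in the ball of radius `‖A‖`.
  rcases subsingleton_or_nontrivial H with h | h
  · have : Subsingleton (H →L[ℂ] H) := inferInstance
    rw [Subsingleton.elim A 0] at hx
    simp [spectrum.of_subsingleton] at hx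
  · have : ‖x‖ ≤ M := (spectrum.norm_le_norm_of_mem hx).trans hM
    exact hQ x (abs_le.1 this)

/-- Take `V` to be the square root of the Poisson kernel at `A`. Its norm is at most `η^{-1/2}`, so
`‖V²x‖² ≤ ‖Vx‖² / η`, the inequality form of the Ward identity. -/
theorem exists_sqrt_imInv {A : H →L[ℂ] H} (hA : IsSelfAdjoint A) {E η : ℝ} (hη : 0 < η) :
    ∃ V : H →L[ℂ] H, (∀ x y : H, inner ℂ x (imInv A (E + η * Complex.I) y) = inner ℂ (V x) (V y)) ∧
      ∀ x, ‖imInv A (E + η * Complex.I) x‖ ^ 2 ≤ ‖V x‖ ^ 2 / η := by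
  have hc := (continuous_poisson (E := E) hη).sqrt
  set V := cfc (fun x => √(poisson E η x)) A with hV
  have hVsa : IsSelfAdjoint V := cfc_predicate _ _
  have hWV : imInv A (E + η * Complex.I) = V * V := by
    rw [imInv_eq_cfc hA hη, hV, ← cfc_mul (fun x => √(poisson E η x)) (fun x => √(poisson E η x)) A
      hc.continuousOn hc.continuousOn]
    refine cfc_congr fun x _ => ?_
    exact (Real.mul_self_sqrt (poisson_pos hη x).le).symm
  have hVn : ‖V‖ ≤ √(η⁻¹) := norm_cfc_le (Real.sqrt_nonneg _) fun x _ => by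
    rw [Real.norm_of_nonneg (Real.sqrt_nonneg _)]
    exact Real.sqrt_le_sqrt (poisson_le hη x)
  refine ⟨V, fun x y => ?_, fun x => ?_⟩
  · rw [hWV]
    exact (ContinuousLinearMap.isSelfAdjoint_iff_isSymmetric.1 hVsa x (V y)).symm
  · rw [hWV]
    calc ‖V (V x)‖ ^ 2 ≤ (√(η⁻¹) * ‖V x‖) ^ 2 := by
          gcongr
          exact (V.le_opNorm _).trans (by gcongr)
      _ = _ := by
          rw [mul_pow, Real.sq_sqrt (by positivity), inv_mul_eq_div]

end General

theorem isSelfAdjoint_imResolv {p : MatAlg r Γ} (hp : IsSelfAdj p) {E η : ℝ} (hη : 0 < η) :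
    IsSelfAdjoint (imResolv p (E + η * Complex.I)) :=
  isSelfAdjoint_imInv (isSelfAdjoint_matRegRep hp) hη

/-- The approximation interval contains both `[-M, M]`, meant for the eigenvalues of all `P_N`, and
the spectrum of `λ(p)`. One polynomial thus serves the finite models and the limit simultaneously.
-/
theorem exists_polynomial_approx {p : MatAlg r Γ} (hp : IsSelfAdj p) {E η : ℝ} (hη : 0 < η)
    (M : ℝ) {ε : ℝ} (hε : 0 < ε) :
    ∃ Q : Polynomial ℝ, (∀ x ∈ Set.Icc (-M) M, |Q.eval x - poisson E η x| ≤ ε) ∧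
      ‖matRegRep (Polynomial.aeval p Q) - imResolv p (E + η * Complex.I)‖ ≤ ε := by
  obtain ⟨Q, hQ⟩ := exists_polynomial_near_of_continuousOn (-max M ‖matRegRep p‖)
    (max M ‖matRegRep p‖) (poisson E η) (continuous_poisson hη).continuousOn ε hε
  refine ⟨Q, fun x hx => (hQ x ?_).le, ?_⟩
  · have := le_max_left M ‖matRegRep p‖
    exact ⟨by linarith [hx.1], hx.2.trans this⟩
  · rw [matRegRep_aeval]
    exact norm_aeval_sub_imInv_le (isSelfAdjoint_matRegRep hp) hη
      (le_max_right _ _) hε.le fun x hx => (hQ x hx).le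

open scoped Classical in
/-- The basis vector `e_j ⊗ δ_h`. -/
def deltaVec (h : Γ) (j : Fin r) : L2 Γ (EuclideanSpace ℂ (Fin r)) :=
  lp.single (E := fun _ : Γ => EuclideanSpace ℂ (Fin r)) 2 h (EuclideanSpace.single j (1 : ℂ))

theorem norm_deltaVec (h : Γ) (j : Fin r) : ‖deltaVec h j‖ = 1 := by
  classical
  rw [deltaVec, lp.norm_single (by norm_num)]
  simp

variable (Q : L2 Γ (EuclideanSpace ℂ (Fin r)) →L[ℂ] L2 Γ (EuclideanSpace ℂ (Fin r)))

theorem opBlock_apply (g h : Γ) (i j : Fin r) : opBlock Q g h i j = (Q (deltaVec h j)) g i := rfl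

theorem inner_deltaVec (g : Γ) (i : Fin r) (f : L2 Γ (EuclideanSpace ℂ (Fin r))) :
    inner ℂ (deltaVec g i) f = f g i := by
  classical
  rw [deltaVec, lp.inner_single_left]
  simp [EuclideanSpace.inner_single_left]

theorem opBlock_eq_inner (g h : Γ) (i j : Fin r) :
    opBlock Q g h i j = inner ℂ (deltaVec g i) (Q (deltaVec h j)) := by
  rw [inner_deltaVec, opBlock_apply]

theorem norm_opBlock_le (g h : Γ) (i j : Fin r) : ‖opBlock Q g h i j‖ ≤ ‖Q‖ := by
  rw [opBlock_eq_inner]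
  refine (norm_inner_le_norm _ _).trans ?_
  rw [norm_deltaVec, one_mul]
  refine (Q.le_opNorm _).trans ?_
  rw [norm_deltaVec, mul_one]

theorem opBlock_sub (Q Q' : L2 Γ (EuclideanSpace ℂ (Fin r)) →L[ℂ] L2 Γ (EuclideanSpace ℂ (Fin r)))
    (g h : Γ) : opBlock (Q - Q') g h = opBlock Q g h - opBlock Q' g h := rfl

theorem sum_norm_opBlock_sq_le (F : Finset Γ) (h : Γ) (i j : Fin r) :
    ∑ g ∈ F, ‖opBlock Q g h i j‖ ^ 2 ≤ ‖Q (deltaVec h j)‖ ^ 2 := by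
  rw [L2.norm_sq]
  refine le_trans (Finset.sum_le_sum fun g _ => ?_)
    ((L2.summable_sq (Q (deltaVec h j))).sum_le_tsum F fun g _ => by positivity)
  rw [opBlock_apply]
  gcongr
  exact PiLp.norm_apply_le _ _

theorem opBlock_conj {Q : L2 Γ (EuclideanSpace ℂ (Fin r)) →L[ℂ] L2 Γ (EuclideanSpace ℂ (Fin r))}
    (hQ : IsSelfAdjoint Q) (g h : Γ) (i j : Fin r) :
    opBlock Q h g j i = starRingEnd ℂ (opBlock Q g h i j) := by
  rw [opBlock_eq_inner, opBlock_eq_inner, inner_conj_symm]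
  exact (ContinuousLinearMap.isSelfAdjoint_iff_isSymmetric.1 hQ _ _).symm

/-- The fourth-moment condition concerns the blocks `(e, g)`, whereas traces produce the blocks `(g,
e)`; self-adjointness exchanges them. -/
theorem norm_opBlock_le_frob
    {Q : L2 Γ (EuclideanSpace ℂ (Fin r)) →L[ℂ] L2 Γ (EuclideanSpace ℂ (Fin r))}
    (hQ : IsSelfAdjoint Q) (g h : Γ) (i j : Fin r) :
    ‖opBlock Q g h i j‖ ≤ frob (opBlock Q h g) := by
  have : ‖opBlock Q g h i j‖ = ‖opBlock Q h g j i‖ := by rw [opBlock_conj hQ]; simp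
  rw [this, frob]
  refine Real.le_sqrt_of_sq_le ?_
  have h1 := Finset.single_le_sum (f := fun j' => ‖opBlock Q h g j j'‖ ^ 2)
    (fun _ _ => by positivity) (Finset.mem_univ i)
  have h2 := Finset.single_le_sum (f := fun i' => ∑ j', ‖opBlock Q h g i' j'‖ ^ 2)
    (fun _ _ => by positivity) (Finset.mem_univ j)
  exact h1.trans h2

/-- True for every element of the group algebra by `opBlock_matRegRep`, and preserved under norm
limits of polynomials in `λ(p)`. -/
theorem opBlock_imResolv_translate {p : MatAlg r Γ} (hp : IsSelfAdj p) {E η : ℝ} (hη : 0 < η)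
    (g h : Γ) :
    opBlock (imResolv p (E + η * Complex.I)) g h
      = opBlock (imResolv p (E + η * Complex.I)) (g * h⁻¹) 1 := by
  ext i j
  refine eq_of_forall_dist_le fun ε hε => ?_
  obtain ⟨Q, -, hQ⟩ := exists_polynomial_approx hp (E := E) hη 0 (half_pos hε)
  have h1 := (norm_opBlock_le _ g h i j).trans hQ
  have h2 := (norm_opBlock_le _ (g * h⁻¹) 1 i j).trans hQ
  rw [opBlock_sub, opBlock_matRegRep, Matrix.sub_apply, ← dist_eq_norm] at h1 h2
  rw [inv_one, mul_one] at h2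
  refine (dist_triangle_left _ _ _).trans ((add_le_add h1 h2).trans ?_)
  rw [add_halves]

/-- By translation invariance `‖V (deltaVec g i)‖` is the same for all `g`, so Cauchy–Schwarz bounds
each entry by a diagonal entry at the identity, itself at most the trace by positivity. The `ℓ²`
bound is the Ward inequality at a basis vector. -/
theorem opBlock_imResolv_bounds {p : MatAlg r Γ} (hp : IsSelfAdj p) {E η : ℝ} (hη : 0 < η)
    (i : Fin r) :
    (∀ g : Γ, ‖opBlock (imResolv p (E + η * Complex.I)) g 1 i i‖
      ≤ (opBlock (imResolv p (E + η * Complex.I)) 1 1).trace.re) ∧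
    ∀ F : Finset Γ, ∑ g ∈ F, ‖opBlock (imResolv p (E + η * Complex.I)) g 1 i i‖ ^ 2
      ≤ (opBlock (imResolv p (E + η * Complex.I)) 1 1).trace.re / η := by
  obtain ⟨V, hin, hVW⟩ := exists_sqrt_imInv (isSelfAdjoint_matRegRep hp) (E := E) hη
  change (∀ x y, inner ℂ x (imResolv p (E + η * Complex.I) y) = _) at hin
  change (∀ x, ‖imResolv p (E + η * Complex.I) x‖ ^ 2 ≤ _) at hVW
  set W := imResolv p (E + η * Complex.I) with hW
  have hdiag (g : Γ) (i : Fin r) : opBlock W g g i i = ((‖V (deltaVec g i)‖ ^ 2 : ℝ) : ℂ) := by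
    rw [opBlock_eq_inner, hin, inner_self_eq_norm_sq_to_K]
    simp
  have hdiag1 (g : Γ) : ‖V (deltaVec g i)‖ ^ 2 = ‖V (deltaVec (1 : Γ) i)‖ ^ 2 := by
    have h1 := hdiag g i
    rw [hW, opBlock_imResolv_translate hp hη, mul_inv_cancel, ← hW, hdiag] at h1
    exact_mod_cast h1.symm
  have hle : ‖V (deltaVec (1 : Γ) i)‖ ^ 2 ≤ (opBlock W 1 1).trace.re := by
    rw [Matrix.trace, Complex.re_sum]
    simp only [Matrix.diag_apply, hdiag, Complex.ofReal_re]
    exact Finset.single_le_sum (f := fun i => ‖V (deltaVec (1 : Γ) i)‖ ^ 2)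
      (fun _ _ => by positivity) (Finset.mem_univ i)
  refine ⟨fun g => le_trans ?_ hle, fun F => ?_⟩
  · rw [opBlock_eq_inner, hin]
    refine (norm_inner_le_norm _ _).trans ?_
    have : ‖V (deltaVec g i)‖ = ‖V (deltaVec (1 : Γ) i)‖ :=
      (sq_eq_sq₀ (norm_nonneg _) (norm_nonneg _)).1 (hdiag1 g)
    rw [this, sq]
  · refine (sum_norm_opBlock_sq_le _ F 1 i i).trans ((hVW _).trans ?_)
    gcongr

end Resolvent

/-! ### Traces and matrix coefficients in the finite models -/

section Finite

variable {Γ : Type*} [Group Γ] {r N : ℕ}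

theorem permMat_mul (σ τ : Equiv.Perm (Fin N)) : permMat (σ * τ) = permMat σ * permMat τ :=
  map_mul permMatHom σ τ

theorem permMat_one : permMat (1 : Equiv.Perm (Fin N)) = 1 := map_one permMatHom

theorem permMat_apply (σ : Equiv.Perm (Fin N)) (x y : Fin N) :
    permMat σ x y = if x = σ y then 1 else 0 := rfl

theorem permMat_conjTranspose (σ : Equiv.Perm (Fin N)) :
    (permMat σ).conjTranspose = permMat σ⁻¹ := by
  ext x y
  rw [Matrix.conjTranspose_apply, permMat_apply, permMat_apply]
  have : y = σ x ↔ x = σ⁻¹ y := by rw [Equiv.Perm.eq_inv_iff_eq, eq_comm]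
  simp only [this]
  split_ifs <;> simp

theorem toEuclideanLin_mul {n : Type*} [Fintype n] [DecidableEq n] (A B : Matrix n n ℂ)
    (v : EuclideanSpace ℂ n) :
    Matrix.toEuclideanLin (A * B) v = Matrix.toEuclideanLin A (Matrix.toEuclideanLin B v) := by
  simp [Matrix.toLpLin_apply]

theorem trace_eq_sum_inner {n ι : Type*} [Fintype n] [DecidableEq n] [Fintype ι]
    (A : Matrix n n ℂ) (φ : OrthonormalBasis ι ℂ (EuclideanSpace ℂ n)) :
    A.trace = ∑ α, inner ℂ (φ α) (Matrix.toEuclideanLin A (φ α)) := by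
  rw [← LinearMap.trace_eq_sum_inner _ φ, Matrix.toEuclideanLin, Matrix.toLpLin_eq_toLin, Matrix.trace_toLin_eq]

section Eigenbasis

variable {P : BMat r N} {φ : OrthonormalBasis (Fin (r * N)) ℂ (EuclideanSpace ℂ (Fin r × Fin N))}
  {ev : Fin (r * N) → ℝ}

theorem IsEigenbasis.aeval (h : IsEigenbasis P φ ev) (Q : Polynomial ℝ) :
    IsEigenbasis (Polynomial.aeval P Q) φ (fun α => Q.eval (ev α)) := by
  intro α
  induction Q using Polynomial.induction_on with
  | C a => simp [Algebra.algebraMap_eq_smul_one, ← Complex.coe_smul]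
  | add p q hp hq => simp only [map_add, LinearMap.add_apply, hp, hq, Polynomial.eval_add,
      Complex.ofReal_add, add_smul]
  | monomial n a ih =>
    rw [pow_succ, ← mul_assoc, map_mul, Polynomial.aeval_X, toEuclideanLin_mul, h α, map_smul, ih,
      smul_smul]
    congr 1
    simp only [Polynomial.eval_mul, Polynomial.eval_X, Complex.ofReal_mul]
    ring

theorem IsEigenbasis.sum_eval (h : IsEigenbasis P φ ev) :
    ∑ α, (ev α : ℂ) = P.trace := by
  rw [trace_eq_sum_inner P φ]
  refine Finset.sum_congr rfl fun α _ => ?_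
  rw [h α, inner_smul_right, inner_self_eq_norm_sq_to_K, φ.norm_eq_one]
  simp

/-- Evaluate the trace in the basis `φ` and expand `K φ_α` in that same basis. -/
theorem sum_coef_mul_eq_trace {P₁ P₂ : BMat r N} {e₁ e₂ : Fin (r * N) → ℝ}
    (h₁ : IsEigenbasis P₁ φ e₁) (h₂ : IsEigenbasis P₂ φ e₂) (K : BMat r N) :
    ((∑ α, ∑ β, e₁ α * e₂ β * ‖coef φ K β α‖ ^ 2 : ℝ) : ℂ)
      = (K.conjTranspose * P₂ * K * P₁).trace := by
  rw [trace_eq_sum_inner _ φ, Complex.ofReal_sum]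
  refine Finset.sum_congr rfl fun α _ => ?_
  rw [toEuclideanLin_mul, h₁ α, map_smul, inner_smul_right, mul_assoc, toEuclideanLin_mul,
    Matrix.toEuclideanLin_conjTranspose_eq_adjoint, LinearMap.adjoint_inner_right,
    toEuclideanLin_mul]
  have hK : Matrix.toEuclideanLin K (φ α) = ∑ β, coef φ K β α • φ β := (φ.sum_repr' _).symm
  have hP : Matrix.toEuclideanLin P₂ (Matrix.toEuclideanLin K (φ α))
      = ∑ β, (coef φ K β α * e₂ β) • φ β := by
    rw [hK, map_sum]
    refine Finset.sum_congr rfl fun β _ => ?_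
    rw [map_smul, h₂ β, smul_smul]
  rw [hP, inner_sum, Complex.ofReal_sum, Finset.mul_sum]
  refine Finset.sum_congr rfl fun β _ => ?_
  rw [inner_smul_right]
  have : inner ℂ (Matrix.toEuclideanLin K (φ α)) (φ β) = starRingEnd ℂ (coef φ K β α) :=
    (inner_conj_symm _ _).symm
  have h2 := Complex.mul_conj (coef φ K β α)
  rw [Complex.normSq_eq_norm_sq] at h2
  rw [this, mul_right_comm (coef φ K β α), h2]
  push_cast
  ring

theorem isEigenbasis_one : IsEigenbasis (1 : BMat r N) φ fun _ => 1 := by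
  intro α
  simp

/-- The Hilbert–Schmidt norm does not depend on the basis. This is how errors that are small in
Hilbert–Schmidt norm enter the variance without any knowledge of the eigenvectors. -/
theorem sum_coef_sq (K : BMat r N) :
    ∑ α, ∑ β, ‖coef φ K β α‖ ^ 2 = ∑ a, ∑ b, ‖K b a‖ ^ 2 := by
  have h := sum_coef_mul_eq_trace (isEigenbasis_one (φ := φ)) (isEigenbasis_one (φ := φ)) K
  have h2 : (K.conjTranspose * 1 * K * 1).trace = ((∑ a, ∑ b, ‖K b a‖ ^ 2 : ℝ) : ℂ) := by
    rw [mul_one, mul_one, Matrix.trace]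
    push_cast
    refine Finset.sum_congr rfl fun a _ => ?_
    rw [Matrix.diag_apply, Matrix.mul_apply]
    refine Finset.sum_congr rfl fun b _ => ?_
    rw [Matrix.conjTranspose_apply, mul_comm]
    exact (Complex.mul_conj _).trans (by rw [Complex.normSq_eq_norm_sq]; push_cast; rfl)
  rw [h2] at h
  simpa using Complex.ofReal_injective h

theorem coef_sub (K K' : BMat r N) (β α : Fin (r * N)) :
    coef φ (K - K') β α = coef φ K β α - coef φ K' β α := by
  simp [coef]

theorem coef_sum {ι : Type*} (s : Finset ι) (K : ι → BMat r N) (β α : Fin (r * N)) :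
    coef φ (∑ m ∈ s, K m) β α = ∑ m ∈ s, coef φ (K m) β α := by
  simp [coef]

end Eigenbasis

/-- A bound for the eigenvalues of all `ρ(p)`. -/
def coeffNorm (p : MatAlg r Γ) : ℝ := ∑ g ∈ p.coeff.support, ∑ i, ∑ j, ‖p.coeff g i j‖

/-- Compare both sides of the eigenvalue equation at a coordinate of largest modulus; permutations
do not increase the sup norm. The bound is independent of `N`, so a fixed interval suffices for
polynomial approximation. -/
theorem abs_eigenvalue_le (ρ : Γ →* Equiv.Perm (Fin N)) (p : MatAlg r Γ)
    {φ : OrthonormalBasis (Fin (r * N)) ℂ (EuclideanSpace ℂ (Fin r × Fin N))}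
    {ev : Fin (r * N) → ℝ} (h : IsEigenbasis (matPermRep ρ p) φ ev) (α : Fin (r * N)) :
    |ev α| ≤ coeffNorm p := by
  have hne : Nonempty (Fin r × Fin N) := by
    by_contra hc
    rw [not_nonempty_iff] at hc
    have : φ α = 0 := by ext a; exact hc.elim a
    have h1 := φ.norm_eq_one α
    rw [this, norm_zero] at h1
    exact zero_ne_one h1
  obtain ⟨⟨i, x⟩, hmax⟩ := Finite.exists_max fun a => ‖φ α a‖
  have hpos : 0 < ‖φ α (i, x)‖ := by
    by_contra hc
    have : φ α = 0 := by
      ext a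
      exact norm_le_zero_iff.1 ((hmax a).trans (not_lt.1 hc))
    have h1 := φ.norm_eq_one α
    rw [this, norm_zero] at h1
    exact zero_ne_one h1
  have he := congrArg (fun v : EuclideanSpace ℂ (Fin r × Fin N) => v (i, x)) (h α)
  simp only [Matrix.ofLp_toLpLin, Matrix.toLin'_apply, PiLp.smul_apply, smul_eq_mul] at he
  have hle : ‖(matPermRep ρ p).mulVec (φ α) (i, x)‖ ≤ coeffNorm p * ‖φ α (i, x)‖ := by
    rw [matPermRep, Matrix.sum_mulVec, Finset.sum_apply, coeffNorm, Finset.sum_mul]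
    refine (norm_sum_le _ _).trans (Finset.sum_le_sum fun g _ => ?_)
    rw [Matrix.mulVec, dotProduct, Fintype.sum_prod_type]
    refine (norm_sum_le _ _).trans ?_
    calc ∑ j, ‖∑ y, (p.coeff g ⊗ₖ permMat (ρ g)) (i, x) (j, y) * φ α (j, y)‖
        = ∑ j, ‖p.coeff g i j * φ α (j, (ρ g)⁻¹ x)‖ := by
          refine Finset.sum_congr rfl fun j _ => ?_
          rw [Finset.sum_eq_single ((ρ g)⁻¹ x)]
          · simp [permMat_apply]
          · intro y _ hy
            have : x ≠ ρ g y := fun hxy => hy (by rw [hxy]; simp)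
            simp [permMat_apply, this]
          · simp
      _ ≤ ∑ j, ‖p.coeff g i j‖ * ‖φ α (i, x)‖ := by
          refine Finset.sum_le_sum fun j _ => ?_
          rw [norm_mul]
          gcongr
          exact hmax _
      _ ≤ (∑ i, ∑ j, ‖p.coeff g i j‖) * ‖φ α (i, x)‖ := by
          rw [← Finset.sum_mul]
          refine mul_le_mul_of_nonneg_right ?_ (norm_nonneg _)
          exact Finset.single_le_sum (f := fun i => ∑ j, ‖p.coeff g i j‖)
            (fun _ _ => by positivity) (Finset.mem_univ i)
  rw [he, norm_mul, Complex.norm_real, Real.norm_eq_abs] at hle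
  exact le_of_mul_le_mul_right hle hpos

/-- The piece `E_{li} ⊗ ρ(t) diag(u)` of a local operator. -/
def piece (ρ : Γ →* Equiv.Perm (Fin N)) (t : Γ) (l i : Fin r) (u : Fin N → ℂ) : BMat r N :=
  Matrix.single l i 1 ⊗ₖ (permMat (ρ t) * Matrix.diagonal u)

theorem piece_apply (ρ : Γ →* Equiv.Perm (Fin N)) (t : Γ) (l i : Fin r) (u : Fin N → ℂ)
    (l' i' : Fin r) (x y : Fin N) :
    piece ρ t l i u (l', x) (i', y)
      = (if l = l' ∧ i = i' then 1 else 0) * ((if x = ρ t y then 1 else 0) * u y) := by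
  simp only [piece, Matrix.kroneckerMap_apply, Matrix.mul_diagonal, permMat_apply, Matrix.single,
    Matrix.of_apply]

/-- The empirical correlation `(1/N) ∑_y conj(u(y)) u(g.y)`. -/
def corr (ρ : Γ →* Equiv.Perm (Fin N)) (u : Fin N → ℂ) (g : Γ) : ℂ :=
  (1 / (N : ℂ)) * ∑ y, starRingEnd ℂ (u y) * u (ρ g y)

theorem norm_corr_le (ρ : Γ →* Equiv.Perm (Fin N)) {u : Fin N → ℂ} {C : ℝ} (hC : 0 ≤ C)
    (hu : ∀ y, ‖u y‖ ≤ C) (g : Γ) : ‖corr ρ u g‖ ≤ C ^ 2 := by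
  rw [corr, norm_mul]
  have h1 : ‖∑ y, starRingEnd ℂ (u y) * u (ρ g y)‖ ≤ N * C ^ 2 := by
    refine (norm_sum_le _ _).trans ?_
    refine (Finset.sum_le_card_nsmul _ _ (C ^ 2) fun y _ => ?_).trans (by simp)
    rw [norm_mul, RCLike.norm_conj, sq]
    exact mul_le_mul (hu _) (hu _) (norm_nonneg _) hC
  rcases Nat.eq_zero_or_pos N with h | h
  · subst h; simp; positivity
  · rw [norm_div, norm_one, Complex.norm_natCast, one_div_mul_eq_div, div_le_iff₀ (by positivity)]
    linarith

/-- The matrix units select one diagonal entry from each coefficient. On the permutation side a term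
moves `y` to `g.y`, picks up `u (g.y)`, applies `t⁻¹ht`, and counts only if it returns to `y`. -/
theorem trace_piece (ρ : Γ →* Equiv.Perm (Fin N)) (t : Γ) (l i : Fin r) (u : Fin N → ℂ)
    (q₁ q₂ : MatAlg r Γ) :
    ((piece ρ t l i u).conjTranspose * matPermRep ρ q₂ * piece ρ t l i u * matPermRep ρ q₁).trace
      = ∑ g ∈ q₁.coeff.support, ∑ h ∈ q₂.coeff.support, q₁.coeff g i i * q₂.coeff h l l *
        ∑ y, if ρ (t⁻¹ * h * t * g) y = y then starRingEnd ℂ (u y) * u (ρ g y) else 0 := by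
  rw [matPermRep, matPermRep, Finset.mul_sum, Matrix.trace_sum]
  refine Finset.sum_congr rfl fun g _ => ?_
  rw [Finset.mul_sum, Finset.sum_mul, Finset.sum_mul, Matrix.trace_sum]
  refine Finset.sum_congr rfl fun h _ => ?_
  rw [piece, Matrix.conjTranspose_kronecker, ← Matrix.mul_kronecker_mul,
    ← Matrix.mul_kronecker_mul, ← Matrix.mul_kronecker_mul, Matrix.trace_kronecker,
    Matrix.conjTranspose_mul, permMat_conjTranspose, ← map_inv]
  congr 1
  · simp [Matrix.trace_single_mul, Matrix.single_mul_mul_single, mul_comm]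
  · have : (Matrix.diagonal u).conjTranspose * permMat (ρ t⁻¹) * permMat (ρ h)
        * (permMat (ρ t) * Matrix.diagonal u) * permMat (ρ g)
        = (Matrix.diagonal u).conjTranspose * permMat (ρ (t⁻¹ * h * t)) *
          (Matrix.diagonal u * permMat (ρ g)) := by
      simp only [map_mul, permMat_mul, mul_assoc]
    rw [this, Matrix.trace]
    refine Finset.sum_congr rfl fun y _ => ?_
    rw [Matrix.diag_apply, Matrix.mul_apply, Matrix.diagonal_conjTranspose,
      Finset.sum_eq_single (ρ g y)]
    · rw [Matrix.diagonal_mul, Matrix.diagonal_mul, permMat_apply, permMat_apply, map_mul _ _ g,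
        Equiv.Perm.mul_apply]
      simp only [eq_comm (a := y)]
      split_ifs <;> simp
    · intro z _ hz
      rw [Matrix.diagonal_mul, Matrix.diagonal_mul, permMat_apply, permMat_apply, if_neg hz]
      simp
    · simp

end Finite

/-! ### Convergence of normalised traces and eigenvalue counting -/

section Limits

theorem mem_eigSet {n : ℕ} {ev : Fin n → ℝ} {J : Set ℝ} {α : Fin n} :
    α ∈ eigSet ev J ↔ ev α ∈ J := by
  simp [eigSet]

variable {Γ : Type*} [Group Γ] {r : ℕ} {d : ℕ → ℕ}

/-- The number of fixed points. -/
def fixCount {N : ℕ} (σ : Equiv.Perm (Fin N)) : ℝ := ∑ y, if σ y = y then 1 else 0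

theorem fixCount_nonneg {N : ℕ} (σ : Equiv.Perm (Fin N)) : 0 ≤ fixCount σ :=
  Finset.sum_nonneg fun _ _ => by split_ifs <;> simp

theorem trace_permMat {N : ℕ} (σ : Equiv.Perm (Fin N)) : (permMat σ).trace = (fixCount σ : ℂ) := by
  rw [fixCount, Matrix.trace]
  push_cast
  refine Finset.sum_congr rfl fun y _ => ?_
  rw [Matrix.diag_apply, permMat_apply]
  simp only [eq_comm (a := y)]
  split_ifs <;> simp

theorem ConvDistrib.tendsto_fixCount {ρ : ∀ k, Γ →* Equiv.Perm (Fin (d k))} (hρ : ConvDistrib ρ)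
    {g : Γ} (hg : g ≠ 1) : Tendsto (fun k => fixCount (ρ k g) / d k) atTop (𝓝 0) := by
  have := (hρ g hg).norm
  rw [norm_zero] at this
  refine this.congr fun k => ?_
  rw [trace_permMat, norm_mul, norm_div, norm_one, Complex.norm_natCast, Complex.norm_real,
    Real.norm_of_nonneg (fixCount_nonneg _), one_div_mul_eq_div]

theorem ConvDistrib.tendsto_trace_permMat {ρ : ∀ k, Γ →* Equiv.Perm (Fin (d k))}
    (hρ : ConvDistrib ρ) (hd : Tendsto d atTop atTop) [DecidableEq Γ] (g : Γ) :
    Tendsto (fun k => (1 / (d k : ℂ)) * (permMat (ρ k g)).trace) atTop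
      (𝓝 (if g = 1 then 1 else 0)) := by
  split_ifs with h
  · subst h
    refine tendsto_const_nhds.congr' ?_
    filter_upwards [hd.eventually_gt_atTop 0] with k hk
    have : (d k : ℂ) ≠ 0 := by exact_mod_cast hk.ne'
    rw [map_one, permMat_one, Matrix.trace_one, Fintype.card_fin, one_div_mul_cancel this]
  · exact hρ g h

theorem ConvDistrib.tendsto_trace {ρ : ∀ k, Γ →* Equiv.Perm (Fin (d k))} (hρ : ConvDistrib ρ)
    (hd : Tendsto d atTop atTop) (q : MatAlg r Γ) :
    Tendsto (fun k => (1 / (d k : ℂ)) * (matPermRep (ρ k) q).trace) atTop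
      (𝓝 (q.coeff 1).trace) := by
  classical
  have h : Tendsto (fun k => ∑ g ∈ q.coeff.support,
      (q.coeff g).trace * ((1 / (d k : ℂ)) * (permMat (ρ k g)).trace)) atTop
      (𝓝 (∑ g ∈ q.coeff.support, (q.coeff g).trace * if g = 1 then 1 else 0)) :=
    tendsto_finsetSum _ fun g _ => (hρ.tendsto_trace_permMat hd g).const_mul _
  have hlim : (∑ g ∈ q.coeff.support, (q.coeff g).trace * if g = 1 then 1 else 0)
      = (q.coeff 1).trace := by
    simp only [mul_ite, mul_one, mul_zero, Finset.sum_ite_eq']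
    split_ifs with h1
    · rfl
    · rw [Finsupp.notMem_support_iff.1 h1, Matrix.trace_zero]
  rw [hlim] at h
  refine h.congr fun k => ?_
  rw [matPermRep, Matrix.trace_sum, Finset.mul_sum]
  refine Finset.sum_congr rfl fun g _ => ?_
  rw [Matrix.trace_kronecker]
  ring

theorem norm_trace_le (A : Matrix (Fin r) (Fin r) ℂ) {c : ℝ} (h : ∀ i, ‖A i i‖ ≤ c) :
    ‖A.trace‖ ≤ r * c := by
  refine (norm_sum_le _ _).trans ((Finset.sum_le_card_nsmul _ _ c fun i _ => h i).trans ?_)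
  simp

variable {p : MatAlg r Γ} {ρ : ∀ k, Γ →* Equiv.Perm (Fin (d k))}
  {φ : ∀ k, OrthonormalBasis (Fin (r * d k)) ℂ (EuclideanSpace ℂ (Fin r × Fin (d k)))}
  {ev : ∀ k, Fin (r * d k) → ℝ}

/-- For a polynomial in place of the Poisson kernel this is convergence in distribution; uniform
approximation on the common spectral interval does the rest. -/
theorem tendsto_sum_poisson (hp : IsSelfAdj p) (hd : Tendsto d atTop atTop)
    (hρ : ConvDistrib ρ) (hφ : ∀ k, IsEigenbasis (matPermRep (ρ k) p) (φ k) (ev k))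
    {E η : ℝ} (hη : 0 < η) :
    Tendsto (fun k => (∑ α, poisson E η (ev k α)) / d k) atTop
      (𝓝 (opBlock (imResolv p (E + η * Complex.I)) 1 1).trace.re) := by
  rw [Metric.tendsto_atTop']
  intro ε hε
  -- The approximation error enters twice with a factor `r`: through `rN` eigenvalues divided by
  -- `N`, and through the `r` diagonal entries of the limiting block. The remaining quarter of `ε`
  -- covers the convergence of traces.
  set δ : ℝ := ε / (4 * (r + 1)) with hδ
  have hδ0 : 0 < δ := by positivity
  have hrδ : r * δ ≤ ε / 4 := by
    rw [hδ, mul_div_assoc', div_le_div_iff₀ (by positivity) (by positivity)]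
    nlinarith
  obtain ⟨Q, hQ, hQW⟩ := exists_polynomial_approx hp (E := E) hη (coeffNorm p) hδ0
  have hlim := hρ.tendsto_trace hd (Polynomial.aeval p Q)
  rw [Metric.tendsto_atTop'] at hlim
  obtain ⟨k₀, hk₀⟩ := hlim (ε / 4) (by positivity)
  obtain ⟨k₁, hk₁⟩ := (hd.eventually_gt_atTop 0).exists_forall_of_atTop
  refine ⟨max k₀ k₁, fun k hk => ?_⟩
  have hk2 := hk₀ k (lt_of_le_of_lt (le_max_left _ _) hk)
  have hdk : (0 : ℝ) < d k := by
    exact_mod_cast hk₁ k ((le_max_right k₀ k₁).trans hk.le)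
  have htr : (matPermRep (ρ k) (Polynomial.aeval p Q)).trace
      = ((∑ α, Q.eval (ev k α) : ℝ) : ℂ) := by
    rw [matPermRep_aeval, ← ((hφ k).aeval Q).sum_eval]
    push_cast
    rfl
  have hs : |(∑ α, poisson E η (ev k α)) / d k - (∑ α, Q.eval (ev k α)) / d k| ≤ r * δ := by
    rw [← sub_div, abs_div, abs_of_pos hdk, div_le_iff₀ hdk, ← Finset.sum_sub_distrib]
    refine (Finset.abs_sum_le_sum_abs _ _).trans
      ((Finset.sum_le_card_nsmul _ _ δ fun α _ => ?_).trans (le_of_eq ?_))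
    · rw [abs_sub_comm]
      exact hQ _ (abs_le.1 (abs_eigenvalue_le (ρ k) p (hφ k) α))
    · simp
      ring
  have hW : ‖((Polynomial.aeval p Q : MatAlg r Γ).coeff 1).trace
      - (opBlock (imResolv p (E + η * Complex.I)) 1 1).trace‖ ≤ r * δ := by
    rw [← Matrix.trace_sub]
    refine norm_trace_le _ fun i => ?_
    have := (norm_opBlock_le _ 1 1 i i).trans hQW
    rwa [opBlock_sub, opBlock_matRegRep, inv_one, mul_one] at this
  have h1 : |(∑ α, Q.eval (ev k α)) / d k
      - (opBlock (imResolv p (E + η * Complex.I)) 1 1).trace.re| ≤ ε / 4 + r * δ := by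
    have e1 : ((∑ α, Q.eval (ev k α)) / d k : ℝ)
        = ((1 / (d k : ℂ)) * (matPermRep (ρ k) (Polynomial.aeval p Q)).trace).re := by
      rw [htr, one_div_mul_eq_div, ← Complex.ofReal_natCast, ← Complex.ofReal_div,
        Complex.ofReal_re]
    rw [e1, ← Complex.sub_re]
    refine (Complex.abs_re_le_norm _).trans ?_
    rw [← sub_add_sub_cancel _ ((Polynomial.aeval p Q : MatAlg r Γ).coeff 1).trace]
    refine (norm_add_le _ _).trans (add_le_add ?_ hW)
    rw [← dist_eq_norm]
    exact hk2.le
  rw [Real.dist_eq, ← sub_add_sub_cancel _ ((∑ α, Q.eval (ev k α)) / d k)]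
  refine (abs_add_le _ _).trans_lt ?_
  linarith

/-- Off the window the kernel behaves like `η / (x - E)²`, so dividing the scale by `L` gains `1 /
L`; the factor 2 absorbs `η² ≤ (x - E)²`. -/
theorem poisson_le_of_lt {E η L x : ℝ} (hη : 0 < η) (hL : 1 ≤ L) (hx : η < |x - E|) :
    poisson E (η / L) x ≤ 2 / L * poisson E η x := by
  unfold poisson
  have hL0 : 0 < L := by linarith
  have hx2 : η ^ 2 ≤ (x - E) ^ 2 := by
    rw [← sq_abs (x - E)]; gcongr
  have h0 : 0 < (x - E) ^ 2 := lt_of_lt_of_le (by positivity) hx2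
  rw [← mul_div_assoc, div_le_div_iff₀ (by positivity) (by positivity)]
  have : η / L * ((x - E) ^ 2 + η ^ 2) ≤ η / L * (2 * (x - E) ^ 2) := by gcongr; linarith
  refine this.trans ?_
  have h3 : 2 / L * η * ((x - E) ^ 2 + (η / L) ^ 2) = η / L * (2 * (x - E) ^ 2)
    + 2 / L * η * (η / L) ^ 2 := by ring
  rw [h3]
  have : 0 ≤ 2 / L * η * (η / L) ^ 2 := by positivity
  linarith

/-- Use the Poisson kernel at a scale `η / L` much finer than the window. Its total mass is bounded
below by the spectral assumption, its mass off the window is small, and each eigenvalue inside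
carries at most `L / η`. -/
theorem eventually_card_eigSet_ge (hp : IsSelfAdj p) (hd : Tendsto d atTop atTop)
    (hρ : ConvDistrib ρ) (hφ : ∀ k, IsEigenbasis (matPermRep (ρ k) p) (φ k) (ev k))
    {E C₀ : ℝ} (hC₀ : 1 ≤ C₀)
    (hE : ∀ η ∈ Set.Ioc (0 : ℝ) 1,
      C₀⁻¹ ≤ (opBlock (imResolv p (E + η * Complex.I)) 1 1).trace.re ∧
      (opBlock (imResolv p (E + η * Complex.I)) 1 1).trace.re ≤ C₀) {η : ℝ}
    (hη : η ∈ Set.Ioc (0 : ℝ) 1) :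
    ∀ᶠ k in atTop, η / (32 * C₀ ^ 3) * d k
      ≤ ((eigSet (ev k) (Set.Icc (E - η) (E + η))).card : ℝ) := by
  obtain ⟨hη0, hη1⟩ := hη
  have hC : 0 < C₀ := by linarith
  -- With this `L` the outer mass is at most `(2/L) · 2C₀N = N/(2C₀)`, out of a total of at least
  -- `3N/(4C₀)`; the window keeps `N/(4C₀)`.
  set L : ℝ := 8 * C₀ ^ 2 with hL
  have hL1 : 1 ≤ L := by nlinarith
  have hL0 : 0 < L := by linarith
  have hη' : 0 < η / L := by positivity
  have hη'1 : η / L ≤ 1 := by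
    rw [div_le_one hL0]; linarith
  have h1 := (tendsto_sum_poisson hp hd hρ hφ (E := E) hη').eventually
    (lt_mem_nhds (lt_of_lt_of_le (show 3 / (4 * C₀) < C₀⁻¹ by
      rw [div_lt_iff₀ (by positivity)]; field_simp; norm_num) (hE _ ⟨hη', hη'1⟩).1))
  have h2 := (tendsto_sum_poisson hp hd hρ hφ (E := E) hη0).eventually
    (gt_mem_nhds (lt_of_le_of_lt (hE _ ⟨hη0, hη1⟩).2 (show C₀ < 2 * C₀ by linarith)))
  filter_upwards [h1, h2, hd.eventually_gt_atTop 0] with k hk1 hk2 hk3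
  have hdk : (0 : ℝ) < d k := by exact_mod_cast hk3
  rw [lt_div_iff₀ hdk] at hk1
  rw [div_lt_iff₀ hdk] at hk2
  set s := eigSet (ev k) (Set.Icc (E - η) (E + η)) with hs
  have hin : ∑ α ∈ s, poisson E (η / L) (ev k α) ≤ s.card * (L / η) := by
    rw [← nsmul_eq_mul]
    refine Finset.sum_le_card_nsmul _ _ _ fun α _ => ?_
    rw [← inv_div η L]
    exact poisson_le hη' _
  have hout : ∑ α ∈ sᶜ, poisson E (η / L) (ev k α) ≤ 2 / L * ∑ α, poisson E η (ev k α) := by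
    rw [Finset.mul_sum]
    refine le_trans (Finset.sum_le_sum fun α hα => ?_)
      (Finset.sum_le_sum_of_subset_of_nonneg (Finset.subset_univ sᶜ) fun α _ _ =>
        mul_nonneg (by positivity) (poisson_pos hη0 _).le)
    refine poisson_le_of_lt hη0 hL1 ?_
    rw [Finset.mem_compl, hs, mem_eigSet] at hα
    by_contra hc
    rw [not_lt, abs_le] at hc
    exact hα ⟨by linarith [hc.1], by linarith [hc.2]⟩
  have hsum := Finset.sum_add_sum_compl s fun α => poisson E (η / L) (ev k α)
  have h4 : 2 / L * ∑ α, poisson E η (ev k α) ≤ 2 / L * (2 * C₀ * d k) := by gcongr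
  have h5 : 2 / L * (2 * C₀ * d k) = 1 / (2 * C₀) * d k := by rw [hL]; field_simp; norm_num
  have h6 : 3 / (4 * C₀) * d k = 1 / (2 * C₀) * d k + 1 / (4 * C₀) * d k := by
    field_simp; norm_num
  have h7 : 1 / (4 * C₀) * d k ≤ s.card * (L / η) := by linarith
  have h8 : η / (32 * C₀ ^ 3) * d k = (1 / (4 * C₀) * d k) * (η / L) := by
    rw [hL]; field_simp; norm_num
  rw [h8, ← le_div_iff₀ hη']
  refine h7.trans (le_of_eq ?_)
  field_simp

end Limits

/-! ### The smoothed quantum variance -/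

section Variance

variable {Γ : Type*} [Group Γ] {r : ℕ}

/-- The quantum variance, smoothed by Poisson kernels at energies `E₁`, `E₂` and scale `η`. -/
def qvar {N : ℕ} (φ : OrthonormalBasis (Fin (r * N)) ℂ (EuclideanSpace ℂ (Fin r × Fin N)))
    (ev : Fin (r * N) → ℝ) (E₁ E₂ η : ℝ) (K : BMat r N) : ℝ :=
  ∑ α, ∑ β, poisson E₁ η (ev α) * poisson E₂ η (ev β) * ‖coef φ K β α‖ ^ 2

section One

variable {N : ℕ} {φ : OrthonormalBasis (Fin (r * N)) ℂ (EuclideanSpace ℂ (Fin r × Fin N))}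
  {ev : Fin (r * N) → ℝ} {E₁ E₂ η : ℝ}

theorem qvar_sum_le (hη : 0 < η) {ι : Type*} (s : Finset ι) (K : ι → BMat r N) :
    qvar φ ev E₁ E₂ η (∑ m ∈ s, K m) ≤ s.card * ∑ m ∈ s, qvar φ ev E₁ E₂ η (K m) := by
  have hcomm : ∑ m ∈ s, qvar φ ev E₁ E₂ η (K m) = ∑ α, ∑ β, ∑ m ∈ s,
      poisson E₁ η (ev α) * poisson E₂ η (ev β) * ‖coef φ (K m) β α‖ ^ 2 := by
    unfold qvar
    rw [Finset.sum_comm]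
    exact Finset.sum_congr rfl fun α _ => Finset.sum_comm
  rw [hcomm, qvar, Finset.mul_sum]
  refine Finset.sum_le_sum fun α _ => ?_
  rw [Finset.mul_sum]
  refine Finset.sum_le_sum fun β _ => ?_
  rw [← Finset.mul_sum, mul_left_comm, coef_sum]
  refine mul_le_mul_of_nonneg_left ?_
    (mul_nonneg (poisson_pos hη _).le (poisson_pos hη _).le)
  calc ‖∑ m ∈ s, coef φ (K m) β α‖ ^ 2 ≤ (∑ m ∈ s, ‖coef φ (K m) β α‖) ^ 2 := by
        gcongr; exact norm_sum_le _ _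
    _ ≤ _ := sq_sum_le_card_mul_sum_sq

theorem qvar_add_le (hη : 0 < η) (K K' : BMat r N) :
    qvar φ ev E₁ E₂ η (K + K') ≤ 2 * (qvar φ ev E₁ E₂ η K + qvar φ ev E₁ E₂ η K') := by
  have := qvar_sum_le (φ := φ) (ev := ev) (E₁ := E₁) (E₂ := E₂) hη Finset.univ ![K, K']
  simpa using this

/-- A crude bound that loses `η⁻²`, harmless for remainders of squared Hilbert–Schmidt norm `o(N)`
because `η` is fixed while `N → ∞`. -/
theorem qvar_le (hη : 0 < η) (K : BMat r N) :
    qvar φ ev E₁ E₂ η K ≤ (η⁻¹) ^ 2 * ∑ a, ∑ b, ‖K b a‖ ^ 2 := by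
  unfold qvar
  rw [← sum_coef_sq (φ := φ), Finset.mul_sum]
  refine Finset.sum_le_sum fun α _ => ?_
  rw [Finset.mul_sum]
  refine Finset.sum_le_sum fun β _ => ?_
  rw [sq η⁻¹]
  gcongr
  · exact (poisson_pos hη _).le
  · exact poisson_le hη _
  · exact poisson_le hη _

theorem poisson_ge (hη : 0 < η) {E x : ℝ} (hx : x ∈ Set.Icc (E - η) (E + η)) :
    (2 * η)⁻¹ ≤ poisson E η x := by
  unfold poisson
  have : (x - E) ^ 2 ≤ η ^ 2 := sq_le_sq' (by linarith [hx.1]) (by linarith [hx.2])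
  rw [inv_le_iff_one_le_mul₀ (by positivity), div_mul_eq_mul_div, le_div_iff₀ (by positivity)]
  nlinarith

theorem sum_window_le (hη : 0 < η) (K : BMat r N) :
    ∑ α ∈ eigSet ev (Set.Icc (E₁ - η) (E₁ + η)), ∑ β ∈ eigSet ev (Set.Icc (E₂ - η) (E₂ + η)),
      ‖coef φ K β α‖ ^ 2 ≤ 4 * η ^ 2 * qvar φ ev E₁ E₂ η K := by
  have hpos (α β : Fin (r * N)) :
      0 ≤ poisson E₁ η (ev α) * poisson E₂ η (ev β) * ‖coef φ K β α‖ ^ 2 :=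
    mul_nonneg (mul_nonneg (poisson_pos hη _).le (poisson_pos hη _).le) (by positivity)
  unfold qvar
  rw [Finset.mul_sum]
  refine le_trans (Finset.sum_le_sum fun α hα => ?_)
    (Finset.sum_le_sum_of_subset_of_nonneg (Finset.subset_univ _) fun α _ _ =>
      mul_nonneg (by positivity) (Finset.sum_nonneg fun β _ => hpos α β))
  rw [Finset.mul_sum]
  refine le_trans (Finset.sum_le_sum fun β hβ => ?_)
    (Finset.sum_le_sum_of_subset_of_nonneg (Finset.subset_univ _) fun β _ _ =>
      mul_nonneg (by positivity) (hpos α β))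
  have h1 := poisson_ge hη (mem_eigSet.1 hα)
  have h2 := poisson_ge hη (mem_eigSet.1 hβ)
  have h3 : (2 * η)⁻¹ * (2 * η)⁻¹ ≤ poisson E₁ η (ev α) * poisson E₂ η (ev β) :=
    mul_le_mul h1 h2 (by positivity) (poisson_pos hη _).le
  calc ‖coef φ K β α‖ ^ 2 = 4 * η ^ 2 * ((2 * η)⁻¹ * (2 * η)⁻¹ * ‖coef φ K β α‖ ^ 2) := by
        field_simp; norm_num
    _ ≤ _ := by gcongr

theorem sum_piece_sq (ρ : Γ →* Equiv.Perm (Fin N)) (t : Γ) (l i : Fin r) (u : Fin N → ℂ) :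
    ∑ a, ∑ b, ‖piece ρ t l i u b a‖ ^ 2 = ∑ y, ‖u y‖ ^ 2 := by
  rw [Fintype.sum_prod_type, Finset.sum_comm]
  refine Finset.sum_congr rfl fun y _ => ?_
  rw [Finset.sum_eq_single i, Finset.sum_eq_single (l, ρ t y)]
  · simp [piece_apply]
  · rintro ⟨l', x⟩ _ hb
    rw [piece_apply]
    by_cases h : l = l'
    · subst h
      have : x ≠ ρ t y := fun h => hb (by rw [h])
      simp [this]
    · simp [h]
  · simp
  · intro i' _ hi'
    refine Finset.sum_eq_zero fun b _ => ?_
    obtain ⟨l', x⟩ := b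
    rw [piece_apply]
    simp [hi'.symm]
  · simp

/-- Expand the difference of products into one quadratic and two linear error terms, each kernel
being at most `η⁻¹`; the weights `‖coef‖²` sum to the Hilbert–Schmidt norm. -/
theorem abs_qvar_sub_le (hη : 0 < η) {Q₁ Q₂ : Fin (r * N) → ℝ} {δ : ℝ} (hδ : 0 ≤ δ)
    (h₁ : ∀ α, |Q₁ α - poisson E₁ η (ev α)| ≤ δ) (h₂ : ∀ α, |Q₂ α - poisson E₂ η (ev α)| ≤ δ)
    (K : BMat r N) :
    |∑ α, ∑ β, Q₁ α * Q₂ β * ‖coef φ K β α‖ ^ 2 - qvar φ ev E₁ E₂ η K|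
      ≤ δ * (2 * η⁻¹ + δ) * ∑ a, ∑ b, ‖K b a‖ ^ 2 := by
  unfold qvar
  rw [← sum_coef_sq (φ := φ), Finset.mul_sum, ← Finset.sum_sub_distrib]
  refine (Finset.abs_sum_le_sum_abs _ _).trans (Finset.sum_le_sum fun α _ => ?_)
  rw [Finset.mul_sum, ← Finset.sum_sub_distrib]
  refine (Finset.abs_sum_le_sum_abs _ _).trans (Finset.sum_le_sum fun β _ => ?_)
  rw [← sub_mul, abs_mul, abs_of_nonneg (by positivity : 0 ≤ ‖coef φ K β α‖ ^ 2)]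
  gcongr
  have e : Q₁ α * Q₂ β - poisson E₁ η (ev α) * poisson E₂ η (ev β)
      = (Q₁ α - poisson E₁ η (ev α)) * (Q₂ β - poisson E₂ η (ev β))
        + (Q₁ α - poisson E₁ η (ev α)) * poisson E₂ η (ev β)
        + poisson E₁ η (ev α) * (Q₂ β - poisson E₂ η (ev β)) := by ring
  have p1 : |poisson E₁ η (ev α)| ≤ η⁻¹ := by
    rw [abs_of_pos (poisson_pos hη _)]; exact poisson_le hη _
  have p2 : |poisson E₂ η (ev β)| ≤ η⁻¹ := by
    rw [abs_of_pos (poisson_pos hη _)]; exact poisson_le hη _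
  rw [e]
  refine (abs_add_le _ _).trans ((add_le_add_left (abs_add_le _ _) _).trans ?_)
  rw [abs_mul, abs_mul, abs_mul]
  have a1 := mul_le_mul (h₁ α) (h₂ β) (abs_nonneg _) hδ
  have a2 := mul_le_mul (h₁ α) p2 (abs_nonneg _) hδ
  have a3 := mul_le_mul p1 (h₂ β) (abs_nonneg _) (by positivity)
  linarith

end One

/-! ### The limit of the variance of one piece as a sum of correlations -/

section Asymptotics

variable {d : ℕ → ℕ} {ρ : ∀ k, Γ →* Equiv.Perm (Fin (d k))}

/-- A pair with `t⁻¹htg ≠ 1` contributes at most a constant times the fixed points of a nontrivial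
element, which is `o(N)`. A pair with `t⁻¹htg = 1` gives the correlation at `g` exactly. -/
theorem ConvDistrib.tendsto_trace_piece (hρ : ConvDistrib ρ) (t : Γ) (l i : Fin r)
    {u : ∀ k, Fin (d k) → ℂ} {C : ℝ} (hu : ∀ k y, ‖u k y‖ ≤ C) (q₁ q₂ : MatAlg r Γ)
    (F : Finset Γ) (hF : q₁.coeff.support ⊆ F) :
    Tendsto (fun k => (1 / (d k : ℂ)) * ((piece (ρ k) t l i (u k)).conjTranspose
        * matPermRep (ρ k) q₂ * piece (ρ k) t l i (u k) * matPermRep (ρ k) q₁).trace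
      - ∑ g ∈ F, q₁.coeff g i i * q₂.coeff (t * g⁻¹ * t⁻¹) l l * corr (ρ k) (u k) g)
      atTop (𝓝 0) := by
  classical
  have key (g h : Γ) : Tendsto (fun k => (1 / (d k : ℂ)) * (q₁.coeff g i i * q₂.coeff h l l *
        ∑ y, if ρ k (t⁻¹ * h * t * g) y = y then starRingEnd ℂ (u k y) * u k (ρ k g y) else 0)
      - if h = t * g⁻¹ * t⁻¹ then q₁.coeff g i i * q₂.coeff h l l * corr (ρ k) (u k) g else 0)
      atTop (𝓝 0) := by
    by_cases hh : h = t * g⁻¹ * t⁻¹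
    · refine tendsto_const_nhds.congr fun k => ?_
      have : t⁻¹ * h * t * g = 1 := by rw [hh]; group
      rw [this, if_pos hh, map_one, corr]
      simp only [Equiv.Perm.one_apply, if_true]
      ring
    · have hne : t⁻¹ * h * t * g ≠ 1 := by
        intro h1
        apply hh
        have : h = t * (t⁻¹ * h * t * g) * g⁻¹ * t⁻¹ := by group
        rw [this, h1, mul_one]
      simp only [if_neg hh, sub_zero]
      have hfix := ((hρ.tendsto_fixCount hne).const_mul
        (‖q₁.coeff g i i * q₂.coeff h l l‖ * (C * C)))
      rw [mul_zero] at hfix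
      refine squeeze_zero_norm (fun k => ?_) hfix
      have hs : ‖∑ y, if ρ k (t⁻¹ * h * t * g) y = y then
          starRingEnd ℂ (u k y) * u k (ρ k g y) else 0‖
          ≤ C * C * fixCount (ρ k (t⁻¹ * h * t * g)) := by
        rw [fixCount, Finset.mul_sum]
        refine (norm_sum_le _ _).trans (Finset.sum_le_sum fun y _ => ?_)
        split_ifs
        · rw [norm_mul, RCLike.norm_conj, mul_one]
          exact mul_le_mul (hu k _) (hu k _) (norm_nonneg _) ((norm_nonneg _).trans (hu k y))
        · simp
      rw [norm_mul, norm_mul _ (∑ y, _), norm_div, norm_one, Complex.norm_natCast]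
      calc 1 / (d k : ℝ) * (‖q₁.coeff g i i * q₂.coeff h l l‖ * ‖∑ y, _‖)
          ≤ 1 / (d k : ℝ) * (‖q₁.coeff g i i * q₂.coeff h l l‖ *
            (C * C * fixCount (ρ k (t⁻¹ * h * t * g)))) := by gcongr
        _ = _ := by ring
  have hsum := tendsto_finsetSum q₁.coeff.support fun g _ =>
    tendsto_finsetSum q₂.coeff.support fun h _ => key g h
  simp only [Finset.sum_const_zero] at hsum
  refine hsum.congr fun k => ?_
  simp only [Finset.sum_sub_distrib]
  congr 1
  · rw [trace_piece, Finset.mul_sum]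
    simp only [Finset.mul_sum]
  · rw [← Finset.sum_subset hF]
    · refine Finset.sum_congr rfl fun g _ => ?_
      rw [Finset.sum_ite_eq']
      split_ifs with h1
      · rfl
      · rw [Finsupp.notMem_support_iff.1 h1]; simp
    · intro g _ hg
      rw [Finsupp.notMem_support_iff.1 hg]; simp

/-- Cauchy–Schwarz on `(a' - a) b' + a (b' - b)`; this telescoping is why `m₁` bounds the
unperturbed `a` but `m₂` the perturbed `b'`. -/
theorem sum_norm_mul_sub_le (F : Finset Γ) {a a' b b' : Γ → ℂ} {δ m₁ m₂ : ℝ} (hδ : 0 ≤ δ)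
    (hm₁ : 0 ≤ m₁) (hm₂ : 0 ≤ m₂)
    (ha : ∑ g ∈ F, ‖a' g - a g‖ ^ 2 ≤ δ ^ 2) (hb : ∑ g ∈ F, ‖b' g - b g‖ ^ 2 ≤ δ ^ 2)
    (ha' : ∑ g ∈ F, ‖a g‖ ^ 2 ≤ m₁ ^ 2) (hb' : ∑ g ∈ F, ‖b' g‖ ^ 2 ≤ m₂ ^ 2) :
    ∑ g ∈ F, ‖a' g * b' g - a g * b g‖ ≤ δ * m₂ + m₁ * δ := by
  have cs (f₁ f₂ : Γ → ℂ) {c₁ c₂ : ℝ} (h1 : 0 ≤ c₁) (h2 : 0 ≤ c₂)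
      (hf₁ : ∑ g ∈ F, ‖f₁ g‖ ^ 2 ≤ c₁ ^ 2) (hf₂ : ∑ g ∈ F, ‖f₂ g‖ ^ 2 ≤ c₂ ^ 2) :
      ∑ g ∈ F, ‖f₁ g‖ * ‖f₂ g‖ ≤ c₁ * c₂ := by
    refine (Real.sum_mul_le_sqrt_mul_sqrt F _ _).trans ?_
    exact mul_le_mul (Real.sqrt_le_iff.2 ⟨h1, hf₁⟩) (Real.sqrt_le_iff.2 ⟨h2, hf₂⟩)
      (Real.sqrt_nonneg _) h1
  calc ∑ g ∈ F, ‖a' g * b' g - a g * b g‖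
      ≤ ∑ g ∈ F, (‖a' g - a g‖ * ‖b' g‖ + ‖a g‖ * ‖b' g - b g‖) := by
        refine Finset.sum_le_sum fun g _ => ?_
        have : a' g * b' g - a g * b g = (a' g - a g) * b' g + a g * (b' g - b g) := by ring
        rw [this, ← norm_mul, ← norm_mul]
        exact norm_add_le _ _
    _ ≤ _ := by
        rw [Finset.sum_add_distrib]
        exact add_le_add (cs (fun g => a' g - a g) b' hδ hm₂ ha hb')
          (cs a (fun g => b' g - b g) hm₁ hδ ha' hb)

variable {p : MatAlg r Γ}
  {φ : ∀ k, OrthonormalBasis (Fin (r * d k)) ℂ (EuclideanSpace ℂ (Fin r × Fin (d k)))}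
  {ev : ∀ k, Fin (r * d k) → ℝ}

/-- The limit of the normalised quantum variance of a piece is governed by the products of the
resolvent coefficients. -/
def resolvCoef (p : MatAlg r Γ) (E₁ E₂ η : ℝ) (t : Γ) (l i : Fin r) (g : Γ) : ℂ :=
  opBlock (imResolv p (E₁ + η * Complex.I)) g 1 i i *
    opBlock (imResolv p (E₂ + η * Complex.I)) (t * g⁻¹ * t⁻¹) 1 l l

theorem sum_conj_image (F : Finset Γ) (t : Γ) [DecidableEq Γ] (f : Γ → ℝ) :
    ∑ g ∈ F, f (t * g⁻¹ * t⁻¹) = ∑ h ∈ F.image fun g => t * g⁻¹ * t⁻¹, f h := by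
  rw [Finset.sum_image]
  intro g _ g' _ h
  simpa using h

/-- Both kernels are replaced by polynomials. On the finite side the cost is a Hilbert–Schmidt norm
of size `O(N)`; on the limiting side it is an `ℓ²` error for columns of the resolvent, which
suffices because correlations are bounded. `F₀` is the support of the first polynomial evaluated at
`p`, so it depends on `η` and `ε` but not on `N`. -/
theorem qvar_piece_le (hp : IsSelfAdj p) (hd : Tendsto d atTop atTop)
    (hρ : ConvDistrib ρ) (hφ : ∀ k, IsEigenbasis (matPermRep (ρ k) p) (φ k) (ev k))
    {E₁ E₂ η : ℝ} (hη : 0 < η) (t : Γ) (l i : Fin r) {u : ∀ k, Fin (d k) → ℂ} {C : ℝ}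
    (hu : ∀ k y, ‖u k y‖ ≤ C) {ε : ℝ} (hε : 0 < ε) :
    ∃ F₀ : Finset Γ, ∀ F, F₀ ⊆ F → ∀ᶠ k in atTop,
      qvar (φ k) (ev k) E₁ E₂ η (piece (ρ k) t l i (u k)) / d k
        ≤ ‖∑ g ∈ F, resolvCoef p E₁ E₂ η t l i g * corr (ρ k) (u k) g‖ + ε := by
  classical
  set W₁ := imResolv p (E₁ + η * Complex.I) with hW₁
  set W₂ := imResolv p (E₂ + η * Complex.I) with hW₂
  -- `δ * B` is the total replacement error: the first summand comes from `abs_qvar_sub_le` with `δ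
  -- ≤ 1`, the second from `sum_norm_mul_sub_le`, where `‖W₂‖ + 1` bounds the norm of the polynomial
  -- approximating `W₂`.
  set B : ℝ := C ^ 2 * (2 * η⁻¹ + 1) + C ^ 2 * (‖W₂‖ + 1 + ‖W₁‖) with hB
  have hB0 : 0 ≤ B := by positivity
  obtain ⟨δ, hδ0, hδ1, hδB⟩ : ∃ δ : ℝ, 0 < δ ∧ δ ≤ 1 ∧ δ * B ≤ ε / 2 := by
    refine ⟨min 1 (ε / 2 / (B + 1)), by positivity, min_le_left _ _, ?_⟩
    calc min 1 (ε / 2 / (B + 1)) * B ≤ ε / 2 / (B + 1) * (B + 1) := by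
          gcongr
          · exact min_le_right _ _
          · linarith
      _ = ε / 2 := by field_simp
  obtain ⟨Q₁, hQ₁, hQW₁⟩ := exists_polynomial_approx hp (E := E₁) hη (coeffNorm p) hδ0
  obtain ⟨Q₂, hQ₂, hQW₂⟩ := exists_polynomial_approx hp (E := E₂) hη (coeffNorm p) hδ0
  set q₁ : MatAlg r Γ := Polynomial.aeval p Q₁ with hq₁
  set q₂ : MatAlg r Γ := Polynomial.aeval p Q₂ with hq₂
  have hblock (q : MatAlg r Γ) (g : Γ) (j : Fin r) :
      q.coeff g j j = opBlock (matRegRep q) g 1 j j := by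
    rw [opBlock_matRegRep, inv_one, mul_one]
  have hl2 (T : L2 Γ (EuclideanSpace ℂ (Fin r)) →L[ℂ] L2 Γ (EuclideanSpace ℂ (Fin r)))
      (G : Finset Γ) (j : Fin r) {c : ℝ} (hc : ‖T‖ ≤ c) :
      ∑ g ∈ G, ‖opBlock T g 1 j j‖ ^ 2 ≤ c ^ 2 := by
    refine (sum_norm_opBlock_sq_le T G 1 j j).trans ?_
    gcongr
    refine (T.le_opNorm _).trans ?_
    rw [norm_deltaVec, mul_one]
    exact hc
  refine ⟨q₁.coeff.support, fun F hF => ?_⟩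
  have hlim := (hρ.tendsto_trace_piece t l i hu q₁ q₂ F hF).norm
  rw [norm_zero] at hlim
  have hcoefs : ∑ g ∈ F, ‖q₁.coeff g i i * q₂.coeff (t * g⁻¹ * t⁻¹) l l
      - resolvCoef p E₁ E₂ η t l i g‖ ≤ δ * (‖W₂‖ + 1) + ‖W₁‖ * δ := by
    refine sum_norm_mul_sub_le F hδ0.le (norm_nonneg _) (by positivity) ?_ ?_ ?_ ?_
    · simp only [hblock, ← Matrix.sub_apply, ← opBlock_sub]
      exact hl2 _ _ _ hQW₁
    · simp only [hblock, ← Matrix.sub_apply, ← opBlock_sub]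
      rw [sum_conj_image F t fun h => ‖opBlock (matRegRep q₂ - W₂) h 1 l l‖ ^ 2]
      exact hl2 _ _ _ hQW₂
    · exact hl2 _ _ _ le_rfl
    · simp only [hblock]
      rw [sum_conj_image F t fun h => ‖opBlock (matRegRep q₂) h 1 l l‖ ^ 2]
      refine hl2 _ _ _ ?_
      have := norm_add_le (matRegRep q₂ - W₂) W₂
      rw [sub_add_cancel] at this
      linarith
  filter_upwards [hlim.eventually (gt_mem_nhds (half_pos hε)), hd.eventually_gt_atTop 0]
    with k hk hk0
  have hdk : (0 : ℝ) < d k := by exact_mod_cast hk0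
  have hC : 0 ≤ C := (norm_nonneg _).trans (hu k ⟨0, hk0⟩)
  set K := piece (ρ k) t l i (u k) with hK
  have hKsq : ∑ a, ∑ b, ‖K b a‖ ^ 2 ≤ d k * C ^ 2 := by
    rw [hK, sum_piece_sq]
    refine (Finset.sum_le_card_nsmul _ _ (C ^ 2) fun y _ => ?_).trans (by simp)
    gcongr
    exact hu k y
  have hQ := abs_qvar_sub_le (φ := φ k) (ev := ev k) (E₁ := E₁) (E₂ := E₂) hη hδ0.le
    (Q₁ := fun α => Q₁.eval (ev k α)) (Q₂ := fun α => Q₂.eval (ev k α))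
    (fun α => hQ₁ _ (abs_le.1 (abs_eigenvalue_le (ρ k) p (hφ k) α)))
    (fun α => hQ₂ _ (abs_le.1 (abs_eigenvalue_le (ρ k) p (hφ k) α))) K
  set s := ∑ α, ∑ β, Q₁.eval (ev k α) * Q₂.eval (ev k β) * ‖coef (φ k) K β α‖ ^ 2 with hs
  have hs2 : (s : ℂ) = (K.conjTranspose * matPermRep (ρ k) q₂ * K * matPermRep (ρ k) q₁).trace := by
    rw [hq₁, hq₂, matPermRep_aeval, matPermRep_aeval]
    exact sum_coef_mul_eq_trace ((hφ k).aeval Q₁) ((hφ k).aeval Q₂) K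
  rw [← hs2] at hk
  have hsk : s / d k ≤ ‖(1 / (d k : ℂ)) * s‖ := by
    rw [norm_mul, norm_div, norm_one, Complex.norm_natCast, Complex.norm_real, one_div_mul_eq_div]
    gcongr
    exact Real.le_norm_self _
  have hcorr : ‖∑ g ∈ F, q₁.coeff g i i * q₂.coeff (t * g⁻¹ * t⁻¹) l l * corr (ρ k) (u k) g
      - ∑ g ∈ F, resolvCoef p E₁ E₂ η t l i g * corr (ρ k) (u k) g‖
      ≤ (δ * (‖W₂‖ + 1) + ‖W₁‖ * δ) * C ^ 2 := by
    rw [← Finset.sum_sub_distrib]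
    refine (norm_sum_le _ _).trans (le_trans (Finset.sum_le_sum fun g _ => ?_)
      (le_of_eq_of_le (Finset.sum_mul _ _ _).symm
        (mul_le_mul_of_nonneg_right hcoefs (by positivity))))
    rw [← sub_mul, norm_mul]
    gcongr
    exact norm_corr_le _ hC (hu k) g
  have hq : qvar (φ k) (ev k) E₁ E₂ η K / d k ≤ s / d k + δ * (2 * η⁻¹ + 1) * C ^ 2 := by
    rw [div_add' _ _ _ hdk.ne', div_le_div_iff_of_pos_right hdk]
    have h1 := (abs_le.1 hQ).1
    have h2 : δ * (2 * η⁻¹ + δ) * ∑ a, ∑ b, ‖K b a‖ ^ 2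
        ≤ δ * (2 * η⁻¹ + 1) * (d k * C ^ 2) := by
      gcongr
    linarith
  have htri : ‖(1 / (d k : ℂ)) * s‖ ≤
      ‖∑ g ∈ F, resolvCoef p E₁ E₂ η t l i g * corr (ρ k) (u k) g‖
      + (δ * (‖W₂‖ + 1) + ‖W₁‖ * δ) * C ^ 2 + ε / 2 := by
    have e : (1 / (d k : ℂ)) * s
        = ∑ g ∈ F, resolvCoef p E₁ E₂ η t l i g * corr (ρ k) (u k) g
        + (∑ g ∈ F, q₁.coeff g i i * q₂.coeff (t * g⁻¹ * t⁻¹) l l * corr (ρ k) (u k) g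
          - ∑ g ∈ F, resolvCoef p E₁ E₂ η t l i g * corr (ρ k) (u k) g)
        + ((1 / (d k : ℂ)) * s
          - ∑ g ∈ F, q₁.coeff g i i * q₂.coeff (t * g⁻¹ * t⁻¹) l l * corr (ρ k) (u k) g) := by
      ring
    rw [e]
    refine (norm_add_le _ _).trans (add_le_add ((norm_add_le _ _).trans ?_) hk.le)
    gcongr
  have : δ * B = δ * (2 * η⁻¹ + 1) * C ^ 2 + (δ * (‖W₂‖ + 1) + ‖W₁‖ * δ) * C ^ 2 := by
    rw [hB]; ring
  linarith

end Asymptotics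

end Variance

/-! ### Reduction of ergodicity and mixing to weighted sums of correlations -/

section Reduction

variable {Γ : Type*} [Group Γ] {r : ℕ}

/-- The centred matrix coefficient `y ↦ K(t.y, y)_{li} - ⟨K(t.·, ·)_{li}⟩`. -/
def centredEntry {N : ℕ} (ρ : Γ →* Equiv.Perm (Fin N)) (K : BMat r N) (t : Γ) (l i : Fin r)
    (y : Fin N) : ℂ :=
  diagAt ρ K t y l i - avg (diagAt ρ K t) l i

section One

variable {N : ℕ} (ρ : Γ →* Equiv.Perm (Fin N)) (T : Finset Γ) (K : BMat r N)

/-- The sum of the pieces of `K`. It differs from `K` only at those `(x, y)` for which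
`x = t.y` for several `t ∈ T`. -/
def localSum : BMat r N :=
  ∑ m ∈ T ×ˢ (Finset.univ : Finset (Fin r × Fin r)),
    piece ρ m.1 m.2.1 m.2.2 fun y => diagAt ρ K m.1 y m.2.1 m.2.2

theorem sum_piece_apply (u : Γ → Fin r → Fin r → Fin N → ℂ) (l i : Fin r) (x y : Fin N) :
    (∑ m ∈ T ×ˢ (Finset.univ : Finset (Fin r × Fin r)),
      piece ρ m.1 m.2.1 m.2.2 (u m.1 m.2.1 m.2.2)) (l, x) (i, y)
      = ∑ t ∈ T, if x = ρ t y then u t l i y else 0 := by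
  rw [Finset.sum_product, Matrix.sum_apply]
  refine Finset.sum_congr rfl fun t _ => ?_
  rw [Matrix.sum_apply, Finset.sum_eq_single (l, i)]
  · rw [piece_apply]
    simp
  · rintro ⟨l', i'⟩ _ hne
    rw [piece_apply, if_neg]
    · simp
    · rintro ⟨h1, h2⟩
      exact hne (by rw [← h1, ← h2])
  · simp

theorem centre_apply (l i : Fin r) (x y : Fin N) :
    centre ρ T K (l, x) (i, y) = ∑ t ∈ T, if x = ρ t y then avg (diagAt ρ K t) l i else 0 := by
  rw [centre, Matrix.sum_apply]
  refine Finset.sum_congr rfl fun t _ => ?_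
  rw [Matrix.kroneckerMap_apply, permMat_apply]
  simp

theorem sub_centre_eq :
    K - centre ρ T K = ∑ m ∈ T ×ˢ (Finset.univ : Finset (Fin r × Fin r)),
        piece ρ m.1 m.2.1 m.2.2 (centredEntry ρ K m.1 m.2.1 m.2.2) + (K - localSum ρ T K) := by
  rw [← sub_eq_zero]
  ext ⟨l, x⟩ ⟨i, y⟩
  simp only [Matrix.sub_apply, Matrix.add_apply, localSum, Matrix.zero_apply]
  rw [sum_piece_apply ρ T (centredEntry ρ K) l i x y,
    sum_piece_apply ρ T (fun t l i y => diagAt ρ K t y l i) l i x y, centre_apply]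
  have : ∑ t ∈ T, (if x = ρ t y then centredEntry ρ K t l i y else 0)
      = ∑ t ∈ T, (if x = ρ t y then diagAt ρ K t y l i else 0)
        - ∑ t ∈ T, (if x = ρ t y then avg (diagAt ρ K t) l i else 0) := by
    rw [← Finset.sum_sub_distrib]
    refine Finset.sum_congr rfl fun t _ => ?_
    split_ifs <;> simp [centredEntry]
  rw [this]
  ring

variable {ρ T K}

theorem norm_apply_le_frob (A : Matrix (Fin r) (Fin r) ℂ) (i j : Fin r) : ‖A i j‖ ≤ frob A := by
  refine Real.le_sqrt_of_sq_le ?_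
  have h1 := Finset.single_le_sum (f := fun j' => ‖A i j'‖ ^ 2)
    (fun _ _ => by positivity) (Finset.mem_univ j)
  have h2 := Finset.single_le_sum (f := fun i' => ∑ j', ‖A i' j'‖ ^ 2)
    (fun _ _ => by positivity) (Finset.mem_univ i)
  exact h1.trans h2

theorem IsBddOne.norm_le (hK : IsBddOne K) (a b : Fin r × Fin N) : ‖K a b‖ ≤ 1 :=
  (norm_apply_le_frob (block K a.2 b.2) a.1 b.1).trans (hK _ _)

theorem IsBddOne.norm_centredEntry_le (hK : IsBddOne K) (t : Γ) (l i : Fin r) (y : Fin N) :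
    ‖centredEntry ρ K t l i y‖ ≤ 2 := by
  have h1 (y) : ‖diagAt ρ K t y l i‖ ≤ 1 := hK.norm_le (l, ρ t y) (i, y)
  have h2 : ‖avg (diagAt ρ K t) l i‖ ≤ 1 := by
    rw [avg, Matrix.smul_apply, Matrix.sum_apply, smul_eq_mul, norm_mul, norm_div, norm_one,
      Complex.norm_natCast, one_div_mul_eq_div]
    refine div_le_one_of_le₀ ?_ (by positivity)
    refine (norm_sum_le _ _).trans ((Finset.sum_le_card_nsmul _ _ 1 fun y _ => h1 y).trans ?_)
    simp
  refine (norm_sub_le _ _).trans ?_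
  linarith [h1 y]

/-- If `n` elements of `T` carry `y` to `x`, the entry of the difference is `(1 - n) K`. It vanishes
for `n = 0` by locality and for `n = 1`; for `n ≥ 2` some pair `t ≠ t'` makes the double sum at
least 1. -/
theorem norm_sub_localSum_sq_le (hL : IsLocal ρ T K) (hK : IsBddOne K) [DecidableEq Γ]
    (l i : Fin r) (x y : Fin N) :
    ‖(K - localSum ρ T K) (l, x) (i, y)‖ ^ 2
      ≤ (T.card : ℝ) ^ 2 * ∑ t ∈ T, ∑ t' ∈ T,
        if t ≠ t' then (if x = ρ t y ∧ x = ρ t' y then 1 else 0) else 0 := by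
  classical
  set n := (T.filter fun t => x = ρ t y).card with hn
  have hnT : n ≤ T.card := Finset.card_filter_le _ _
  have hval : (K - localSum ρ T K) (l, x) (i, y) = (1 - (n : ℂ)) * K (l, x) (i, y) := by
    rw [Matrix.sub_apply, localSum, sum_piece_apply ρ T (fun t l i y => diagAt ρ K t y l i) l i x y]
    have : ∑ t ∈ T, (if x = ρ t y then diagAt ρ K t y l i else 0)
        = ∑ t ∈ T, (if x = ρ t y then K (l, x) (i, y) else 0) := by
      refine Finset.sum_congr rfl fun t _ => ?_
      split_ifs with h
      · rw [h]; rfl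
      · rfl
    rw [this, ← Finset.sum_filter, Finset.sum_const, nsmul_eq_mul, ← hn]
    ring
  have hnn : 0 ≤ ∑ t ∈ T, ∑ t' ∈ T,
        (if t ≠ t' then (if x = ρ t y ∧ x = ρ t' y then (1 : ℝ) else 0) else 0) :=
    Finset.sum_nonneg fun t _ => Finset.sum_nonneg fun t' _ => by split_ifs <;> simp
  rw [hval]
  rcases Nat.lt_or_ge n 2 with h2 | h2
  · have : (1 - (n : ℂ)) * K (l, x) (i, y) = 0 := by
      interval_cases n
      · have hK0 : block K x y = 0 := by
          refine hL x y ?_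
          rintro ⟨g, hg, hxg⟩
          have : g ∈ T.filter fun t => x = ρ t y := Finset.mem_filter.2 ⟨hg, hxg⟩
          rw [Finset.card_eq_zero.1 hn.symm] at this
          exact absurd this (Finset.notMem_empty _)
        have : K (l, x) (i, y) = block K x y l i := rfl
        rw [this, hK0]
        simp
      · simp
    rw [this, norm_zero, zero_pow two_ne_zero]
    exact mul_nonneg (by positivity) hnn
  · obtain ⟨t, ht, t', ht', hne⟩ := Finset.one_lt_card.1 h2
    rw [Finset.mem_filter] at ht ht'
    have h1 : (1 : ℝ) ≤ ∑ t ∈ T, ∑ t' ∈ T,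
        (if t ≠ t' then (if x = ρ t y ∧ x = ρ t' y then (1 : ℝ) else 0) else 0) := by
      refine le_trans ?_ (Finset.single_le_sum (f := fun t => ∑ t' ∈ T,
        (if t ≠ t' then (if x = ρ t y ∧ x = ρ t' y then (1 : ℝ) else 0) else 0)) (fun t _ =>
        Finset.sum_nonneg fun t' _ => by split_ifs <;> simp) ht.1)
      refine le_trans ?_ (Finset.single_le_sum (f := fun t' =>
        (if t ≠ t' then (if x = ρ t y ∧ x = ρ t' y then (1 : ℝ) else 0) else 0)) (fun t' _ =>
        by split_ifs <;> simp) ht'.1)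
      rw [if_pos hne, if_pos ⟨ht.2, ht'.2⟩]
    refine le_trans ?_ (le_mul_of_one_le_right (by positivity) h1)
    gcongr
    rw [norm_mul]
    have h3 : ‖1 - (n : ℂ)‖ ≤ T.card := by
      rw [norm_sub_rev]
      have : ((n : ℂ) - 1) = ((n - 1 : ℕ) : ℂ) := by
        rw [Nat.cast_sub (by omega)]; simp
      rw [this, Complex.norm_natCast]
      exact_mod_cast (Nat.sub_le n 1).trans hnT
    calc ‖1 - (n : ℂ)‖ * ‖K (l, x) (i, y)‖ ≤ T.card * 1 := by
          gcongr
          exact hK.norm_le _ _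
      _ = T.card := mul_one _

/-- A coincidence `t.y = t'.y` says that `y` is fixed by `t'⁻¹t`, so the remainder is controlled by
fixed points of nontrivial elements. -/
theorem sum_sub_localSum_sq_le (hL : IsLocal ρ T K) (hK : IsBddOne K) [DecidableEq Γ] :
    ∑ a, ∑ b, ‖(K - localSum ρ T K) b a‖ ^ 2
      ≤ (r : ℝ) ^ 2 * (T.card : ℝ) ^ 2 * ∑ t ∈ T, ∑ t' ∈ T,
        if t ≠ t' then fixCount (ρ (t'⁻¹ * t)) else 0 := by
  have hfix (t t' : Γ) : ∑ y, ∑ x, (if x = ρ t y ∧ x = ρ t' y then (1 : ℝ) else 0)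
      = fixCount (ρ (t'⁻¹ * t)) := by
    refine Finset.sum_congr rfl fun y _ => ?_
    rw [Finset.sum_eq_single (ρ t y)]
    · simp only [map_mul, map_inv, Equiv.Perm.mul_apply, Equiv.Perm.inv_eq_iff_eq, true_and]
    · intro x _ hx
      rw [if_neg fun h => hx h.1]
    · simp
  calc ∑ a, ∑ b, ‖(K - localSum ρ T K) b a‖ ^ 2
      = ∑ i, ∑ l, ∑ y, ∑ x, ‖(K - localSum ρ T K) (l, x) (i, y)‖ ^ 2 := by
        simp only [Fintype.sum_prod_type]
        exact Finset.sum_congr rfl fun i _ => Finset.sum_comm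
    _ ≤ ∑ _i : Fin r, ∑ _l : Fin r, ∑ y, ∑ x, (T.card : ℝ) ^ 2 * ∑ t ∈ T, ∑ t' ∈ T,
        (if t ≠ t' then (if x = ρ t y ∧ x = ρ t' y then 1 else 0) else 0) := by
        gcongr
        exact norm_sub_localSum_sq_le hL hK _ _ _ _
    _ = _ := by
        simp only [Finset.sum_const, Finset.card_univ, Fintype.card_fin, nsmul_eq_mul,
          ← Finset.mul_sum]
        have : ∑ y, ∑ x, ∑ t ∈ T, ∑ t' ∈ T,
            (if t ≠ t' then (if x = ρ t y ∧ x = ρ t' y then (1 : ℝ) else 0) else 0)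
            = ∑ t ∈ T, ∑ t' ∈ T, if t ≠ t' then fixCount (ρ (t'⁻¹ * t)) else 0 := by
          calc _ = ∑ y, ∑ t ∈ T, ∑ x, ∑ t' ∈ T,
              (if t ≠ t' then (if x = ρ t y ∧ x = ρ t' y then (1 : ℝ) else 0) else 0) :=
                Finset.sum_congr rfl fun y _ => Finset.sum_comm
            _ = ∑ t ∈ T, ∑ y, ∑ x, ∑ t' ∈ T,
              (if t ≠ t' then (if x = ρ t y ∧ x = ρ t' y then (1 : ℝ) else 0) else 0) :=
                Finset.sum_comm
            _ = ∑ t ∈ T, ∑ y, ∑ t' ∈ T, ∑ x,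
              (if t ≠ t' then (if x = ρ t y ∧ x = ρ t' y then (1 : ℝ) else 0) else 0) :=
                Finset.sum_congr rfl fun t _ => Finset.sum_congr rfl fun y _ => Finset.sum_comm
            _ = ∑ t ∈ T, ∑ t' ∈ T, ∑ y, ∑ x,
              (if t ≠ t' then (if x = ρ t y ∧ x = ρ t' y then (1 : ℝ) else 0) else 0) :=
                Finset.sum_congr rfl fun t _ => Finset.sum_comm
            _ = _ := by
                refine Finset.sum_congr rfl fun t _ => Finset.sum_congr rfl fun t' _ => ?_
                by_cases h : t ≠ t'
                · simp only [if_pos h, hfix]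
                · simp [if_neg h]
        rw [this]
        ring

end One

variable {d : ℕ → ℕ} {ρ : ∀ k, Γ →* Equiv.Perm (Fin (d k))} {p : MatAlg r Γ} {T : Finset Γ}
  {φ : ∀ k, OrthonormalBasis (Fin (r * d k)) ℂ (EuclideanSpace ℂ (Fin r × Fin (d k)))}
  {ev : ∀ k, Fin (r * d k) → ℝ} {K : ∀ k, BMat r (d k)}

theorem ConvDistrib.tendsto_sub_localSum (hρ : ConvDistrib ρ) (hL : ∀ k, IsLocal (ρ k) T (K k))
    (hK : ∀ k, IsBddOne (K k)) :
    Tendsto (fun k => (∑ a, ∑ b, ‖(K k - localSum (ρ k) T (K k)) b a‖ ^ 2) / d k) atTop (𝓝 0) := by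
  classical
  have h : Tendsto (fun k => (r : ℝ) ^ 2 * (T.card : ℝ) ^ 2 * ∑ t ∈ T, ∑ t' ∈ T,
        if t ≠ t' then fixCount (ρ k (t'⁻¹ * t)) / d k else 0) atTop
      (𝓝 ((r : ℝ) ^ 2 * (T.card : ℝ) ^ 2 * ∑ t ∈ T, ∑ t' ∈ T, 0)) := by
    refine (tendsto_finsetSum _ fun t _ => tendsto_finsetSum _ fun t' _ => ?_).const_mul _
    split_ifs with hne
    · refine hρ.tendsto_fixCount fun h => hne ?_
      exact (inv_mul_eq_one.1 h).symm
    · exact tendsto_const_nhds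
  simp only [Finset.sum_const_zero, mul_zero] at h
  refine squeeze_zero (fun k => by positivity) (fun k => ?_) h
  refine (div_le_div_of_nonneg_right (sum_sub_localSum_sq_le (hL k) (hK k))
    (Nat.cast_nonneg _)).trans (le_of_eq ?_)
  rw [mul_div_assoc, Finset.sum_div]
  congr 1
  refine Finset.sum_congr rfl fun t _ => ?_
  rw [Finset.sum_div]
  refine Finset.sum_congr rfl fun t' _ => ?_
  rw [ite_div, zero_div]

variable {a₀ a b b₀ : ℝ}

/-- The order of quantifiers in `hcorr` matters: first the scale `η`, then the finite set `F`, then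
`N`, since `F` is dictated by the polynomial approximation at scale `η`. -/
theorem eventually_qvar_le (hp : IsSelfAdj p) (hd : Tendsto d atTop atTop)
    (hρ : ConvDistrib ρ) (hφ : ∀ k, IsEigenbasis (matPermRep (ρ k) p) (φ k) (ev k))
    (hL : ∀ k, IsLocal (ρ k) T (K k)) (hK : ∀ k, IsBddOne (K k))
    (hcorr : ∀ t ∈ T, ∀ l i : Fin r, ∀ ε > 0, ∀ᶠ η in 𝓝[>] (0 : ℝ), ∀ E₁ ∈ Set.Icc a b,
      ∀ E₂ ∈ Set.Icc a b, ∀ F : Finset Γ, ∀ᶠ k in atTop,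
      η * ‖∑ g ∈ F, resolvCoef p E₁ E₂ η t l i g *
        corr (ρ k) (centredEntry (ρ k) (K k) t l i) g‖ ≤ ε) {ε : ℝ} (hε : 0 < ε) :
    ∀ᶠ η in 𝓝[>] (0 : ℝ), ∀ E₁ ∈ Set.Icc a b, ∀ E₂ ∈ Set.Icc a b, ∀ᶠ k in atTop,
      η * qvar (φ k) (ev k) E₁ E₂ η (K k - centre (ρ k) T (K k)) ≤ ε * d k := by
  set s := T ×ˢ (Finset.univ : Finset (Fin r × Fin r)) with hs
  set n : ℝ := (s.card : ℝ) with hn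
  have hn0 : 0 ≤ n := Nat.cast_nonneg _
  -- There is a factor 2 from splitting off the remainder, `n` from Cauchy–Schwarz, and `n` pieces
  -- of size `2ε'`: in total `4n²ε' ≤ ε/2`.
  set ε' : ℝ := ε / (8 * (n + 1) ^ 2) with hε'
  have hε'0 : 0 < ε' := by positivity
  have h1 : ∀ᶠ η in 𝓝[>] (0 : ℝ), ∀ m ∈ s, ∀ E₁ ∈ Set.Icc a b, ∀ E₂ ∈ Set.Icc a b,
      ∀ F : Finset Γ, ∀ᶠ k in atTop, η * ‖∑ g ∈ F, resolvCoef p E₁ E₂ η m.1 m.2.1 m.2.2 g *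
        corr (ρ k) (centredEntry (ρ k) (K k) m.1 m.2.1 m.2.2) g‖ ≤ ε' :=
    (Finset.eventually_all s).2 fun m hm =>
      hcorr m.1 (Finset.mem_product.1 hm).1 m.2.1 m.2.2 ε' hε'0
  filter_upwards [h1, Ioc_mem_nhdsGT (zero_lt_one (α := ℝ))] with η hη ⟨hη0, hη1⟩ E₁ hE₁ E₂ hE₂
  have h2 : ∀ᶠ k in atTop, ∀ m ∈ s, η * qvar (φ k) (ev k) E₁ E₂ η
      (piece (ρ k) m.1 m.2.1 m.2.2 (centredEntry (ρ k) (K k) m.1 m.2.1 m.2.2)) / d k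
      ≤ 2 * ε' := by
    refine (Finset.eventually_all s).2 fun m hm => ?_
    obtain ⟨F, hF⟩ := qvar_piece_le (E₁ := E₁) (E₂ := E₂) hp hd hρ hφ hη0 m.1 m.2.1 m.2.2
      (fun k y => (hK k).norm_centredEntry_le (ρ := ρ k) m.1 m.2.1 m.2.2 y) hε'0
    filter_upwards [hF F subset_rfl, hη m hm E₁ hE₁ E₂ hE₂ F] with k hk1 hk2
    rw [mul_div_assoc]
    calc η * _ ≤ η * (_ + ε') := mul_le_mul_of_nonneg_left hk1 hη0.le
      _ ≤ 2 * ε' := by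
        rw [mul_add]
        have : η * ε' ≤ 1 * ε' := by gcongr
        linarith
  -- With `η` fixed, the `o(N)` remainder can be taken below `εη/4`, which compensates the `η⁻²` of
  -- `qvar_le` and the prefactor `η`.
  have h3 := (hρ.tendsto_sub_localSum hL hK).eventually
    (gt_mem_nhds (show 0 < ε * η / 4 by positivity))
  filter_upwards [h2, h3, hd.eventually_gt_atTop 0] with k hk2 hk3 hk0
  have hdk : (0 : ℝ) < d k := by exact_mod_cast hk0
  rw [div_lt_iff₀ hdk] at hk3
  rw [sub_centre_eq]
  have e1 := qvar_add_le (φ := φ k) (ev := ev k) (E₁ := E₁) (E₂ := E₂) hη0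
    (∑ m ∈ s, piece (ρ k) m.1 m.2.1 m.2.2 (centredEntry (ρ k) (K k) m.1 m.2.1 m.2.2))
    (K k - localSum (ρ k) T (K k))
  have e2 := qvar_sum_le (φ := φ k) (ev := ev k) (E₁ := E₁) (E₂ := E₂) hη0 s
    (fun m => piece (ρ k) m.1 m.2.1 m.2.2 (centredEntry (ρ k) (K k) m.1 m.2.1 m.2.2))
  have e3 := qvar_le (φ := φ k) (ev := ev k) (E₁ := E₁) (E₂ := E₂) hη0
    (K k - localSum (ρ k) T (K k))
  have e4 : η * ∑ m ∈ s, qvar (φ k) (ev k) E₁ E₂ η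
      (piece (ρ k) m.1 m.2.1 m.2.2 (centredEntry (ρ k) (K k) m.1 m.2.1 m.2.2))
      ≤ n * (2 * ε' * d k) := by
    rw [Finset.mul_sum, hn, ← nsmul_eq_mul]
    refine Finset.sum_le_card_nsmul _ _ _ fun m hm => ?_
    have := hk2 m hm
    rwa [div_le_iff₀ hdk] at this
  have e5 : η * ((η⁻¹) ^ 2 * (ε * η / 4 * d k)) = ε / 4 * d k := by
    field_simp
  have e6 : 2 * (n * (n * (2 * ε' * d k))) ≤ ε / 2 * d k := by
    have : n * n ≤ (n + 1) ^ 2 := by nlinarith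
    calc 2 * (n * (n * (2 * ε' * d k))) = 4 * (n * n) * ε' * d k := by ring
      _ ≤ 4 * (n + 1) ^ 2 * ε' * d k := by gcongr
      _ = ε / 2 * d k := by rw [hε']; field_simp; norm_num
  have e7 := mul_le_mul_of_nonneg_left hk3.le (sq_nonneg η⁻¹)
  calc η * qvar (φ k) (ev k) E₁ E₂ η _
      ≤ η * (2 * (n * ∑ m ∈ s, qvar (φ k) (ev k) E₁ E₂ η
      (piece (ρ k) m.1 m.2.1 m.2.2 (centredEntry (ρ k) (K k) m.1 m.2.1 m.2.2))
        + (η⁻¹) ^ 2 * (ε * η / 4 * d k))) := by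
        refine mul_le_mul_of_nonneg_left (e1.trans ?_) hη0.le
        linarith
    _ = 2 * (n * (η * ∑ m ∈ s, qvar (φ k) (ev k) E₁ E₂ η
      (piece (ρ k) m.1 m.2.1 m.2.2 (centredEntry (ρ k) (K k) m.1 m.2.1 m.2.2))))
        + 2 * (η * ((η⁻¹) ^ 2 * (ε * η / 4 * d k))) := by ring
    _ ≤ 2 * (n * (n * (2 * ε' * d k))) + 2 * (ε / 4 * d k) := by
        rw [e5]; gcongr
    _ ≤ ε * d k := by linarith

theorem sum_biUnion_le {ι κ : Type*} [DecidableEq κ] (s : Finset ι) (t : ι → Finset κ)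
    {f : κ → ℝ} (hf : ∀ x, 0 ≤ f x) : ∑ x ∈ s.biUnion t, f x ≤ ∑ i ∈ s, ∑ x ∈ t i, f x := by
  classical
  induction s using Finset.induction_on with
  | empty => simp
  | insert i s hi ih =>
    rw [Finset.biUnion_insert, Finset.sum_insert hi]
    have h := Finset.sum_union_inter (s₁ := t i) (s₂ := s.biUnion t) (f := f)
    have h2 : 0 ≤ ∑ x ∈ t i ∩ s.biUnion t, f x := Finset.sum_nonneg fun x _ => hf x
    linarith

/-- A diagonal coefficient is one term of the double sum over a window containing `λ_α`. About `(b -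
a)/η` windows, each contributing at most `4ηε'N`, cover `I`, so the powers of `η` cancel and one
small fixed `η` suffices. -/
theorem qErgodic_of_eventually_qvar_le (hp : IsSelfAdj p) (hd : Tendsto d atTop atTop)
    (hρ : ConvDistrib ρ) (hφ : ∀ k, IsEigenbasis (matPermRep (ρ k) p) (φ k) (ev k))
    (ha₀ : a₀ < a) (hab : a < b) (hb₀ : b < b₀) (hAC : ACOn p a₀ b₀)
    (hV : ∀ ε > 0, ∀ᶠ η in 𝓝[>] (0 : ℝ), ∀ E₁ ∈ Set.Icc a b, ∀ E₂ ∈ Set.Icc a b, ∀ᶠ k in atTop,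
      η * qvar (φ k) (ev k) E₁ E₂ η (K k - centre (ρ k) T (K k)) ≤ ε * d k) :
    QErgodic ρ T φ ev K (Set.Icc a b) := by
  obtain ⟨C₀, hC₀, hAC⟩ := hAC
  -- The window of half-width `η₁` about the midpoint lies in `[a, b]`, which gives `|Λ_I| ≥ cN`.
  set η₁ : ℝ := min 1 ((b - a) / 2) with hη₁
  have hη₁0 : 0 < η₁ := by
    have : 0 < b - a := by linarith
    positivity
  set c : ℝ := η₁ / (32 * C₀ ^ 3) with hc
  have hc0 : 0 < c := by positivity
  have hcard := eventually_card_eigSet_ge hp hd hρ hφ (E := (a + b) / 2) hC₀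
    (hAC _ ⟨by linarith, by linarith⟩) (η := η₁) ⟨hη₁0, min_le_left _ _⟩
  rw [QErgodic, Metric.tendsto_nhds]
  intro ε hε
  have hba : 0 < b - a := by linarith
  set ε' : ℝ := c * ε / (8 * (b - a + 1)) with hε'
  have hε'0 : 0 < ε' := by positivity
  obtain ⟨η, hη, hη0, hη1⟩ := ((hV ε' hε'0).and
    (Ioc_mem_nhdsGT (zero_lt_one (α := ℝ)))).exists
  -- The centres `a + jη` with `j < n` stay in `[a, b]`, where the variance bound is available; the
  -- last window may protrude beyond `b`.
  set n := ⌊(b - a) / η⌋₊ + 1 with hn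
  have hcent (j : ℕ) (hj : j ∈ Finset.range n) : a + j * η ∈ Set.Icc a b := by
    rw [Finset.mem_range, hn, Nat.lt_succ_iff, Nat.le_floor_iff (by positivity),
      le_div_iff₀ hη0] at hj
    refine ⟨?_, by linarith⟩
    have : 0 ≤ (j : ℝ) * η := by positivity
    linarith
  have hev := (Finset.eventually_all (Finset.range n)).2 fun j hj =>
    hη _ (hcent j hj) _ (hcent j hj)
  filter_upwards [hcard, hev, hd.eventually_gt_atTop 0] with k hk1 hk2 hk0
  have hdk : (0 : ℝ) < d k := by exact_mod_cast hk0
  set Kc := K k - centre (ρ k) T (K k) with hKc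
  have hcardI : c * d k ≤ ((eigSet (ev k) (Set.Icc a b)).card : ℝ) := by
    refine hk1.trans ?_
    gcongr
    intro α hα
    rw [mem_eigSet] at hα ⊢
    have : η₁ ≤ (b - a) / 2 := min_le_right _ _
    exact ⟨by linarith [hα.1], by linarith [hα.2]⟩
  have hcard0 : (0 : ℝ) < (eigSet (ev k) (Set.Icc a b)).card := lt_of_lt_of_le (by positivity) hcardI
  have hcover : ∑ α ∈ eigSet (ev k) (Set.Icc a b), ‖coef (φ k) Kc α α‖ ^ 2
      ≤ ∑ j ∈ Finset.range n,
        ∑ α ∈ eigSet (ev k) (Set.Icc (a + j * η - η) (a + j * η + η)),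
          ∑ β ∈ eigSet (ev k) (Set.Icc (a + j * η - η) (a + j * η + η)),
            ‖coef (φ k) Kc β α‖ ^ 2 := by
    have hsub : eigSet (ev k) (Set.Icc a b) ⊆ (Finset.range n).biUnion fun j =>
        eigSet (ev k) (Set.Icc (a + j * η - η) (a + j * η + η)) := by
      intro α hα
      rw [mem_eigSet] at hα
      rw [Finset.mem_biUnion]
      refine ⟨⌊(ev k α - a) / η⌋₊, ?_, ?_⟩
      · rw [Finset.mem_range, hn, Nat.lt_succ_iff]
        refine Nat.floor_le_floor ?_
        have := hα.2
        gcongr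
      · have h0 : 0 ≤ (ev k α - a) / η := div_nonneg (by linarith [hα.1]) hη0.le
        have h1 := Nat.floor_le h0
        have h2 := Nat.lt_floor_add_one ((ev k α - a) / η)
        rw [le_div_iff₀ hη0] at h1
        rw [div_lt_iff₀ hη0] at h2
        rw [mem_eigSet]
        exact ⟨by linarith, by linarith⟩
    refine (Finset.sum_le_sum_of_subset_of_nonneg hsub fun _ _ _ => by positivity).trans ?_
    refine (sum_biUnion_le _ _ fun _ => by positivity).trans ?_
    refine Finset.sum_le_sum fun j _ => Finset.sum_le_sum fun α hα => ?_
    exact Finset.single_le_sum (f := fun β => ‖coef (φ k) Kc β α‖ ^ 2)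
      (fun _ _ => by positivity) hα
  have hwin : ∑ α ∈ eigSet (ev k) (Set.Icc a b), ‖coef (φ k) Kc α α‖ ^ 2
      ≤ n * (4 * η * (ε' * d k)) := by
    refine hcover.trans ?_
    have : (n : ℝ) * (4 * η * (ε' * d k)) = ∑ j ∈ Finset.range n, 4 * η * (ε' * d k) := by
      simp
    rw [this]
    refine Finset.sum_le_sum fun j hj => (sum_window_le hη0 Kc).trans ?_
    calc _ = 4 * η * (η * qvar (φ k) (ev k) (a + j * η) (a + j * η) η Kc) := by ring
      _ ≤ _ := mul_le_mul_of_nonneg_left (hk2 j hj) (by positivity)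
  have hnη : (n : ℝ) * η ≤ b - a + 1 := by
    rw [hn]
    push_cast
    have := Nat.floor_le (show 0 ≤ (b - a) / η by positivity)
    rw [le_div_iff₀ hη0] at this
    linarith
  simp only [← coef_sub]
  rw [Real.dist_eq, sub_zero, abs_of_nonneg (by positivity), one_div_mul_eq_div, div_lt_iff₀ hcard0]
  calc ∑ α ∈ eigSet (ev k) (Set.Icc a b), ‖coef (φ k) Kc α α‖ ^ 2
      ≤ n * (4 * η * (ε' * d k)) := hwin
    _ = (n * η) * (4 * ε' * d k) := by ring
    _ ≤ (b - a + 1) * (4 * ε' * d k) := by gcongr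
    _ = ε / 2 * (c * d k) := by rw [hε']; field_simp; norm_num
    _ ≤ ε / 2 * (eigSet (ev k) (Set.Icc a b)).card := by gcongr
    _ < ε * (eigSet (ev k) (Set.Icc a b)).card := by
        have := mul_pos hε hcard0
        linarith

theorem qMixing_of_eventually_qvar_le (hp : IsSelfAdj p) (hd : Tendsto d atTop atTop)
    (hρ : ConvDistrib ρ) (hφ : ∀ k, IsEigenbasis (matPermRep (ρ k) p) (φ k) (ev k))
    (ha₀ : a₀ < a) (hb₀ : b < b₀) (hAC : ACOn p a₀ b₀)
    (hV : ∀ ε > 0, ∀ᶠ η in 𝓝[>] (0 : ℝ), ∀ E₁ ∈ Set.Icc a b, ∀ E₂ ∈ Set.Icc a b, ∀ᶠ k in atTop,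
      η * qvar (φ k) (ev k) E₁ E₂ η (K k - centre (ρ k) T (K k)) ≤ ε * d k) :
    QMixing ρ T φ ev K (Set.Icc a b) := by
  obtain ⟨C₀, hC₀, hAC⟩ := hAC
  intro E₁ hE₁ E₂ hE₂
  have hE₁ := interior_subset hE₁
  have hE₂ := interior_subset hE₂
  rw [ENNReal.tendsto_nhds_zero]
  intro δ hδ
  obtain ⟨ε, hε0, hεδ⟩ : ∃ ε : ℝ, 0 < ε ∧ ENNReal.ofReal ε ≤ δ := by
    rcases eq_or_ne δ ⊤ with h | h
    · exact ⟨1, one_pos, h ▸ le_top⟩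
    · exact ⟨δ.toReal, ENNReal.toReal_pos hδ.ne' h, (ENNReal.ofReal_toReal h).le⟩
  -- Then `4η · ε'` equals `ε` times the lower bound `η / (32 C₀³)` for the eigenvalue density of
  -- the window.
  set ε' : ℝ := ε / (128 * C₀ ^ 3) with hε'
  have hε'0 : 0 < ε' := by positivity
  filter_upwards [hV ε' hε'0, Ioc_mem_nhdsGT (zero_lt_one (α := ℝ))] with η hη ⟨hη0, hη1⟩
  refine le_trans (limsup_le_of_le (by isBoundedDefault) ?_) hεδ
  have hcard := eventually_card_eigSet_ge hp hd hρ hφ (E := E₁) hC₀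
    (hAC _ ⟨by linarith [hE₁.1], by linarith [hE₁.2]⟩) (η := η) ⟨hη0, hη1⟩
  filter_upwards [hη E₁ hE₁ E₂ hE₂, hcard, hd.eventually_gt_atTop 0] with k hk1 hk2 hk0
  have hdk : (0 : ℝ) < d k := by exact_mod_cast hk0
  refine ENNReal.ofReal_le_ofReal ?_
  simp only [← coef_sub]
  set n := (eigSet (ev k) (Set.Icc (E₁ - η) (E₁ + η))).card with hn
  have hn0 : (0 : ℝ) < n := lt_of_lt_of_le (by positivity) hk2
  rw [one_div_mul_eq_div, div_le_iff₀ hn0]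
  refine (sum_window_le hη0 _).trans ?_
  calc 4 * η ^ 2 * qvar (φ k) (ev k) E₁ E₂ η (K k - centre (ρ k) T (K k))
      = 4 * η * (η * qvar (φ k) (ev k) E₁ E₂ η (K k - centre (ρ k) T (K k))) := by ring
    _ ≤ 4 * η * (ε' * d k) := by gcongr
    _ = ε * (η / (32 * C₀ ^ 3) * d k) := by rw [hε']; field_simp; norm_num
    _ ≤ ε * n := by gcongr

theorem qErgodic_and_qMixing_of_corr (hp : IsSelfAdj p) (hd : Tendsto d atTop atTop)
    (hρ : ConvDistrib ρ) (hφ : ∀ k, IsEigenbasis (matPermRep (ρ k) p) (φ k) (ev k))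
    (ha₀ : a₀ < a) (hab : a < b) (hb₀ : b < b₀) (hAC : ACOn p a₀ b₀)
    (hL : ∀ k, IsLocal (ρ k) T (K k)) (hK : ∀ k, IsBddOne (K k))
    (hcorr : ∀ t ∈ T, ∀ l i : Fin r, ∀ ε > 0, ∀ᶠ η in 𝓝[>] (0 : ℝ), ∀ E₁ ∈ Set.Icc a b,
      ∀ E₂ ∈ Set.Icc a b, ∀ F : Finset Γ, ∀ᶠ k in atTop,
      η * ‖∑ g ∈ F, resolvCoef p E₁ E₂ η t l i g *
        corr (ρ k) (centredEntry (ρ k) (K k) t l i) g‖ ≤ ε) :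
    QErgodic ρ T φ ev K (Set.Icc a b) ∧ QMixing ρ T φ ev K (Set.Icc a b) := by
  have hV := fun ε (hε : ε > 0) => eventually_qvar_le (a := a) (b := b) hp hd hρ hφ hL hK hcorr hε
  exact ⟨qErgodic_of_eventually_qvar_le hp hd hρ hφ ha₀ hab hb₀ hAC hV,
    qMixing_of_eventually_qvar_le hp hd hρ hφ ha₀ hb₀ hAC hV⟩

end Reduction

/-! ### Word length -/

section WordLength

variable {Γ : Type*} [Group Γ] {S : Finset Γ}

theorem wordLength_le_of_list {l : List Γ} (hl : ∀ s ∈ l, s ∈ S ∨ s⁻¹ ∈ S) :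
    wordLength S l.prod ≤ l.length :=
  Nat.sInf_le ⟨l, hl, rfl, rfl⟩

theorem exists_list_wordLength (hS : Subgroup.closure (S : Set Γ) = ⊤) (g : Γ) :
    ∃ l : List Γ, (∀ s ∈ l, s ∈ S ∨ s⁻¹ ∈ S) ∧ l.prod = g ∧ l.length = wordLength S g := by
  have hg : g ∈ (Subgroup.closure (S : Set Γ)).toSubmonoid := by rw [hS]; trivial
  rw [Subgroup.closure_toSubmonoid] at hg
  obtain ⟨l, hl, hprod⟩ := Submonoid.exists_list_of_mem_closure hg
  exact Nat.sInf_mem (s := {n | ∃ l : List Γ, (∀ s ∈ l, s ∈ S ∨ s⁻¹ ∈ S) ∧ l.prod = g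
    ∧ l.length = n}) ⟨l.length, l, by simpa using hl, hprod, rfl⟩

theorem wordLength_one : wordLength S (1 : Γ) = 0 :=
  Nat.le_zero.1 (wordLength_le_of_list (l := []) (by simp))

theorem eq_one_of_wordLength_eq_zero (hS : Subgroup.closure (S : Set Γ) = ⊤) {g : Γ}
    (h : wordLength S g = 0) : g = 1 := by
  obtain ⟨l, -, hprod, hlen⟩ := exists_list_wordLength hS g
  rw [h, List.length_eq_zero_iff] at hlen
  rw [← hprod, hlen, List.prod_nil]

theorem wordLength_mul_le (hS : Subgroup.closure (S : Set Γ) = ⊤) (g h : Γ) :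
    wordLength S (g * h) ≤ wordLength S g + wordLength S h := by
  obtain ⟨l, hl, hprod, hlen⟩ := exists_list_wordLength hS g
  obtain ⟨l', hl', hprod', hlen'⟩ := exists_list_wordLength hS h
  rw [← hlen, ← hlen', ← List.length_append, ← hprod, ← hprod', ← List.prod_append]
  refine wordLength_le_of_list fun s hs => ?_
  rcases List.mem_append.1 hs with h | h
  exacts [hl s h, hl' s h]

theorem wordLength_inv_le (hS : Subgroup.closure (S : Set Γ) = ⊤) (g : Γ) :
    wordLength S g⁻¹ ≤ wordLength S g := by
  obtain ⟨l, hl, hprod, hlen⟩ := exists_list_wordLength hS g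
  rw [← hlen, ← hprod, List.prod_inv_reverse]
  refine (wordLength_le_of_list fun s hs => ?_).trans (by simp)
  rw [List.mem_reverse, List.mem_map] at hs
  obtain ⟨x, hx, rfl⟩ := hs
  rw [inv_inv]
  exact (hl x hx).symm

theorem wordLength_inv (hS : Subgroup.closure (S : Set Γ) = ⊤) (g : Γ) :
    wordLength S g⁻¹ = wordLength S g :=
  (wordLength_inv_le hS g).antisymm (by simpa using wordLength_inv_le hS g⁻¹)

theorem finite_ball (hS : Subgroup.closure (S : Set Γ) = ⊤) (n : ℕ) :
    {g : Γ | wordLength S g ≤ n}.Finite := by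
  classical
  let A : Set Γ := {s | s ∈ S ∨ s⁻¹ ∈ S}
  have hA : A.Finite := by
    refine (S.finite_toSet.union (S.finite_toSet.image fun s => s⁻¹)).subset ?_
    rintro s (h | h)
    exacts [Or.inl h, Or.inr ⟨s⁻¹, h, inv_inv s⟩]
  have : Finite A := hA
  refine ((List.finite_length_le A n).image fun l => (l.map Subtype.val).prod).subset ?_
  intro g hg
  obtain ⟨l, hl, hprod, hlen⟩ := exists_list_wordLength hS g
  refine ⟨l.attach.map fun s => ⟨s.1, hl s.1 s.2⟩, ?_, ?_⟩
  · simpa [hlen] using hg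
  · simp [List.map_map, Function.comp_def, hprod]

/-- Each letter of `S` is a word of bounded length in `S'`. The comparison is needed because rapid
decay may refer to a different generating set. -/
theorem exists_wordLength_le_mul {S' : Finset Γ} (hS : Subgroup.closure (S : Set Γ) = ⊤)
    (hS' : Subgroup.closure (S' : Set Γ) = ⊤) :
    ∃ c : ℕ, 1 ≤ c ∧ ∀ g, wordLength S' g ≤ c * wordLength S g := by
  refine ⟨S.sup (wordLength S') + 1, by omega, fun g => ?_⟩
  set c := S.sup (wordLength S') + 1 with hc
  have hs (s : Γ) (h : s ∈ S ∨ s⁻¹ ∈ S) : wordLength S' s ≤ c := by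
    rcases h with h | h
    · exact (Finset.le_sup (f := wordLength S') h).trans (Nat.le_succ _)
    · rw [← wordLength_inv hS']
      exact (Finset.le_sup (f := wordLength S') h).trans (Nat.le_succ _)
  obtain ⟨l, hl, hprod, hlen⟩ := exists_list_wordLength hS g
  rw [← hlen, ← hprod]
  clear hlen hprod
  induction l with
  | nil => simp [wordLength_one]
  | cons s l ih =>
    rw [List.prod_cons, List.length_cons, mul_add, mul_one, add_comm]
    refine (wordLength_mul_le hS' _ _).trans (add_le_add ?_ ?_)
    · exact hs s (hl s (by simp))
    · exact ih fun x hx => hl x (by simp [hx])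

end WordLength

/-! ### Rapid decay and a weighted norm inequality -/

section RapidDecay

variable {Γ : Type*} [Group Γ] {S : Finset Γ}

/-- The regular representation of `ℂ[Γ]` as an algebra homomorphism. -/
def regHom : MonoidAlgebra ℂ Γ →ₐ[ℂ] (L2 Γ ℂ →L[ℂ] L2 Γ ℂ) :=
  MonoidAlgebra.lift ℂ _ Γ (translateHom Γ ℂ)

theorem regHom_apply (q : MonoidAlgebra ℂ Γ) : regHom q = regRep q := by
  rw [regHom, MonoidAlgebra.lift_apply]
  rfl

theorem norm_translate_le {E : Type*} [NormedAddCommGroup E] [InnerProductSpace ℂ E] (g : Γ) :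
    ‖(translate g : L2 Γ E →L[ℂ] L2 Γ E)‖ ≤ 1 :=
  LinearMap.mkContinuous_norm_le _ zero_le_one _

theorem norm_regRep_le (q : MonoidAlgebra ℂ Γ) : ‖regRep q‖ ≤ ∑ g ∈ q.coeff.support, ‖q.coeff g‖ := by
  refine (norm_sum_le _ _).trans (Finset.sum_le_sum fun g _ => ?_)
  rw [norm_smul]
  exact mul_le_of_le_one_right (norm_nonneg _) (norm_translate_le g)

theorem HasRD.exists_ball_bound {C₁ : ℝ} (h : HasRD Γ C₁)
    (hS : Subgroup.closure (S : Set Γ) = ⊤) :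
    ∃ C : ℝ, 0 < C ∧ ∀ n : ℕ, 1 ≤ n → ∀ q : MonoidAlgebra ℂ Γ,
      (∀ g ∈ q.coeff.support, wordLength S g ≤ n) →
      ‖regRep q‖ ≤ C * (n : ℝ) ^ C₁ * √(∑ g ∈ q.coeff.support, ‖q.coeff g‖ ^ 2) := by
  obtain ⟨hC₁, S', hS', C, hC, hq⟩ := h
  obtain ⟨c, hc1, hc⟩ := exists_wordLength_le_mul hS hS'
  refine ⟨C * (2 * c : ℝ) ^ C₁, by positivity, fun n hn q hsupp => (hq q).trans ?_⟩
  have hdiam : suppDiam S' q ≤ 2 * c * n := by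
    refine max_le (Nat.mul_pos (Nat.mul_pos two_pos hc1) hn) (Finset.sup_le ?_)
    rintro ⟨g, h⟩ hgh
    rw [Finset.mem_product] at hgh
    calc wordLength S' (g * h⁻¹) ≤ wordLength S' g + wordLength S' h⁻¹ := wordLength_mul_le hS' _ _
      _ ≤ c * n + c * n := by
        rw [wordLength_inv hS']
        exact add_le_add ((hc g).trans (Nat.mul_le_mul_left _ (hsupp g hgh.1)))
          ((hc h).trans (Nat.mul_le_mul_left _ (hsupp h hgh.2)))
      _ = 2 * c * n := by ring
  have : (suppDiam S' q : ℝ) ^ C₁ ≤ (2 * c : ℝ) ^ C₁ * (n : ℝ) ^ C₁ := by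
    rw [← Real.mul_rpow (by positivity) (by positivity)]
    refine Real.rpow_le_rpow (by positivity) ?_ hC₁.le
    exact_mod_cast hdiam
  rw [mul_assoc C ((2 * c : ℝ) ^ C₁)]
  gcongr

/-- Split `q` into spheres. Rapid decay bounds the part on the sphere of radius `n` by `C n^{C₁}
‖q_n‖₂ = C n^{-β/2} (n^{C₁'} ‖q_n‖₂²)^{1/2}` with `β = C₁' - 2C₁`; then apply Cauchy–Schwarz in `n`.
The hypothesis on the exponents says that `β > 1`, so that `∑ n^{-β}` converges. -/
theorem HasRD.exists_weighted_bound {C₁ C₁' : ℝ} (h : HasRD Γ C₁)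
    (hS : Subgroup.closure (S : Set Γ) = ⊤) (hC : 2 * C₁ + 1 < C₁') :
    ∃ C : ℝ, 0 < C ∧ ∀ q : MonoidAlgebra ℂ Γ,
      ‖regRep q‖ ≤ ‖q.coeff 1‖ +
        C * √(∑ g ∈ q.coeff.support, (wordLength S g : ℝ) ^ C₁' * ‖q.coeff g‖ ^ 2) := by
  obtain ⟨C, hC0, hball⟩ := h.exists_ball_bound hS
  set β : ℝ := C₁' - 2 * C₁ with hβ
  have hsumm : Summable fun n : ℕ => (n : ℝ) ^ (-β) := Real.summable_nat_rpow.2 (by linarith)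
  set Z : ℝ := ∑' n : ℕ, (n : ℝ) ^ (-β) with hZ
  refine ⟨C * (√Z + 1), by positivity, fun q => ?_⟩
  classical
  set part : ℕ → MonoidAlgebra ℂ Γ := fun n =>
    MonoidAlgebra.ofCoeff (q.coeff.filter fun g => wordLength S g = n) with hpart
  have hpc (n : ℕ) (g : Γ) : (part n).coeff g = if wordLength S g = n then q.coeff g else 0 :=
    Finsupp.filter_apply _ _ _
  have hps (n : ℕ) : (part n).coeff.support = q.coeff.support.filter fun g => wordLength S g = n :=
    Finsupp.support_filter _ _
  set M := q.coeff.support.sup (wordLength S) with hM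
  have hMlt : ∀ g ∈ q.coeff.support, wordLength S g ∈ Finset.range (M + 1) := fun g hg =>
    Finset.mem_range.2 (Nat.lt_succ_of_le (Finset.le_sup (f := wordLength S) hg))
  have hq : q = ∑ n ∈ Finset.range (M + 1), part n := by
    ext g
    rw [MonoidAlgebra.coeff_sum, Finsupp.finsetSum_apply]
    simp only [hpc]
    rw [Finset.sum_ite_eq]
    split_ifs with h
    · rfl
    · by_contra hne
      exact h (hMlt g (Finsupp.mem_support_iff.2 hne))
  set s : ℕ → ℝ := fun n => ∑ g ∈ (part n).coeff.support, ‖(part n).coeff g‖ ^ 2 with hs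
  have hnorm : ‖regRep q‖ ≤ ∑ n ∈ Finset.range (M + 1), ‖regRep (part n)‖ := by
    conv_lhs => rw [hq, ← regHom_apply, map_sum]
    refine (norm_sum_le _ _).trans (le_of_eq ?_)
    simp only [regHom_apply]
  -- The weight `n^{C₁'}` vanishes at `n = 0`, so the identity has to be estimated separately.
  have h0 : ‖regRep (part 0)‖ ≤ ‖q.coeff 1‖ := by
    refine (norm_regRep_le _).trans ?_
    have hsub : (part 0).coeff.support ⊆ {1} := by
      intro g hg
      rw [hps, Finset.mem_filter] at hg
      exact Finset.mem_singleton.2 (eq_one_of_wordLength_eq_zero hS hg.2)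
    refine (Finset.sum_le_sum_of_subset_of_nonneg hsub fun _ _ _ => norm_nonneg _).trans ?_
    rw [Finset.sum_singleton, hpc, wordLength_one, if_pos rfl]
  have hn (n : ℕ) : ‖regRep (part (n + 1))‖ ≤
      C * (√(((n + 1 : ℕ) : ℝ) ^ (-β)) * √(((n + 1 : ℕ) : ℝ) ^ C₁' * s (n + 1))) := by
    refine (hball (n + 1) (by omega) (part (n + 1)) fun g hg => ?_).trans (le_of_eq ?_)
    · rw [hps, Finset.mem_filter] at hg
      exact hg.2.le
    · have hpos : (0 : ℝ) < ((n + 1 : ℕ) : ℝ) := by positivity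
      rw [← Real.sqrt_mul (by positivity), ← mul_assoc, ← Real.rpow_add hpos,
        Real.sqrt_mul (by positivity), mul_assoc]
      have : -β + C₁' = C₁ + C₁ := by rw [hβ]; ring
      rw [this, Real.rpow_add hpos, Real.sqrt_mul_self (by positivity)]
  have hsw (n : ℕ) : ((n : ℕ) : ℝ) ^ C₁' * s n
      = ∑ g ∈ q.coeff.support with wordLength S g = n,
        (wordLength S g : ℝ) ^ C₁' * ‖q.coeff g‖ ^ 2 := by
    rw [hs]
    simp only
    rw [hps, Finset.mul_sum]
    refine Finset.sum_congr rfl fun g hg => ?_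
    rw [Finset.mem_filter] at hg
    rw [hpc, if_pos hg.2, hg.2]
  rw [Finset.sum_range_succ'] at hnorm
  refine hnorm.trans ?_
  rw [add_comm]
  refine add_le_add h0 ?_
  refine (Finset.sum_le_sum fun n _ => hn n).trans ?_
  rw [← Finset.mul_sum, mul_assoc]
  refine mul_le_mul_of_nonneg_left ?_ hC0.le
  refine (Real.sum_sqrt_mul_sqrt_le _ (fun n => by positivity) fun n => by positivity).trans ?_
  refine mul_le_mul ?_ (Real.sqrt_le_sqrt ?_) (Real.sqrt_nonneg _) (by positivity)
  · refine (Real.sqrt_le_sqrt ?_).trans (le_add_of_nonneg_right zero_le_one)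
    have := hsumm.sum_le_tsum (Finset.range (M + 1)) fun n _ => by positivity
    rw [Finset.sum_range_succ'] at this
    have h0' : (0 : ℝ) ≤ ((0 : ℕ) : ℝ) ^ (-β) := by positivity
    linarith
  · rw [← Finset.sum_fiberwise_of_maps_to hMlt, Finset.sum_range_succ']
    simp only [hsw]
    exact le_add_of_nonneg_right (Finset.sum_nonneg fun g _ => by positivity)

end RapidDecay

/-! ### Case (i): decaying correlations -/

section Uncorrelated

variable {Γ : Type*} [Group Γ] {r : ℕ} {d : ℕ → ℕ} {ρ : ∀ k, Γ →* Equiv.Perm (Fin (d k))}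
  {p : MatAlg r Γ} {a b : ℝ}

/-- The `ℓ¹` bound is Cauchy–Schwarz between two columns of squared `ℓ²` norm at most `C₀ / η`; `g ↦
tg⁻¹t⁻¹` is injective and only relabels the second. -/
theorem resolvCoef_bounds (hp : IsSelfAdj p) {C₀ : ℝ} (hC₀ : 0 ≤ C₀) {E₁ E₂ η : ℝ} (hη : 0 < η)
    (h₁ : (opBlock (imResolv p (E₁ + η * Complex.I)) 1 1).trace.re ≤ C₀)
    (h₂ : (opBlock (imResolv p (E₂ + η * Complex.I)) 1 1).trace.re ≤ C₀)
    (t : Γ) (l i : Fin r) :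
    (∀ g, ‖resolvCoef p E₁ E₂ η t l i g‖ ≤ C₀ ^ 2) ∧
    ∀ F : Finset Γ, η * ∑ g ∈ F, ‖resolvCoef p E₁ E₂ η t l i g‖ ≤ C₀ := by
  classical
  obtain ⟨b₁, s₁⟩ := opBlock_imResolv_bounds hp (E := E₁) hη i
  obtain ⟨b₂, s₂⟩ := opBlock_imResolv_bounds hp (E := E₂) hη l
  refine ⟨fun g => ?_, fun F => ?_⟩
  · rw [resolvCoef, norm_mul, sq]
    exact mul_le_mul ((b₁ _).trans h₁) ((b₂ _).trans h₂) (norm_nonneg _) hC₀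
  · simp only [resolvCoef, norm_mul]
    have hs₁ := (s₁ F).trans (div_le_div_of_nonneg_right h₁ hη.le)
    have hs₂ := (s₂ (F.image fun g => t * g⁻¹ * t⁻¹)).trans (div_le_div_of_nonneg_right h₂ hη.le)
    rw [← sum_conj_image F t
      fun h => ‖opBlock (imResolv p (E₂ + η * Complex.I)) h 1 l l‖ ^ 2] at hs₂
    have := (Real.sum_mul_le_sqrt_mul_sqrt F _ _).trans
      (mul_le_mul (Real.sqrt_le_sqrt hs₁) (Real.sqrt_le_sqrt hs₂) (Real.sqrt_nonneg _)
        (Real.sqrt_nonneg _))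
    rw [Real.mul_self_sqrt (by positivity), le_div_iff₀ hη] at this
    linarith

/-- On the finite set `G` the terms are bounded and the prefactor `η` kills them; off `G` the
correlations are small and the coefficients have `ℓ¹` norm at most `C₀ / η`. -/
theorem eventually_corr_le_of_decay (hp : IsSelfAdj p) {a₀ b₀ : ℝ} (ha₀ : a₀ < a) (hb₀ : b < b₀)
    (hAC : ACOn p a₀ b₀) {u : ∀ k, Fin (d k) → ℂ} (hu : ∀ k y, ‖u k y‖ ≤ 2)
    (hdec : ∀ ε > 0, ∃ G : Finset Γ, ∀ g ∉ G, ∀ᶠ k in atTop, ‖corr (ρ k) (u k) g‖ ≤ ε)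
    (t : Γ) (l i : Fin r) {ε : ℝ} (hε : 0 < ε) :
    ∀ᶠ η in 𝓝[>] (0 : ℝ), ∀ E₁ ∈ Set.Icc a b, ∀ E₂ ∈ Set.Icc a b, ∀ F : Finset Γ,
      ∀ᶠ k in atTop, η * ‖∑ g ∈ F, resolvCoef p E₁ E₂ η t l i g * corr (ρ k) (u k) g‖ ≤ ε := by
  classical
  obtain ⟨C₀, hC₀, hAC⟩ := hAC
  obtain ⟨G, hG⟩ := hdec (ε / (2 * C₀)) (by positivity)
  have hsmall : ∀ᶠ η in 𝓝[>] (0 : ℝ), η * (G.card * (C₀ ^ 2 * 4)) < ε / 2 := by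
    have : Tendsto (fun η : ℝ => η * (G.card * (C₀ ^ 2 * 4))) (𝓝[>] 0) (𝓝 0) := by
      have h : Continuous fun η : ℝ => η * (G.card * (C₀ ^ 2 * 4)) := by fun_prop
      simpa using (h.tendsto 0).mono_left nhdsWithin_le_nhds
    exact this.eventually (gt_mem_nhds (by positivity))
  filter_upwards [hsmall, Ioc_mem_nhdsGT (zero_lt_one (α := ℝ))] with η hη ⟨hη0, hη1⟩ E₁ hE₁ E₂ hE₂ F
  obtain ⟨hb, hs⟩ := resolvCoef_bounds hp (by linarith) hη0
    (hAC E₁ ⟨by linarith [hE₁.1], by linarith [hE₁.2]⟩ η ⟨hη0, hη1⟩).2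
    (hAC E₂ ⟨by linarith [hE₂.1], by linarith [hE₂.2]⟩ η ⟨hη0, hη1⟩).2 t l i
  have hev := (Finset.eventually_all (F \ G)).2 fun g hg => hG g (Finset.mem_sdiff.1 hg).2
  filter_upwards [hev] with k hk
  rw [← Finset.sum_inter_add_sum_sdiff F G]
  have h1 : ‖∑ g ∈ F ∩ G, resolvCoef p E₁ E₂ η t l i g * corr (ρ k) (u k) g‖
      ≤ G.card * (C₀ ^ 2 * 4) := by
    refine (norm_sum_le_of_le (f := fun g => resolvCoef p E₁ E₂ η t l i g * corr (ρ k) (u k) g)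
      (n := fun _ => C₀ ^ 2 * 4) _ fun g _ => ?_).trans ?_
    · rw [norm_mul]
      have := norm_corr_le (ρ k) zero_le_two (hu k) g
      exact mul_le_mul (hb g) (this.trans (by norm_num)) (norm_nonneg _) (by positivity)
    · rw [Finset.sum_const, nsmul_eq_mul]
      have : (F ∩ G).card ≤ G.card := Finset.card_le_card Finset.inter_subset_right
      gcongr
  have h2 : ‖∑ g ∈ F \ G, resolvCoef p E₁ E₂ η t l i g * corr (ρ k) (u k) g‖
      ≤ (∑ g ∈ F \ G, ‖resolvCoef p E₁ E₂ η t l i g‖) * (ε / (2 * C₀)) := by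
    rw [Finset.sum_mul]
    refine (norm_sum_le _ _).trans (Finset.sum_le_sum fun g hg => ?_)
    rw [norm_mul]
    exact mul_le_mul_of_nonneg_left (hk g hg) (norm_nonneg _)
  calc η * ‖_ + _‖ ≤ η * (G.card * (C₀ ^ 2 * 4)
        + (∑ g ∈ F \ G, ‖resolvCoef p E₁ E₂ η t l i g‖) * (ε / (2 * C₀))) :=
        mul_le_mul_of_nonneg_left ((norm_add_le _ _).trans (add_le_add h1 h2)) hη0.le
    _ = η * (G.card * (C₀ ^ 2 * 4))
        + (η * ∑ g ∈ F \ G, ‖resolvCoef p E₁ E₂ η t l i g‖) * (ε / (2 * C₀)) := by ring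
    _ ≤ ε / 2 + C₀ * (ε / (2 * C₀)) := by
        have := hs (F \ G)
        gcongr
    _ = ε := by field_simp; norm_num

theorem norm_apply_le_toEuclideanCLM {n : Type*} [Fintype n] [DecidableEq n] (A : Matrix n n ℂ)
    (i j : n) : ‖A i j‖ ≤ ‖Matrix.toEuclideanCLM (n := n) (𝕜 := ℂ) A‖ := by
  have h := (Matrix.toEuclideanCLM (n := n) (𝕜 := ℂ) A).le_opNorm (EuclideanSpace.single j 1)
  rw [PiLp.norm_single, norm_one, mul_one] at h
  refine le_trans ?_ ((PiLp.norm_apply_le _ i).trans h)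
  simp [Matrix.ofLp_toEuclideanCLM]

/-- The correlation is the entry of the empirical covariance in row `(l, l)` and column `(i, i)`. -/
theorem norm_corr_centredEntry_le {N : ℕ} (ρ : Γ →* Equiv.Perm (Fin N)) (K : BMat r N) (t : Γ)
    (l i : Fin r) (g : Γ) :
    ‖corr ρ (centredEntry ρ K t l i) g‖
      ≤ ‖Matrix.toEuclideanCLM (n := Fin r × Fin r) (𝕜 := ℂ) (empCov ρ (diagAt ρ K t) g)‖ := by
  refine le_of_eq_of_le ?_ (norm_apply_le_toEuclideanCLM _ (l, l) (i, i))
  rw [empCov, Matrix.smul_apply, Matrix.sum_apply, corr, smul_eq_mul]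
  rfl

/-- Balls are finite, so `G` can be taken to be a ball outside which the asymptotic covariance is
below `ε`. -/
theorem AsympUncorr.exists_finset {S T : Finset Γ} (hS : Subgroup.closure (S : Set Γ) = ⊤)
    {K : ∀ k, BMat r (d k)} (h : AsympUncorr S ρ T K) {t : Γ} (ht : t ∈ T) (l i : Fin r)
    {ε : ℝ} (hε : 0 < ε) :
    ∃ G : Finset Γ, ∀ g ∉ G, ∀ᶠ k in atTop,
      ‖corr (ρ k) (centredEntry (ρ k) (K k) t l i) g‖ ≤ ε := by
  have h1 := (h t ht).eventually (gt_mem_nhds (ENNReal.ofReal_pos.2 hε))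
  obtain ⟨s, hs, hsub⟩ := mem_comap.1 h1
  obtain ⟨n, hn⟩ := mem_atTop_sets.1 hs
  refine ⟨(finite_ball hS n).toFinset, fun g hg => ?_⟩
  rw [Set.Finite.mem_toFinset, Set.mem_ofPred_eq, not_le] at hg
  have h2 : asympCov ρ (fun k => diagAt (ρ k) (K k) t) g < ENNReal.ofReal ε := hsub (hn _ hg.le)
  filter_upwards [eventually_lt_of_limsup_lt h2] with k hk
  exact (norm_corr_centredEntry_le _ _ _ _ _ _).trans ((ENNReal.ofReal_lt_ofReal_iff hε).1 hk).le

end Uncorrelated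

/-! ### Cases (ii) and (iii): norm bounds off a small subspace -/

section PermBound

variable {Γ : Type*} [Group Γ] {r : ℕ} {d : ℕ → ℕ}

/-- `ρ` on `ℂ[Γ]` as an algebra homomorphism. -/
def permHom {N : ℕ} (ρ : Γ →* Equiv.Perm (Fin N)) :
    MonoidAlgebra ℂ Γ →ₐ[ℂ] Matrix (Fin N) (Fin N) ℂ :=
  MonoidAlgebra.lift ℂ _ Γ (permMatHom.comp ρ)

theorem permHom_apply {N : ℕ} (ρ : Γ →* Equiv.Perm (Fin N)) (q : MonoidAlgebra ℂ Γ) :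
    permHom ρ q = permRep ρ q := by
  rw [permHom, MonoidAlgebra.lift_apply]
  rfl

theorem permHom_single {N : ℕ} (ρ : Γ →* Equiv.Perm (Fin N)) (g : Γ) (c : ℂ) :
    permHom ρ (MonoidAlgebra.single g c) = c • permMat (ρ g) := by
  rw [permHom, MonoidAlgebra.lift_single]
  rfl

theorem regHom_single (g : Γ) (c : ℂ) :
    regHom (MonoidAlgebra.single g c) = c • (translate g : L2 Γ ℂ →L[ℂ] L2 Γ ℂ) := by
  rw [regHom, MonoidAlgebra.lift_single]
  rfl

/-- On the orthogonal complements of the subspaces `H k`, the operator norms of `ρ_k(q)` are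
asymptotically bounded by the norm of `λ(q)`. -/
def PermBound (ρ : ∀ k, Γ →* Equiv.Perm (Fin (d k)))
    (H : ∀ k, Submodule ℂ (EuclideanSpace ℂ (Fin (d k)))) : Prop :=
  ∀ (q : MonoidAlgebra ℂ Γ) (c : ℝ), ‖regRep q‖ < c → ∀ᶠ k in atTop, ∀ v ∈ (H k)ᗮ,
    ‖Matrix.toEuclideanCLM (n := Fin (d k)) (𝕜 := ℂ) (permRep (ρ k) q) v‖ ≤ c * ‖v‖

theorem ConvStrong.permBound {ρ : ∀ k, Γ →* Equiv.Perm (Fin (d k))} (h : ConvStrong ρ) :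
    PermBound ρ fun k => Submodule.span ℂ {onesVec (d k)} := by
  intro q c hc
  filter_upwards [(h.2 q).eventually (gt_mem_nhds hc)] with k hk v hv
  have h1 := ((Matrix.toEuclideanCLM (n := Fin (d k)) (𝕜 := ℂ) (permRep (ρ k) q)).comp
        (Submodule.span ℂ {onesVec (d k)})ᗮ.subtypeL).le_opNorm ⟨v, hv⟩
  exact h1.trans (mul_le_mul_of_nonneg_right hk.le (norm_nonneg _))

theorem toEuclideanCLM_permMat_apply {N : ℕ} (σ : Equiv.Perm (Fin N))
    (v : EuclideanSpace ℂ (Fin N)) (y : Fin N) :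
    Matrix.toEuclideanCLM (n := Fin N) (𝕜 := ℂ) (permMat σ) v y = v (σ⁻¹ y) := by
  rw [Matrix.ofLp_toEuclideanCLM, Matrix.mulVec, dotProduct, Finset.sum_eq_single (σ⁻¹ y)]
  · rw [permMat_apply]
    simp
  · intro z _ hz
    rw [permMat_apply, if_neg, zero_mul]
    intro h
    exact hz (by rw [h]; simp)
  · simp

theorem norm_toEuclideanCLM_permMat {N : ℕ} (σ : Equiv.Perm (Fin N))
    (v : EuclideanSpace ℂ (Fin N)) :
    ‖Matrix.toEuclideanCLM (n := Fin N) (𝕜 := ℂ) (permMat σ) v‖ = ‖v‖ := by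
  rw [EuclideanSpace.norm_eq, EuclideanSpace.norm_eq]
  simp only [toEuclideanCLM_permMat_apply]
  rw [Equiv.sum_comp (σ⁻¹) fun y => ‖v y‖ ^ 2]

theorem norm_permRep_apply_le {N : ℕ} (ρ : Γ →* Equiv.Perm (Fin N)) (q : MonoidAlgebra ℂ Γ)
    (v : EuclideanSpace ℂ (Fin N)) :
    ‖Matrix.toEuclideanCLM (n := Fin N) (𝕜 := ℂ) (permRep ρ q) v‖
      ≤ (∑ g ∈ q.coeff.support, ‖q.coeff g‖) * ‖v‖ := by
  rw [permRep, map_sum, sum_apply, Finset.sum_mul]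
  refine (norm_sum_le _ _).trans (Finset.sum_le_sum fun g _ => ?_)
  rw [map_smul, smul_apply, norm_smul, norm_toEuclideanCLM_permMat]

theorem corr_eq_inner {N : ℕ} (ρ : Γ →* Equiv.Perm (Fin N)) (u : Fin N → ℂ) (g : Γ) :
    corr ρ u g = (1 / (N : ℂ)) * inner ℂ (WithLp.toLp 2 u : EuclideanSpace ℂ (Fin N))
      (Matrix.toEuclideanCLM (n := Fin N) (𝕜 := ℂ) (permMat (ρ g⁻¹)) (WithLp.toLp 2 u)) := by
  rw [corr, PiLp.inner_apply]
  congr 1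
  refine Finset.sum_congr rfl fun y _ => ?_
  rw [toEuclideanCLM_permMat_apply, map_inv, inv_inv, RCLike.inner_apply, mul_comm]

theorem FourthMoment.eventually_sum_le {S : Finset Γ} {p : MatAlg r Γ} {a b C₁' : ℝ}
    (h : FourthMoment S p a b C₁') {δ : ℝ} (hδ : 0 < δ) :
    ∀ᶠ η : ℝ in 𝓝[>] 0, ∀ E ∈ Set.Icc a b, ∀ G : Finset Γ,
      ∑ g ∈ G, η ^ 2 * frob (opBlock (imResolv p (E + η * Complex.I)) 1 g) ^ 4
        * (wordLength S g : ℝ) ^ C₁' ≤ δ := by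
  filter_upwards [h.eventually (gt_mem_nhds (ENNReal.ofReal_pos.2 hδ))] with η hη E hE G
  have h1 := (le_iSup₂ (f := fun (E : ℝ) (_ : E ∈ Set.Icc a b) => ∑' g : Γ, ENNReal.ofReal
      (η ^ 2 * frob (opBlock (imResolv p (E + η * Complex.I)) 1 g) ^ 4
        * (wordLength S g : ℝ) ^ C₁')) E hE).trans_lt hη
  have h2 := (ENNReal.sum_le_tsum G).trans_lt h1
  rw [← ENNReal.ofReal_sum_of_nonneg fun g _ => by
    exact mul_nonneg (mul_nonneg (sq_nonneg _) (pow_nonneg (Real.sqrt_nonneg _) _)) (by positivity)]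
    at h2
  exact ((ENNReal.ofReal_lt_ofReal_iff hδ).1 h2).le

/-- If the conjugate is nontrivial its length is at least 1 and absorbs the additive `2|t|`. The
multiplicative form can be raised to the power `C₁'`. -/
theorem wordLength_le_conj {S : Finset Γ} (hS : Subgroup.closure (S : Set Γ) = ⊤) (t g : Γ) :
    wordLength S g ≤ (1 + 2 * wordLength S t) * wordLength S (t * g⁻¹ * t⁻¹) := by
  rcases eq_or_ne (wordLength S (t * g⁻¹ * t⁻¹)) 0 with h | h
  · have h1 := eq_one_of_wordLength_eq_zero hS h
    have : g = 1 := by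
      have : g = (t⁻¹ * (t * g⁻¹ * t⁻¹) * t)⁻¹ := by group
      rw [this, h1]
      group
    rw [this, wordLength_one]
    exact Nat.zero_le _
  · have h1 : wordLength S g ≤ wordLength S t + wordLength S (t * g⁻¹ * t⁻¹) + wordLength S t := by
      have e : g⁻¹ = t⁻¹ * (t * g⁻¹ * t⁻¹) * t := by group
      calc wordLength S g = wordLength S g⁻¹ := (wordLength_inv hS g).symm
        _ = wordLength S (t⁻¹ * (t * g⁻¹ * t⁻¹) * t) := congrArg _ e
        _ ≤ wordLength S (t⁻¹ * (t * g⁻¹ * t⁻¹)) + wordLength S t := wordLength_mul_le hS _ _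
        _ ≤ wordLength S t⁻¹ + wordLength S (t * g⁻¹ * t⁻¹) + wordLength S t := by
          gcongr
          exact wordLength_mul_le hS _ _
        _ = _ := by rw [wordLength_inv hS t]
    have h2 : 1 ≤ wordLength S (t * g⁻¹ * t⁻¹) := Nat.one_le_iff_ne_zero.2 h
    nlinarith

variable {ρ : ∀ k, Γ →* Equiv.Perm (Fin (d k))} {p : MatAlg r Γ} {a b : ℝ}

/-- The element `∑_{g ∈ F} η c_g g⁻¹` of `ℂ[Γ]` built from the resolvent coefficients. -/
def resolvElt (p : MatAlg r Γ) (E₁ E₂ η : ℝ) (t : Γ) (l i : Fin r) (F : Finset Γ) :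
    MonoidAlgebra ℂ Γ :=
  ∑ g ∈ F, MonoidAlgebra.single g⁻¹ ((η : ℂ) * resolvCoef p E₁ E₂ η t l i g)

theorem coeff_resolvElt [DecidableEq Γ] (E₁ E₂ η : ℝ) (t : Γ) (l i : Fin r) (F : Finset Γ) (h : Γ) :
    (resolvElt p E₁ E₂ η t l i F).coeff h
      = if h⁻¹ ∈ F then (η : ℂ) * resolvCoef p E₁ E₂ η t l i h⁻¹ else 0 := by
  rw [resolvElt, MonoidAlgebra.coeff_sum, Finsupp.finsetSum_apply]
  have : ∀ g ∈ F, (MonoidAlgebra.single g⁻¹ ((η : ℂ) * resolvCoef p E₁ E₂ η t l i g)).coeff h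
      = if h⁻¹ = g then (η : ℂ) * resolvCoef p E₁ E₂ η t l i g else 0 := fun g _ => by
    have e : g⁻¹ = h ↔ h⁻¹ = g := ⟨fun e => by rw [← e, inv_inv], fun e => by rw [← e, inv_inv]⟩
    rw [MonoidAlgebra.coeff_single, Finsupp.single_apply]
    simp only [e]
  rw [Finset.sum_congr rfl this, Finset.sum_ite_eq]

/-- The sum is `(1/N)⟨u, ρ(w) u⟩` with `w` the element `resolvElt`; its inverses come from
`corr_eq_inner`. The factor 4 is `‖u‖² / N` for `|u| ≤ 2`. -/
theorem norm_sum_resolvCoef_corr_le {N : ℕ} (ρ : Γ →* Equiv.Perm (Fin N)) (p : MatAlg r Γ)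
    (E₁ E₂ : ℝ) {η : ℝ} (hη : 0 < η) (t : Γ) (l i : Fin r) (F : Finset Γ) {u : Fin N → ℂ}
    (hu : ∀ y, ‖u y‖ ≤ 2) {c : ℝ}
    (hc : ‖Matrix.toEuclideanCLM (n := Fin N) (𝕜 := ℂ)
      (permRep ρ (resolvElt p E₁ E₂ η t l i F)) (WithLp.toLp 2 u)‖
        ≤ c * ‖(WithLp.toLp 2 u : EuclideanSpace ℂ (Fin N))‖) (hc0 : 0 ≤ c) :
    η * ‖∑ g ∈ F, resolvCoef p E₁ E₂ η t l i g * corr ρ u g‖ ≤ 4 * c := by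
  set v : EuclideanSpace ℂ (Fin N) := WithLp.toLp 2 u with hv
  have h1 : (η : ℂ) * ∑ g ∈ F, resolvCoef p E₁ E₂ η t l i g * corr ρ u g
      = (1 / (N : ℂ)) * inner ℂ v (Matrix.toEuclideanCLM (n := Fin N) (𝕜 := ℂ)
        (permRep ρ (resolvElt p E₁ E₂ η t l i F)) v) := by
    rw [← permHom_apply, resolvElt, map_sum, map_sum, sum_apply, inner_sum, Finset.mul_sum,
      Finset.mul_sum]
    refine Finset.sum_congr rfl fun g _ => ?_
    rw [permHom_single, map_smul, smul_apply, inner_smul_right, corr_eq_inner]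
    ring
  have hvn : ‖v‖ ^ 2 ≤ N * 4 := by
    rw [EuclideanSpace.norm_sq_eq]
    refine (Finset.sum_le_card_nsmul _ _ 4 fun y _ => ?_).trans (by simp)
    have : ‖v y‖ ≤ 2 := hu y
    nlinarith [norm_nonneg (v y)]
  have h2 : η * ‖∑ g ∈ F, resolvCoef p E₁ E₂ η t l i g * corr ρ u g‖
      = ‖(η : ℂ) * ∑ g ∈ F, resolvCoef p E₁ E₂ η t l i g * corr ρ u g‖ := by
    rw [norm_mul, Complex.norm_real, Real.norm_of_nonneg hη.le]
  rw [h2, h1, norm_mul, norm_div, norm_one, Complex.norm_natCast, one_div_mul_eq_div]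
  refine div_le_of_le_mul₀ (Nat.cast_nonneg _) (by positivity) ?_
  calc ‖inner ℂ v _‖ ≤ ‖v‖ * (c * ‖v‖) := (norm_inner_le_norm _ _).trans (by gcongr)
    _ = c * ‖v‖ ^ 2 := by ring
    _ ≤ c * (N * 4) := by gcongr
    _ = 4 * c * N := by ring

/-- By `(AB)² ≤ A⁴ + B⁴` the two energies separate into fourth moments. The second is indexed by
`tg⁻¹t⁻¹`, and changing its weight costs the factor in `wordLength_le_conj`. -/
theorem sum_weighted_resolvCoef_le {S : Finset Γ} (hS : Subgroup.closure (S : Set Γ) = ⊤)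
    (hp : IsSelfAdj p) {C₁' δ : ℝ} (hC₁' : 0 ≤ C₁') {E₁ E₂ η : ℝ} (hη : 0 < η)
    (h₁ : ∀ G : Finset Γ, ∑ g ∈ G, η ^ 2 *
      frob (opBlock (imResolv p (E₁ + η * Complex.I)) 1 g) ^ 4 * (wordLength S g : ℝ) ^ C₁' ≤ δ)
    (h₂ : ∀ G : Finset Γ, ∑ g ∈ G, η ^ 2 *
      frob (opBlock (imResolv p (E₂ + η * Complex.I)) 1 g) ^ 4 * (wordLength S g : ℝ) ^ C₁' ≤ δ)
    (t : Γ) (l i : Fin r) (F : Finset Γ) :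
    ∑ g ∈ F, (wordLength S g : ℝ) ^ C₁' * (η * ‖resolvCoef p E₁ E₂ η t l i g‖) ^ 2
      ≤ (1 + (1 + 2 * wordLength S t : ℝ) ^ C₁') * δ := by
  classical
  set f₁ : Γ → ℝ := fun g => η ^ 2 *
      frob (opBlock (imResolv p (E₁ + η * Complex.I)) 1 g) ^ 4 * (wordLength S g : ℝ) ^ C₁' with hf₁
  set f₂ : Γ → ℝ := fun g => η ^ 2 *
      frob (opBlock (imResolv p (E₂ + η * Complex.I)) 1 g) ^ 4 * (wordLength S g : ℝ) ^ C₁' with hf₂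
  set D : ℝ := (1 + 2 * wordLength S t : ℝ) ^ C₁' with hD
  have hterm (g : Γ) : (wordLength S g : ℝ) ^ C₁' * (η * ‖resolvCoef p E₁ E₂ η t l i g‖) ^ 2
      ≤ f₁ g + D * f₂ (t * g⁻¹ * t⁻¹) := by
    have hA := norm_opBlock_le_frob (isSelfAdjoint_imResolv hp (E := E₁) hη) g 1 i i
    have hB := norm_opBlock_le_frob (isSelfAdjoint_imResolv hp (E := E₂) hη) (t * g⁻¹ * t⁻¹) 1 l l
    have hw : (wordLength S g : ℝ) ^ C₁' ≤ D * (wordLength S (t * g⁻¹ * t⁻¹) : ℝ) ^ C₁' := by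
      rw [hD, ← Real.mul_rpow (by positivity) (by positivity)]
      refine Real.rpow_le_rpow (by positivity) ?_ hC₁'
      exact_mod_cast wordLength_le_conj hS t g
    simp only [hf₁, hf₂]
    rw [resolvCoef, norm_mul]
    set A := ‖opBlock (imResolv p (E₁ + η * Complex.I)) g 1 i i‖
    set B := ‖opBlock (imResolv p (E₂ + η * Complex.I)) (t * g⁻¹ * t⁻¹) 1 l l‖
    set A' := frob (opBlock (imResolv p (E₁ + η * Complex.I)) 1 g)
    set B' := frob (opBlock (imResolv p (E₂ + η * Complex.I)) 1 (t * g⁻¹ * t⁻¹))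
    set x := (wordLength S g : ℝ) ^ C₁'
    set y := (wordLength S (t * g⁻¹ * t⁻¹) : ℝ) ^ C₁'
    have hx : 0 ≤ x := by positivity
    have hA0 : 0 ≤ A := norm_nonneg _
    have hB0 : 0 ≤ B := norm_nonneg _
    have hAA : A ^ 4 ≤ A' ^ 4 := by gcongr
    have hBB : B ^ 4 ≤ B' ^ 4 := by gcongr
    have hab : (A * B) ^ 2 ≤ A ^ 4 + B ^ 4 := by
      nlinarith [sq_nonneg (A ^ 2 - B ^ 2), sq_nonneg (A ^ 2), sq_nonneg (B ^ 2)]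
    calc x * (η * (A * B)) ^ 2 = x * η ^ 2 * (A * B) ^ 2 := by ring
      _ ≤ x * η ^ 2 * (A' ^ 4 + B' ^ 4) := by gcongr; linarith
      _ = η ^ 2 * A' ^ 4 * x + η ^ 2 * B' ^ 4 * x := by ring
      _ ≤ η ^ 2 * A' ^ 4 * x + η ^ 2 * B' ^ 4 * (D * y) := by gcongr
      _ = _ := by ring
  refine (Finset.sum_le_sum fun g _ => hterm g).trans ?_
  rw [Finset.sum_add_distrib, ← Finset.mul_sum, sum_conj_image F t f₂, add_mul, one_mul]
  have hD0 : 0 ≤ D := by positivity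
  exact add_le_add (h₁ F) (mul_le_mul_of_nonneg_left (h₂ _) hD0)

/-- Once `η`, the energies and `F` are fixed, `w` does not depend on `N`, so `PermBound` applies to
it. In the weighted bound for `‖λ(w)‖`, the coefficient at 1 is `O(η)` and the weighted norm is
governed by the fourth moments. -/
theorem eventually_corr_le_of_permBound {S : Finset Γ} (hS : Subgroup.closure (S : Set Γ) = ⊤)
    (hp : IsSelfAdj p) {a₀ b₀ : ℝ} (ha₀ : a₀ < a) (hb₀ : b < b₀) (hAC : ACOn p a₀ b₀)
    {C₁ C₁' : ℝ} (hRD : HasRD Γ C₁) (hC : 2 * C₁ + 1 < C₁') (hFM : FourthMoment S p a b C₁')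
    {H : ∀ k, Submodule ℂ (EuclideanSpace ℂ (Fin (d k)))} (hH : PermBound ρ H)
    {u : ∀ k, Fin (d k) → ℂ} (hu : ∀ k y, ‖u k y‖ ≤ 2)
    (huH : ∀ k, WithLp.toLp 2 (u k) ∈ (H k)ᗮ)
    (t : Γ) (l i : Fin r) {ε : ℝ} (hε : 0 < ε) :
    ∀ᶠ η in 𝓝[>] (0 : ℝ), ∀ E₁ ∈ Set.Icc a b, ∀ E₂ ∈ Set.Icc a b, ∀ F : Finset Γ,
      ∀ᶠ k in atTop, η * ‖∑ g ∈ F, resolvCoef p E₁ E₂ η t l i g * corr (ρ k) (u k) g‖ ≤ ε := by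
  classical
  obtain ⟨C₀, hC₀, hAC⟩ := hAC
  have hC₁ := hRD.1
  obtain ⟨C, hC0, hw⟩ := hRD.exists_weighted_bound hS hC
  set D : ℝ := 1 + (1 + 2 * wordLength S t : ℝ) ^ C₁' with hD
  have hD0 : 0 < D := by positivity
  -- This makes both contributions to `‖λ(w)‖` at most `ε/16`, so the norm is below `ε/4`, as the
  -- factor 4 in `norm_sum_resolvCoef_corr_le` requires.
  set δ : ℝ := (ε / (16 * C)) ^ 2 / D with hδ
  have hδ0 : 0 < δ := by positivity
  have hsmall : ∀ᶠ η in 𝓝[>] (0 : ℝ), η * C₀ ^ 2 < ε / 16 := by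
    have : Tendsto (fun η : ℝ => η * C₀ ^ 2) (𝓝[>] 0) (𝓝 0) := by
      have h : Continuous fun η : ℝ => η * C₀ ^ 2 := by fun_prop
      simpa using (h.tendsto 0).mono_left nhdsWithin_le_nhds
    exact this.eventually (gt_mem_nhds (by positivity))
  filter_upwards [hsmall, hFM.eventually_sum_le hδ0, Ioc_mem_nhdsGT (zero_lt_one (α := ℝ))]
    with η hη hfm ⟨hη0, hη1⟩ E₁ hE₁ E₂ hE₂ F
  obtain ⟨hb, -⟩ := resolvCoef_bounds hp (by linarith) hη0
    (hAC E₁ ⟨by linarith [hE₁.1], by linarith [hE₁.2]⟩ η ⟨hη0, hη1⟩).2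
    (hAC E₂ ⟨by linarith [hE₂.1], by linarith [hE₂.2]⟩ η ⟨hη0, hη1⟩).2 t l i
  set w := resolvElt p E₁ E₂ η t l i F with hwdef
  have hw1 : ‖w.coeff 1‖ ≤ ε / 16 := by
    rw [hwdef, coeff_resolvElt]
    split_ifs
    · rw [norm_mul, Complex.norm_real, Real.norm_of_nonneg hη0.le]
      exact (mul_le_mul_of_nonneg_left (hb _) hη0.le).trans hη.le
    · rw [norm_zero]; positivity
  have hw2 : ∑ g ∈ w.coeff.support, (wordLength S g : ℝ) ^ C₁' * ‖w.coeff g‖ ^ 2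
      ≤ (ε / (16 * C)) ^ 2 := by
    have hsub : w.coeff.support ⊆ F.image fun g => g⁻¹ := by
      intro h hh
      rw [Finsupp.mem_support_iff, hwdef, coeff_resolvElt] at hh
      have : h⁻¹ ∈ F := by
        by_contra hc
        exact hh (if_neg hc)
      exact Finset.mem_image.2 ⟨h⁻¹, this, inv_inv h⟩
    refine (Finset.sum_le_sum_of_subset_of_nonneg hsub fun _ _ _ => by positivity).trans ?_
    rw [Finset.sum_image fun x _ y _ h => inv_injective h]
    have := sum_weighted_resolvCoef_le hS hp (by linarith : 0 ≤ C₁') hη0 (hfm E₁ hE₁) (hfm E₂ hE₂)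
      t l i F
    refine le_trans (Finset.sum_le_sum fun g hg => ?_) (this.trans (le_of_eq ?_))
    · rw [hwdef, coeff_resolvElt, inv_inv, if_pos hg, wordLength_inv hS, norm_mul,
        Complex.norm_real, Real.norm_of_nonneg hη0.le]
    · rw [← hD, hδ]
      field_simp
  have hnorm : ‖regRep w‖ < ε / 4 := by
    refine (hw w).trans_lt ?_
    have : C * √(∑ g ∈ w.coeff.support, (wordLength S g : ℝ) ^ C₁' * ‖w.coeff g‖ ^ 2)
        ≤ C * (ε / (16 * C)) := by
      gcongr
      exact Real.sqrt_le_iff.2 ⟨by positivity, hw2⟩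
    have e : C * (ε / (16 * C)) = ε / 16 := by field_simp
    linarith
  filter_upwards [hH w (ε / 4) hnorm] with k hk
  refine (norm_sum_resolvCoef_corr_le (ρ k) p E₁ E₂ hη0 t l i F (hu k) (hk _ (huH k))
    (by positivity)).trans (le_of_eq ?_)
  ring

end PermBound

/-! ### Construction of the exceptional subspaces -/

section Exceptional

variable {Γ : Type*} [Group Γ] {d : ℕ → ℕ}

/-- The adjoint `∑ conj(q_g) g⁻¹` in `ℂ[Γ]`. -/
def algStar (q : MonoidAlgebra ℂ Γ) : MonoidAlgebra ℂ Γ :=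
  ∑ g ∈ q.coeff.support, MonoidAlgebra.single g⁻¹ (starRingEnd ℂ (q.coeff g))

theorem permRep_algStar {N : ℕ} (ρ : Γ →* Equiv.Perm (Fin N)) (q : MonoidAlgebra ℂ Γ) :
    permRep ρ (algStar q) = (permRep ρ q).conjTranspose := by
  rw [← permHom_apply, algStar, map_sum, permRep, Matrix.conjTranspose_sum]
  refine Finset.sum_congr rfl fun g _ => ?_
  rw [permHom_single, Matrix.conjTranspose_smul, permMat_conjTranspose, map_inv]
  rfl

theorem regRep_algStar (q : MonoidAlgebra ℂ Γ) :
    regRep (algStar q) = ContinuousLinearMap.adjoint (regRep q) := by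
  rw [← regHom_apply, algStar, map_sum, regRep, map_sum]
  refine Finset.sum_congr rfl fun g _ => ?_
  rw [regHom_single, ← adjoint_translate]
  exact (map_smulₛₗ ContinuousLinearMap.adjoint (q.coeff g) (translate g)).symm

theorem norm_coeff_one_le (q : MonoidAlgebra ℂ Γ) : ‖q.coeff 1‖ ≤ ‖regRep q‖ := by
  classical
  set δ : L2 Γ ℂ := lp.single (E := fun _ : Γ => ℂ) 2 1 (1 : ℂ) with hδ
  have hδn : ‖δ‖ = 1 := by
    rw [hδ, lp.norm_single (by norm_num)]
    simp
  have h1 : (regRep q δ) 1 = q.coeff 1 := by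
    rw [regRep, sum_apply, lp.coeFn_sum, Finset.sum_apply, Finset.sum_eq_single 1]
    · rw [smul_apply, lp.coeFn_smul, Pi.smul_apply, translate_apply, hδ]
      simp
    · intro g _ hg
      rw [smul_apply, lp.coeFn_smul, Pi.smul_apply, translate_apply, hδ, lp.single_apply_ne]
      · simp
      · simpa using hg
    · intro h
      rw [Finsupp.notMem_support_iff.1 h]
      simp
  rw [← h1]
  refine (lp.norm_apply_le_norm two_ne_zero (regRep q δ) 1).trans ?_
  have := (regRep q).le_opNorm δ
  rwa [hδn, mul_one] at this

theorem ConvDistrib.tendsto_trace_permRep {ρ : ∀ k, Γ →* Equiv.Perm (Fin (d k))}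
    (hρ : ConvDistrib ρ) (hd : Tendsto d atTop atTop) (q : MonoidAlgebra ℂ Γ) :
    Tendsto (fun k => (1 / (d k : ℂ)) * (permRep (ρ k) q).trace) atTop (𝓝 (q.coeff 1)) := by
  classical
  have h : Tendsto (fun k => ∑ g ∈ q.coeff.support,
      q.coeff g * ((1 / (d k : ℂ)) * (permMat (ρ k g)).trace)) atTop
      (𝓝 (∑ g ∈ q.coeff.support, q.coeff g * if g = 1 then 1 else 0)) :=
    tendsto_finsetSum _ fun g _ => (hρ.tendsto_trace_permMat hd g).const_mul _
  have hlim : (∑ g ∈ q.coeff.support, q.coeff g * if g = 1 then 1 else 0) = q.coeff 1 := by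
    simp only [mul_ite, mul_one, mul_zero, Finset.sum_ite_eq']
    split_ifs with h1
    · rfl
    · rw [Finsupp.notMem_support_iff.1 h1]
  rw [hlim] at h
  refine h.congr fun k => ?_
  rw [permRep, Matrix.trace_sum, Finset.mul_sum]
  refine Finset.sum_congr rfl fun g _ => ?_
  rw [Matrix.trace_smul, smul_eq_mul]
  ring

-- `H` is spanned by the eigenvectors of `M*M` with eigenvalue above 1. Each of these contributes at
-- least 1 to the trace of every power, and the other eigenvalues contribute nonnegatively.
open scoped ComplexOrder in
theorem exists_singular_subspace {N : ℕ} (M : Matrix (Fin N) (Fin N) ℂ) :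
    ∃ H : Submodule ℂ (EuclideanSpace ℂ (Fin N)),
      (∀ v ∈ Hᗮ, ‖Matrix.toEuclideanCLM (n := Fin N) (𝕜 := ℂ) M v‖ ≤ ‖v‖) ∧
      ∀ m : ℕ, (Module.finrank ℂ H : ℝ) ≤ ((M.conjTranspose * M) ^ m).trace.re := by
  classical
  set A := M.conjTranspose * M with hA
  have hpsd : A.PosSemidef := Matrix.posSemidef_conjTranspose_mul_self M
  have hherm : A.IsHermitian := hpsd.isHermitian
  set e := hherm.eigenvectorBasis with he
  set s := hherm.eigenvalues with hs
  have hs0 (i) : 0 ≤ s i := hpsd.eigenvalues_nonneg i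
  have heig (i) : Matrix.toEuclideanLin A (e i) = (s i : ℂ) • e i := by
    have h := hherm.mulVec_eigenvectorBasis i
    ext x
    have h2 := congrFun h x
    simpa [Matrix.toLpLin_apply] using h2
  have heigm (m : ℕ) (i) : Matrix.toEuclideanLin (A ^ m) (e i) = ((s i ^ m : ℝ) : ℂ) • e i := by
    induction m with
    | zero => simp
    | succ m ih =>
      rw [pow_succ, toEuclideanLin_mul, heig, map_smul, ih, smul_smul]
      congr 1
      push_cast
      ring
  set B := Finset.univ.filter fun i => 1 < s i with hB
  refine ⟨Submodule.span ℂ (B.image e : Set (EuclideanSpace ℂ (Fin N))), fun v hv => ?_, fun m => ?_⟩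
  · have horth (i) (hi : 1 < s i) : inner ℂ (e i) v = 0 := by
      refine (Submodule.mem_orthogonal _ _).1 hv _ (Submodule.subset_span ?_)
      rw [Finset.mem_coe]
      exact Finset.mem_image_of_mem e (Finset.mem_filter.2 ⟨Finset.mem_univ _, hi⟩)
    have h1 : ((‖Matrix.toEuclideanLin M v‖ ^ 2 : ℝ) : ℂ)
        = ((∑ i, s i * ‖inner ℂ (e i) v‖ ^ 2 : ℝ) : ℂ) := by
      have e1 : inner ℂ v (Matrix.toEuclideanLin A v)
          = ((‖Matrix.toEuclideanLin M v‖ ^ 2 : ℝ) : ℂ) := by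
        rw [hA, toEuclideanLin_mul, Matrix.toEuclideanLin_conjTranspose_eq_adjoint,
          LinearMap.adjoint_inner_right, inner_self_eq_norm_sq_to_K]
        simp
      have e2 : Matrix.toEuclideanLin A v = ∑ i, (inner ℂ (e i) v * s i) • e i := by
        conv_lhs => rw [← e.sum_repr' v]
        rw [map_sum]
        refine Finset.sum_congr rfl fun i _ => ?_
        rw [map_smul, heig, smul_smul]
      rw [← e1, e2, inner_sum]
      push_cast
      refine Finset.sum_congr rfl fun i _ => ?_
      rw [inner_smul_right, ← inner_conj_symm v (e i), mul_right_comm]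
      have := Complex.mul_conj (inner ℂ (e i) v)
      rw [Complex.normSq_eq_norm_sq] at this
      rw [this]
      push_cast
      ring
    have h2 := Complex.ofReal_injective h1
    have h3 : ‖Matrix.toEuclideanLin M v‖ ^ 2 ≤ ‖v‖ ^ 2 := by
      rw [h2, ← e.sum_sq_norm_inner_right v]
      refine Finset.sum_le_sum fun i _ => ?_
      by_cases hi : 1 < s i
      · rw [horth i hi]; simp
      · exact mul_le_of_le_one_left (by positivity) (not_lt.1 hi)
    exact (sq_le_sq₀ (norm_nonneg _) (norm_nonneg _)).1 h3
  · have h1 : (A ^ m).trace = ((∑ i, s i ^ m : ℝ) : ℂ) := by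
      rw [trace_eq_sum_inner _ e]
      push_cast
      refine Finset.sum_congr rfl fun i _ => ?_
      rw [heigm, inner_smul_right, inner_self_eq_norm_sq_to_K, e.norm_eq_one]
      simp
    rw [h1, Complex.ofReal_re]
    calc (Module.finrank ℂ _ : ℝ) ≤ ((B.image e).card : ℝ) := by
          exact_mod_cast finrank_span_finset_le_card (R := ℂ) (B.image e)
      _ ≤ (B.card : ℝ) := by exact_mod_cast Finset.card_image_le
      _ = ∑ i ∈ B, (1 : ℝ) := by simp
      _ ≤ ∑ i ∈ B, s i ^ m := Finset.sum_le_sum fun i hi =>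
          one_le_pow₀ (Finset.mem_filter.1 hi).2.le
      _ ≤ ∑ i, s i ^ m := Finset.sum_le_sum_of_subset_of_nonneg (Finset.subset_univ _)
          fun i _ _ => pow_nonneg (hs0 i) m

/-- The normalised trace of the `m`-th power converges to the coefficient of `(q*q)^m` at 1, which
is at most `‖λ(q)‖^{2m}`. Since `m` is arbitrary, the dimension is `o(N)`. -/
theorem exists_exceptional_of_norm_lt_one {ρ : ∀ k, Γ →* Equiv.Perm (Fin (d k))}
    (hρ : ConvDistrib ρ) (hd : Tendsto d atTop atTop) {q : MonoidAlgebra ℂ Γ}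
    (hq : ‖regRep q‖ < 1) :
    ∃ H : ∀ k, Submodule ℂ (EuclideanSpace ℂ (Fin (d k))),
      (∀ k, ∀ v ∈ (H k)ᗮ,
        ‖Matrix.toEuclideanCLM (n := Fin (d k)) (𝕜 := ℂ) (permRep (ρ k) q) v‖ ≤ ‖v‖) ∧
      Tendsto (fun k => (Module.finrank ℂ (H k) : ℝ) / d k) atTop (𝓝 0) := by
  choose H hH hrank using fun k => exists_singular_subspace (permRep (ρ k) q)
  refine ⟨H, hH, ?_⟩
  rw [Metric.tendsto_nhds]
  intro ε hε
  obtain ⟨m, hm⟩ := exists_pow_lt_of_lt_one hε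
    (show ‖regRep q‖ * ‖regRep q‖ < 1 from mul_lt_one_of_nonneg_of_lt_one_left (norm_nonneg _) hq hq.le)
  have hcoef : ‖((algStar q * q) ^ m).coeff 1‖ < ε := by
    refine (norm_coeff_one_le _).trans_lt (lt_of_le_of_lt ?_ hm)
    have hreg : regRep ((algStar q * q) ^ m)
        = (ContinuousLinearMap.adjoint (regRep q) * regRep q) ^ m := by
      rw [← regHom_apply, map_pow, map_mul, regHom_apply, regHom_apply, regRep_algStar]
    rw [hreg]
    have hle : ‖ContinuousLinearMap.adjoint (regRep q) * regRep q‖ ≤ ‖regRep q‖ * ‖regRep q‖ := by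
      refine (norm_mul_le _ _).trans (le_of_eq ?_)
      rw [LinearIsometryEquiv.norm_map]
    rcases Nat.eq_zero_or_pos m with h0 | h0
    · subst h0
      rw [pow_zero, pow_zero]
      exact ContinuousLinearMap.norm_id_le
    · exact (norm_pow_le' _ h0).trans (by gcongr)
  have hlim := ((hρ.tendsto_trace_permRep hd ((algStar q * q) ^ m)).norm).eventually
    (gt_mem_nhds hcoef)
  filter_upwards [hlim] with k hk
  rw [Real.dist_eq, sub_zero, abs_of_nonneg (by positivity)]
  refine lt_of_le_of_lt ?_ hk
  rw [norm_mul, norm_div, norm_one, Complex.norm_natCast, one_div_mul_eq_div]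
  gcongr
  refine (hrank k m).trans ?_
  have hperm : permRep (ρ k) ((algStar q * q) ^ m)
      = ((permRep (ρ k) q).conjTranspose * permRep (ρ k) q) ^ m := by
    rw [← permHom_apply, map_pow, map_mul, permHom_apply, permHom_apply, permRep_algStar]
  rw [hperm]
  exact Complex.re_le_norm _

/-- Allows countably many exceptional subspaces to be joined: at stage `k` the first `J k` are
included, with `J` growing slowly enough to keep the total dimension `o(N)`. -/
theorem exists_diagonal_sequence {h : ℕ → ℕ → ℝ} (hlim : ∀ j, Tendsto (h j) atTop (𝓝 0)) :
    ∃ J : ℕ → ℕ, Tendsto J atTop atTop ∧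
      Tendsto (fun k => ∑ j ∈ Finset.range (J k), |h j k|) atTop (𝓝 0) := by
  classical
  set s : ℕ → ℕ → ℝ := fun n k => ∑ j ∈ Finset.range n, |h j k| with hs
  have hs0 (n) : Tendsto (s n) atTop (𝓝 0) := by
    have := tendsto_finsetSum (Finset.range n) fun j _ => (hlim j).abs
    simpa using this
  -- The value `n = 0` always qualifies, the empty sum being 0; the cap `n ≤ k` makes the maximum
  -- exist.
  set J : ℕ → ℕ := fun k => Nat.findGreatest (fun n => s n k ≤ 1 / ((n : ℝ) + 1)) k with hJ
  have hJlim : Tendsto J atTop atTop := by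
    rw [tendsto_atTop]
    intro n
    filter_upwards [(hs0 n).eventually (gt_mem_nhds (show 0 < 1 / ((n : ℝ) + 1) by positivity)),
      eventually_ge_atTop n] with k hk hnk
    exact Nat.le_findGreatest hnk hk.le
  refine ⟨J, hJlim, ?_⟩
  have hspec (k) : s (J k) k ≤ 1 / ((J k : ℝ) + 1) :=
    Nat.findGreatest_spec (P := fun n => s n k ≤ 1 / ((n : ℝ) + 1)) (Nat.zero_le k) (by simp [hs])
  exact squeeze_zero (fun k => Finset.sum_nonneg fun _ _ => abs_nonneg _) hspec
    (tendsto_one_div_add_atTop_nhds_zero_nat.comp hJlim)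

/-- The element of `ℂ[Γ]` with given rational coefficients. -/
def ratElt (j : Γ →₀ ℚ × ℚ) : MonoidAlgebra ℂ Γ :=
  MonoidAlgebra.ofCoeff (j.mapRange (fun x => (x.1 : ℂ) + (x.2 : ℂ) * Complex.I) (by simp))

theorem exists_rat_near_complex (z : ℂ) {ε : ℝ} (hε : 0 < ε) :
    ∃ x : ℚ × ℚ, ‖z - ((x.1 : ℂ) + (x.2 : ℂ) * Complex.I)‖ < ε := by
  obtain ⟨x, hx⟩ := exists_rat_near z.re (half_pos hε)
  obtain ⟨y, hy⟩ := exists_rat_near z.im (half_pos hε)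
  refine ⟨(x, y), (Complex.norm_le_abs_re_add_abs_im _).trans_lt ?_⟩
  have h1 : (z - ((x : ℂ) + (y : ℂ) * Complex.I)).re = z.re - x := by simp
  have h2 : (z - ((x : ℂ) + (y : ℂ) * Complex.I)).im = z.im - y := by simp
  rw [h1, h2]
  linarith

/-- Approximation in the `ℓ¹` norm of the coefficients, because that norm dominates both `‖λ(·)‖`
and all `‖ρ_N(·)‖`, uniformly in `N`. -/
theorem exists_ratElt_near (q : MonoidAlgebra ℂ Γ) {ε : ℝ} (hε : 0 < ε) :
    ∃ j : Γ →₀ ℚ × ℚ,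
      ∑ g ∈ (q - ratElt j).coeff.support, ‖(q - ratElt j).coeff g‖ < ε := by
  classical
  set s := q.coeff.support with hs
  choose f hf using fun g => exists_rat_near_complex (q.coeff g)
    (show 0 < ε / (s.card + 1) by positivity)
  set j : Γ →₀ ℚ × ℚ := Finsupp.onFinset s (fun g => if g ∈ s then f g else 0) (by
    intro g hg
    by_contra hc
    exact hg (if_neg hc)) with hj
  have hval (g : Γ) : (q - ratElt j).coeff g
      = q.coeff g - (((j g).1 : ℂ) + ((j g).2 : ℂ) * Complex.I) := rfl
  have hjg (g : Γ) : j g = if g ∈ s then f g else 0 := rfl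
  refine ⟨j, ?_⟩
  have hsub : (q - ratElt j).coeff.support ⊆ s := by
    intro g hg
    by_contra hc
    rw [Finsupp.mem_support_iff, hval, hjg, if_neg hc, Finsupp.notMem_support_iff.1 hc] at hg
    simp at hg
  calc ∑ g ∈ (q - ratElt j).coeff.support, ‖(q - ratElt j).coeff g‖
      ≤ ∑ g ∈ s, ‖(q - ratElt j).coeff g‖ :=
        Finset.sum_le_sum_of_subset_of_nonneg hsub fun _ _ _ => norm_nonneg _
    _ ≤ s.card • (ε / (s.card + 1)) := by
        refine Finset.sum_le_card_nsmul _ _ _ fun g hg => ?_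
        rw [hval, hjg, if_pos hg]
        exact (hf g).le
    _ < ε := by
        rw [nsmul_eq_mul, mul_div_assoc', div_lt_iff₀ (by positivity)]
        nlinarith

theorem finrank_sup_range_le {V : Type*} [AddCommGroup V] [Module ℂ V] [FiniteDimensional ℂ V]
    (H : ℕ → Submodule ℂ V) (n : ℕ) :
    Module.finrank ℂ ((Finset.range n).sup H : Submodule ℂ V)
      ≤ ∑ j ∈ Finset.range n, Module.finrank ℂ (H j) := by
  induction n with
  | zero => rw [Finset.range_zero, Finset.sup_empty, finrank_bot, Finset.sum_empty]
  | succ n ih =>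
    rw [Finset.range_add_one, Finset.sup_insert, Finset.sum_insert Finset.notMem_range_self]
    exact (Submodule.finrank_add_le_finrank_add_finrank _ _).trans (by gcongr)

/-- `Γ` is countable, so the elements with rational complex coefficients can be enumerated. Those
with `‖λ(·)‖ < 1` have exceptional subspaces, joined along a diagonal sequence; scaling and density
then give the bound for every `q`. The vector 1 is added so that orthogonality implies mean zero. -/
theorem exists_permBound {S : Finset Γ} (hS : Subgroup.closure (S : Set Γ) = ⊤)
    {ρ : ∀ k, Γ →* Equiv.Perm (Fin (d k))} (hρ : ConvDistrib ρ) (hd : Tendsto d atTop atTop) :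
    ∃ H : ∀ k, Submodule ℂ (EuclideanSpace ℂ (Fin (d k))),
      PermBound ρ H ∧ (∀ k, onesVec (d k) ∈ H k) ∧
      Tendsto (fun k => (Module.finrank ℂ (H k) : ℝ) / d k) atTop (𝓝 0) := by
  classical
  have hcount : Countable Γ := by
    have : (Set.univ : Set Γ) = ⋃ n : ℕ, {g : Γ | wordLength S g ≤ n} := by
      ext g
      simp only [Set.mem_univ, Set.mem_iUnion, true_iff]
      exact ⟨wordLength S g, le_refl (wordLength S g)⟩
    rw [← Set.countable_univ_iff, this]
    exact Set.countable_iUnion fun n => (finite_ball hS n).countable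
  obtain ⟨e, he⟩ := exists_surjective_nat (Γ →₀ ℚ × ℚ)
  have hex (j : ℕ) : ∃ H : ∀ k, Submodule ℂ (EuclideanSpace ℂ (Fin (d k))),
      (‖regRep (ratElt (e j))‖ < 1 → ∀ k, ∀ v ∈ (H k)ᗮ,
        ‖Matrix.toEuclideanCLM (n := Fin (d k)) (𝕜 := ℂ) (permRep (ρ k) (ratElt (e j))) v‖ ≤ ‖v‖) ∧
      Tendsto (fun k => (Module.finrank ℂ (H k) : ℝ) / d k) atTop (𝓝 0) := by
    by_cases hj : ‖regRep (ratElt (e j))‖ < 1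
    · obtain ⟨H, h1, h2⟩ := exists_exceptional_of_norm_lt_one hρ hd hj
      exact ⟨H, fun _ => h1, h2⟩
    · exact ⟨fun _ => ⊥, fun h => absurd h hj, by simp⟩
  choose H hH hrank using hex
  obtain ⟨J, hJ, hJsum⟩ := exists_diagonal_sequence hrank
  refine ⟨fun k => Submodule.span ℂ {onesVec (d k)} ⊔ (Finset.range (J k)).sup fun j => H j k,
    ?_, ?_, ?_⟩
  · intro q c hc
    have hc0 : 0 < c := (norm_nonneg _).trans_lt hc
    obtain ⟨c₀, hc₀, hc₀c⟩ := exists_between hc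
    have hc₀0 : 0 < c₀ := (norm_nonneg _).trans_lt hc₀
    have hc₀' : (c₀ : ℂ) ≠ 0 := by exact_mod_cast hc₀0.ne'
    -- The first bound keeps the norm of the rational approximant to `q / c₀` below 1; the second
    -- gives `c₀ (1 + x) ≤ c` after scaling back.
    set x : ℝ := min (1 - ‖regRep q‖ / c₀) (c / c₀ - 1) with hx
    have hx0 : 0 < x := by
      refine lt_min ?_ ?_
      · rw [sub_pos, div_lt_one hc₀0]; exact hc₀
      · rw [sub_pos, one_lt_div hc₀0]; exact hc₀c
    set q' : MonoidAlgebra ℂ Γ := (c₀ : ℂ)⁻¹ • q with hq'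
    obtain ⟨f, hf⟩ := exists_ratElt_near q' hx0
    obtain ⟨j, rfl⟩ := he f
    have hreg : ‖regRep (ratElt (e j))‖ < 1 := by
      have h1 : regRep (ratElt (e j)) = regRep q' - regRep (q' - ratElt (e j)) := by
        rw [← regHom_apply, ← regHom_apply, ← regHom_apply, map_sub, sub_sub_cancel]
      have h2 : ‖regRep q'‖ = ‖regRep q‖ / c₀ := by
        rw [← regHom_apply, hq', map_smul, norm_smul, regHom_apply, norm_inv, Complex.norm_real,
          Real.norm_of_nonneg hc₀0.le, inv_mul_eq_div]
      rw [h1]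
      refine (norm_sub_le _ _).trans_lt ?_
      have h3 := (norm_regRep_le (q' - ratElt (e j))).trans_lt hf
      have h4 : x ≤ 1 - ‖regRep q‖ / c₀ := min_le_left _ _
      linarith
    filter_upwards [hJ.eventually_gt_atTop j] with k hk v hv
    have hvj : v ∈ (H j k)ᗮ := by
      refine Submodule.orthogonal_le ?_ hv
      exact (Finset.le_sup (f := fun j => H j k) (Finset.mem_range.2 hk)).trans le_sup_right
    have h1 : permRep (ρ k) q = (c₀ : ℂ) • (permRep (ρ k) (ratElt (e j))
        + permRep (ρ k) (q' - ratElt (e j))) := by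
      rw [← permHom_apply, ← permHom_apply, ← permHom_apply, ← map_add, add_sub_cancel, hq',
        map_smul, smul_smul, mul_inv_cancel₀ hc₀', one_smul]
    rw [h1, map_smul, map_add, smul_apply, add_apply, norm_smul, Complex.norm_real,
      Real.norm_of_nonneg hc₀0.le]
    have h2 := hH j hreg k v hvj
    have h3 := norm_permRep_apply_le (ρ k) (q' - ratElt (e j)) v
    have h4 : x ≤ c / c₀ - 1 := min_le_right _ _
    calc c₀ * ‖_ + _‖ ≤ c₀ * (‖v‖ + x * ‖v‖) := by
          refine mul_le_mul_of_nonneg_left ((norm_add_le _ _).trans (add_le_add h2 (h3.trans ?_)))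
            hc₀0.le
          gcongr
      _ = c₀ * (1 + x) * ‖v‖ := by ring
      _ ≤ c₀ * (c / c₀) * ‖v‖ := by gcongr; linarith
      _ = c * ‖v‖ := by field_simp
  · intro k
    exact Submodule.mem_sup_left (Submodule.mem_span_singleton_self _)
  · have hone : Tendsto (fun k => 1 / (d k : ℝ)) atTop (𝓝 0) :=
      (tendsto_const_nhds (x := (1 : ℝ))).div_atTop (tendsto_natCast_atTop_atTop.comp hd)
    have hlim := hone.add hJsum
    rw [add_zero] at hlim
    refine squeeze_zero (fun k => by positivity) (fun k => ?_) hlim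
    have h1 : Module.finrank ℂ (Submodule.span ℂ {onesVec (d k)} ⊔
        (Finset.range (J k)).sup fun j => H j k : Submodule ℂ (EuclideanSpace ℂ (Fin (d k))))
        ≤ 1 + ∑ j ∈ Finset.range (J k), Module.finrank ℂ (H j k) := by
      refine (Submodule.finrank_add_le_finrank_add_finrank _ _).trans (add_le_add ?_ ?_)
      · refine (finrank_span_le_card (R := ℂ) {onesVec (d k)}).trans (by simp)
      · exact finrank_sup_range_le (fun j => H j k) (J k)
    have h2 : ∑ j ∈ Finset.range (J k), |(Module.finrank ℂ (H j k) : ℝ) / d k|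
        = (∑ j ∈ Finset.range (J k), (Module.finrank ℂ (H j k) : ℝ)) / d k := by
      rw [Finset.sum_div]
      exact Finset.sum_congr rfl fun j _ => abs_of_nonneg (by positivity)
    rw [h2, ← add_div]
    gcongr
    exact_mod_cast h1

end Exceptional

/-! ### Assembly of cases (ii) and (iii) -/

section Final

variable {Γ : Type*} [Group Γ] {r : ℕ} {d : ℕ → ℕ}

theorem toLp_mem_orthogonal_onesVec {N : ℕ} {a : Fin N → ℂ}
    (ha : ∑ x, a x = 0) : WithLp.toLp 2 a ∈ (Submodule.span ℂ {onesVec N})ᗮ := by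
  rw [Submodule.mem_orthogonal_singleton_iff_inner_right, PiLp.inner_apply]
  simpa [onesVec] using ha

theorem sum_eq_zero_of_mem_orthogonal {N : ℕ} {H : Submodule ℂ (EuclideanSpace ℂ (Fin N))}
    (hH : onesVec N ∈ H) {a : Fin N → ℂ} (ha : WithLp.toLp 2 a ∈ Hᗮ) : ∑ x, a x = 0 := by
  have h := (Submodule.mem_orthogonal _ _).1 ha _ hH
  rw [PiLp.inner_apply] at h
  simpa [onesVec] using h

theorem centredEntry_eq_of_sum_eq_zero {N : ℕ} (ρ : Γ →* Equiv.Perm (Fin N)) (K : BMat r N)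
    (t : Γ) (l i : Fin r) (h : ∑ x, diagAt ρ K t x l i = 0) :
    centredEntry ρ K t l i = fun y => diagAt ρ K t y l i := by
  funext y
  rw [centredEntry, avg, Matrix.smul_apply, Matrix.sum_apply, h, smul_zero, sub_zero]

/-- Because `1 ∈ H`, entries orthogonal to `H` have mean zero. Centring leaves them unchanged, so
the centred entries still lie in `Hᗮ`. -/
theorem qErgodic_and_qMixing_of_permBound {S : Finset Γ}
    (hS : Subgroup.closure (S : Set Γ) = ⊤) {p : MatAlg r Γ} (hp : IsSelfAdj p)
    (hd : Tendsto d atTop atTop) {ρ : ∀ k, Γ →* Equiv.Perm (Fin (d k))} (hρ : ConvDistrib ρ)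
    {T : Finset Γ} {a₀ a b b₀ : ℝ} (ha₀ : a₀ < a) (hab : a < b) (hb₀ : b < b₀)
    (hAC : ACOn p a₀ b₀) {C₁ C₁' : ℝ} (hRD : HasRD Γ C₁) (hC : 2 * C₁ + 1 < C₁')
    (hFM : FourthMoment S p a b C₁')
    {φ : ∀ k, OrthonormalBasis (Fin (r * d k)) ℂ (EuclideanSpace ℂ (Fin r × Fin (d k)))}
    {ev : ∀ k, Fin (r * d k) → ℝ} (hφ : ∀ k, IsEigenbasis (matPermRep (ρ k) p) (φ k) (ev k))
    {K : ∀ k, BMat r (d k)} (hL : ∀ k, IsLocal (ρ k) T (K k)) (hK : ∀ k, IsBddOne (K k))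
    {H : ∀ k, Submodule ℂ (EuclideanSpace ℂ (Fin (d k)))} (hH : PermBound ρ H)
    (hone : ∀ k, onesVec (d k) ∈ H k)
    (hKH : ∀ k, ∀ t ∈ T, ∀ l i : Fin r,
      WithLp.toLp 2 (fun y => diagAt (ρ k) (K k) t y l i) ∈ (H k)ᗮ) :
    QErgodic ρ T φ ev K (Set.Icc a b) ∧ QMixing ρ T φ ev K (Set.Icc a b) := by
  refine qErgodic_and_qMixing_of_corr hp hd hρ hφ ha₀ hab hb₀ hAC hL hK fun t ht l i ε hε => ?_
  refine eventually_corr_le_of_permBound hS hp ha₀ hb₀ hAC hRD hC hFM hH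
    (fun k y => (hK k).norm_centredEntry_le t l i y) (fun k => ?_) t l i hε
  rw [centredEntry_eq_of_sum_eq_zero _ _ _ _ _
    (sum_eq_zero_of_mem_orthogonal (hone k) (hKH k t ht l i))]
  exact hKH k t ht l i

/-- The embedding `v ↦ E_{li} ⊗ v` of `ℂ^N` into `M_r(ℂ) ⊗ ℂ^N`. -/
def entryEmb (N : ℕ) (m : Fin r × Fin r) :
    EuclideanSpace ℂ (Fin N) →ₗ[ℂ] EuclideanSpace ℂ (Fin N × Fin r × Fin r) where
  toFun v := WithLp.toLp 2 fun w => if w.2 = m then v w.1 else 0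
  map_add' u v := by
    ext w
    by_cases h : w.2 = m <;> simp [h]
  map_smul' c v := by
    ext w
    by_cases h : w.2 = m <;> simp [h]

theorem inner_entryEmb {N : ℕ} (m : Fin r × Fin r) (v : EuclideanSpace ℂ (Fin N))
    (w : EuclideanSpace ℂ (Fin N × Fin r × Fin r)) :
    inner ℂ (entryEmb N m v) w
      = inner ℂ v (WithLp.toLp 2 fun x => w (x, m) : EuclideanSpace ℂ (Fin N)) := by
  rw [PiLp.inner_apply, PiLp.inner_apply, Fintype.sum_prod_type]
  refine Finset.sum_congr rfl fun x _ => ?_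
  rw [Finset.sum_eq_single m]
  · simp [entryEmb]
  · intro n _ hn
    simp [entryEmb, hn]
  · simp

/-- `M_r(ℂ) ⊗ H`. -/
def matTensor {N : ℕ} (r : ℕ) (H : Submodule ℂ (EuclideanSpace ℂ (Fin N))) :
    Submodule ℂ (EuclideanSpace ℂ (Fin N × Fin r × Fin r)) :=
  ⨆ m : Fin r × Fin r, H.map (entryEmb N m)

theorem finrank_matTensor_le {N : ℕ} (H : Submodule ℂ (EuclideanSpace ℂ (Fin N))) :
    Module.finrank ℂ (matTensor r H) ≤ r * r * Module.finrank ℂ H := by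
  classical
  have key (s : Finset (Fin r × Fin r)) :
      Module.finrank ℂ (s.sup fun m => H.map (entryEmb N m) :
        Submodule ℂ (EuclideanSpace ℂ (Fin N × Fin r × Fin r)))
        ≤ s.card * Module.finrank ℂ H := by
    induction s using Finset.induction_on with
    | empty => rw [Finset.sup_empty, finrank_bot]; exact Nat.zero_le _
    | insert m s hm ih =>
      rw [Finset.sup_insert, Finset.card_insert_of_notMem hm, add_mul, one_mul, add_comm]
      exact (Submodule.finrank_add_le_finrank_add_finrank _ _).trans
        (add_le_add (Submodule.finrank_map_le _ _) ih)
  have := key Finset.univ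
  rwa [Finset.sup_univ_eq_iSup, Finset.card_univ, Fintype.card_prod, Fintype.card_fin] at this

theorem toLp_apply_mem_orthogonal_of_matTensor {N : ℕ}
    {H : Submodule ℂ (EuclideanSpace ℂ (Fin N))}
    {w : EuclideanSpace ℂ (Fin N × Fin r × Fin r)} (hw : w ∈ (matTensor r H)ᗮ)
    (m : Fin r × Fin r) : WithLp.toLp 2 (fun x => w (x, m)) ∈ Hᗮ := by
  refine (Submodule.mem_orthogonal _ _).2 fun v hv => ?_
  rw [← inner_entryEmb]
  exact (Submodule.mem_orthogonal _ _).1 hw _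
    (Submodule.mem_iSup_of_mem m (Submodule.mem_map_of_mem hv))

end Final

end

end QMix

theorem theoremt {Γ : Type*} [Group Γ]
    (S : Finset Γ) (hS : Subgroup.closure (S : Set Γ) = ⊤)
    (r : ℕ) (hr : 1 ≤ r) (p : MatAlg r Γ) (hp : IsSelfAdj p)
    (d : ℕ → ℕ) (hd : Tendsto d atTop atTop)
    (ρ : ∀ k, Γ →* Equiv.Perm (Fin (d k))) (hρ : ConvDistrib ρ)
    (T : Finset Γ) :
    -- (i) asymptotically uncorrelated observables
    (∀ a₀ a b b₀ : ℝ, a₀ < a → a < b → b < b₀ → ACOn p a₀ b₀ →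
      ∀ (φ : ∀ k, OrthonormalBasis (Fin (r * d k)) ℂ (EuclideanSpace ℂ (Fin r × Fin (d k))))
        (ev : ∀ k, Fin (r * d k) → ℝ),
      (∀ k, IsEigenbasis (matPermRep (ρ k) p) (φ k) (ev k)) →
      ∀ K : ∀ k, BMat r (d k), (∀ k, IsLocal (ρ k) T (K k)) → (∀ k, IsBddOne (K k)) →
      AsympUncorr S ρ T K →
      QErgodic ρ T φ ev K (Set.Icc a b) ∧ QMixing ρ T φ ev K (Set.Icc a b)) ∧
    -- (ii) observables orthogonal to a subspace of dimension `o(N)`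
    (∃ H : ∀ k, Submodule ℂ (EuclideanSpace ℂ (Fin (d k) × Fin r × Fin r)),
      Tendsto (fun k => (Module.finrank ℂ (H k) : ℝ) / (d k : ℝ)) atTop (𝓝 0) ∧
      ∀ a₀ a b b₀ : ℝ, a₀ < a → a < b → b < b₀ → ACOn p a₀ b₀ →
      ∀ C₁ C₁' : ℝ, HasRD Γ C₁ → 2 * C₁ + 1 < C₁' → FourthMoment S p a b C₁' →
      ∀ (φ : ∀ k, OrthonormalBasis (Fin (r * d k)) ℂ (EuclideanSpace ℂ (Fin r × Fin (d k))))
        (ev : ∀ k, Fin (r * d k) → ℝ),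
      (∀ k, IsEigenbasis (matPermRep (ρ k) p) (φ k) (ev k)) →
      ∀ K : ∀ k, BMat r (d k), (∀ k, IsLocal (ρ k) T (K k)) → (∀ k, IsBddOne (K k)) →
      (∀ k, ∀ t ∈ T, diagVec (ρ k) (K k) t ∈ (H k)ᗮ) →
      QErgodic ρ T φ ev K (Set.Icc a b) ∧ QMixing ρ T φ ev K (Set.Icc a b)) ∧
    -- (iii) strong convergence and observables in `M_r(ℂ) ⊗ 1^⊥`
    (∀ a₀ a b b₀ : ℝ, a₀ < a → a < b → b < b₀ → ACOn p a₀ b₀ →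
      ∀ C₁ C₁' : ℝ, HasRD Γ C₁ → 2 * C₁ + 1 < C₁' → FourthMoment S p a b C₁' →
      ConvStrong ρ →
      ∀ (φ : ∀ k, OrthonormalBasis (Fin (r * d k)) ℂ (EuclideanSpace ℂ (Fin r × Fin (d k))))
        (ev : ∀ k, Fin (r * d k) → ℝ),
      (∀ k, IsEigenbasis (matPermRep (ρ k) p) (φ k) (ev k)) →
      ∀ K : ∀ k, BMat r (d k), (∀ k, IsLocal (ρ k) T (K k)) → (∀ k, IsBddOne (K k)) →
      (∀ k, ∀ t ∈ T, ∑ x, diagAt (ρ k) (K k) t x = 0) →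
      QErgodic ρ T φ ev K (Set.Icc a b) ∧ QMixing ρ T φ ev K (Set.Icc a b)) := by
  refine ⟨?_, ?_, ?_⟩
  · intro a₀ a b b₀ ha₀ hab hb₀ hAC φ ev hφ K hL hK hU
    exact qErgodic_and_qMixing_of_corr hp hd hρ hφ ha₀ hab hb₀ hAC hL hK
      fun t ht l i ε hε => eventually_corr_le_of_decay hp ha₀ hb₀ hAC
        (fun k y => (hK k).norm_centredEntry_le t l i y)
        (fun ε hε => hU.exists_finset hS ht l i hε) t l i hε
  -- The subspaces are built from `ρ` alone, before the interval, the eigenbases and the observables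
  -- are chosen; tensoring with `M_r(ℂ)` multiplies the dimension by at most `r²`.
  · obtain ⟨H, hH, hone, hrank⟩ := exists_permBound hS hρ hd
    refine ⟨fun k => matTensor r (H k), ?_, ?_⟩
    · have hlim := hrank.const_mul ((r : ℝ) * r)
      rw [mul_zero] at hlim
      refine squeeze_zero (fun k => by positivity) (fun k => ?_) hlim
      rw [← mul_div_assoc]
      gcongr
      exact_mod_cast finrank_matTensor_le (H k)
    · intro a₀ a b b₀ ha₀ hab hb₀ hAC C₁ C₁' hRD hC hFM φ ev hφ K hL hK hKH
      exact qErgodic_and_qMixing_of_permBound hS hp hd hρ ha₀ hab hb₀ hAC hRD hC hFM hφ hL hK hH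
        hone fun k t ht l i => toLp_apply_mem_orthogonal_of_matTensor (hKH k t ht) (l, i)
  · intro a₀ a b b₀ ha₀ hab hb₀ hAC C₁ C₁' hRD hC hFM hstrong φ ev hφ K hL hK hK0
    refine qErgodic_and_qMixing_of_permBound hS hp hd hρ ha₀ hab hb₀ hAC hRD hC hFM hφ hL hK
      hstrong.permBound (fun k => Submodule.mem_span_singleton_self _) fun k t ht l i => ?_
    refine toLp_mem_orthogonal_onesVec ?_
    rw [← Matrix.sum_apply, hK0 k t ht, Matrix.zero_apply]
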